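/- Let $0<b\le\infty$, let $J=\begin{pmatrix}0&-1\\1&0\end{pmatrix}$, and let $q$ and $w$ be $2\times2$ matrices whose entries are complex distributions of order $0$ on $(0,b)$, i.e. local complex measures, which are finite measures on $(0,c)$ for every $c<b$ (so that $0$ is a regular point). Assume that $q$ is Hermitian and that $w$ is non-negative and not identically $0$. A solution of $Ju'+qu=\lambda wu$ is a function $u:(0,b)\to\mathbb C^2$ of locally bounded variation which is balanced, $u(x)=\tfrac12\big(u^-(x)+u^+(x)\big)$ where $u^\pm$ denote the one-sided limits, and for which the local measure $Ju'+qu-\lambda wu$ on $(0,b)$ is zero. Put $\|u\|^2=\int_{(0,b)}u^*wu\in[0,\infty]$, and let $\mathcal L_0$ be the space of solutions of $Ju'+qu=0$ with $\|u\|=0$; its elements solve $Ju'+qu=\lambda wu$ for every $\lambda\in\mathbb C$. Let $n(\mu)$ be the number of linearly independent solutions of $Ju'+qu=\mu wu$ of positive finite norm, i.e. the dimension, modulo $\mathcal L_0$, of the space of solutions of finite norm. Put $B_\pm(x,\lambda)=J\pm\tfrac12\big(q(\{x\})-\lambda w(\{x\})\big)$ and $\Lambda=\{\lambda\in\mathbb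 C:\ \det B_+(x,\lambda)\det B_-(x,\lambda)=0\text{ for some }x\in(0,b)\}$; this set is symmetric with respect to the real axis. For $\lambda\notin\Lambda$ and $x\in(0,b)$ let $$\tau(x,\lambda)=\Bigg(\prod_{y\in(0,x)}\frac{\det B_-(y,\lambda)}{\det B_+(y,\lambda)}\Bigg)\exp\Big(2\mathrm i\int_{(0,x)}\big(\operatorname{Im}q_{c,12}-\lambda\operatorname{Im}w_{c,12}\big)\Big),$$ where the product runs over the countably many $y\in(0,x)$ with $q(\{y\})\ne0$ or $w(\{y\})\neq0$ (it converges unconditionally) and where $q_{c,12}$, $w_{c,12}$ are the continuous parts of the local measures $q_{12}$, $w_{12}$. Let $\lambda\in\mathbb C\setminus\mathbb R$ with $\lambda\notin\Lambda$. Let $n_+=n(\mu_+)$ and $n_-=n(\mu_-)$, where $\mu_+$ and $\mu_-$ are any points with $\operatorname{Im}\mu_+>0$ and $\operatorname{Im}\mu_-<0$ (these deficiency indices do not depend on the choice of the points). If $n_+\neq n_-$, then, as $c\to b$, one of $|\tau(c,\lambda)|$ and $|\tau(c,\overline\lambda)|$ tends to $0$ and the other tends to $\infty$. In particular, if $|\tau(c,\lambda)|$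 has no limit in $[0,\infty]$ as $c\to b$, then $n_+=n_-$. -/

import Mathlib

open MeasureTheory Set Filter Topology
open scoped ComplexOrder

/-- The open interval `(0, b)` of real numbers, where `b` may be `∞`. -/
def interval (b : EReal) : Set ℝ := {x : ℝ | 0 < x ∧ (x : EReal) < b}

/-- The filter `c → b` (from the left) on the real numbers, where `b` may be `∞`. -/
noncomputable def toEnd (b : EReal) : Filter ℝ := comap (fun x : ℝ => (x : EReal)) (𝓝[<] b)

/-- A complex local measure on `(0, b)` (equivalently, a distribution of order `0` on `(0, b)`)
which is a finite measure near the regular endpoint `0`. For `c ∈ (0, b)` the complex measure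
`on c` is its restriction to `(0, c]`; these restrictions are compatible. There need not be any
complex measure on all of `(0, b)` of which they are restrictions. (The values `on c` with
`c ∉ (0, b)` carry no meaning and are never used.) -/
structure LocalMeasure (b : EReal) where
  on : ℝ → ComplexMeasure ℝ
  restrict_on : ∀ c d : ℝ, 0 < c → c ≤ d → (d : EReal) < b →
    (on d).restrict (Ioc 0 c) = on c

namespace LocalMeasure

variable {b : EReal}

/-- The mass `m({x})` of the point `x ∈ (0, b)`. -/
noncomputable def atom (m : LocalMeasure b) (x : ℝ) : ℂ := m.on x {x}

/-- The value on `(0, x)`, `x ∈ (0, b)`, of the continuous part of `m`, i.e. of the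
restriction of `m` to the complement of its (countable) set of atoms. -/
noncomputable def contPart (m : LocalMeasure b) (x : ℝ) : ℂ :=
  m.on x {y | y ∈ Ioo 0 x ∧ m.atom y = 0}

/-- The integral `∫_{(c,d)} f dm` for `0 < c < d < b`. -/
noncomputable def integral (m : LocalMeasure b) (c d : ℝ) (f : ℝ → ℂ) : ℂ :=
  ∫ᵛ x in Ioo c d, f x ∂[ContinuousLinearMap.mul ℝ ℂ; m.on d]

end LocalMeasure

/-- The coefficients of `J u' + q u = λ w u` on `(0, b)`: matrices `q`, `w` of
distributions of order `0`, finite near `0`, with `q` Hermitian and `w` non-negative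
and not identically zero. -/
structure Coefficients (b : EReal) where
  q : Matrix (Fin 2) (Fin 2) (LocalMeasure b)
  w : Matrix (Fin 2) (Fin 2) (LocalMeasure b)
  q_hermitian : ∀ c ∈ interval b, ∀ s : Set ℝ,
    (Matrix.of fun i j => (q i j).on c s).IsHermitian
  w_nonneg : ∀ c ∈ interval b, ∀ s : Set ℝ,
    (Matrix.of fun i j => (w i j).on c s).PosSemidef
  w_ne_zero : ∃ c ∈ interval b, ∃ i j, (w i j).on c ≠ 0

namespace Coefficients

variable {b : EReal} (S : Coefficients b)

/-- The matrix `J`. -/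
def J : Matrix (Fin 2) (Fin 2) ℂ := !![0, -1; 1, 0]

/-- `Δ_q(x) = q({x})`. -/
noncomputable def Δq (x : ℝ) : Matrix (Fin 2) (Fin 2) ℂ := S.q.map fun m => m.atom x

/-- `Δ_w(x) = w({x})`. -/
noncomputable def Δw (x : ℝ) : Matrix (Fin 2) (Fin 2) ℂ := S.w.map fun m => m.atom x

/-- `B_+(x, l) = J + (Δ_q(x) - l Δ_w(x)) / 2`. -/
noncomputable def Bplus (x : ℝ) (l : ℂ) : Matrix (Fin 2) (Fin 2) ℂ :=
  J + (1 / 2 : ℂ) • (S.Δq x - l • S.Δw x)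

/-- `B_-(x, l) = J - (Δ_q(x) - l Δ_w(x)) / 2`. -/
noncomputable def Bminus (x : ℝ) (l : ℂ) : Matrix (Fin 2) (Fin 2) ℂ :=
  J - (1 / 2 : ℂ) • (S.Δq x - l • S.Δw x)

/-- The set `Λ` of those `l` for which some `B_+(x, l)` or `B_-(x, l)`, `x ∈ (0, b)`, is
not invertible. -/
def badSet : Set ℂ := {l | ∃ x ∈ interval b, (S.Bplus x l).det * (S.Bminus x l).det = 0}

/-- The function `τ(x, l)`, for `x ∈ (0, b)` and `l ∉ Λ`. The unconditional product is over all
`y ∈ (0, x)`; the factor is `1` unless `y` is one of the countably many points where `Δ_q` or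
`Δ_w` does not vanish. -/
noncomputable def tau (x : ℝ) (l : ℂ) : ℂ :=
  (∏' y : Ioo (0 : ℝ) x, (S.Bminus y l).det / (S.Bplus y l).det) *
    Complex.exp (2 * Complex.I *
      ((((S.q 0 1).contPart x).im : ℂ) - l * (((S.w 0 1).contPart x).im : ℂ)))

/-- `u` is a balanced solution of `J u' + q u = l w u` on `(0, b)`: it has locally bounded
variation, it is the average of its one-sided limits, and the local measure `J u' + q u - l w u`
vanishes, that is, it vanishes on every interval `(c, d)` with `0 < c < d < b`, where
`u'((c, d)) = u⁻(d) - u⁺(c)`. Functions on `(0, b)` are extended by zero to the real line. -/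
structure IsSolution (l : ℂ) (u : ℝ → Fin 2 → ℂ) : Prop where
  eq_zero : ∀ x ∉ interval b, u x = 0
  locallyBV : LocallyBoundedVariationOn u (interval b)
  balanced : ∀ x ∈ interval b,
    u x = (1 / 2 : ℂ) • (Function.leftLim u x + Function.rightLim u x)
  equation : ∀ c d : ℝ, 0 < c → c < d → (d : EReal) < b → ∀ i : Fin 2,
    J.mulVec (Function.leftLim u d - Function.rightLim u c) i
        + ∑ j, (S.q i j).integral c d (fun x => u x j)
      = l * ∑ j, (S.w i j).integral c d (fun x => u x j)

/-- The number `∫_{(c,d)} u* w u` for `0 < c < d < b`. -/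
noncomputable def energy (u : ℝ → Fin 2 → ℂ) (c d : ℝ) : ℝ :=
  (∑ i, ∑ j, (S.w i j).integral c d (fun x => star (u x i) * u x j)).re

/-- The squared norm `‖u‖² = ∫_{(0,b)} u* w u ∈ [0, ∞]` of a function `u` of locally bounded
variation on `(0, b)`, as the supremum of the integrals over `(c, d)` with `0 < c < d < b`. -/
noncomputable def normSq (u : ℝ → Fin 2 → ℂ) : ENNReal :=
  ⨆ (c : ℝ) (d : ℝ) (_ : 0 < c ∧ c < d ∧ (d : EReal) < b), ENNReal.ofReal (S.energy u c d)

/-- The space `𝓛₀` of solutions of `J u' + q u = 0` of norm `0`. -/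
def nullSolutions : Set (ℝ → Fin 2 → ℂ) := {u | S.IsSolution 0 u ∧ S.normSq u = 0}

/-- The solutions of `J u' + q u = l w u` that lie in `𝓛²(w)`. -/
def finiteNormSolutions (l : ℂ) : Set (ℝ → Fin 2 → ℂ) := {u | S.IsSolution l u ∧ S.normSq u < ⊤}

/-- The number of linearly independent solutions of `J u' + q u = l w u` of positive finite
norm, that is, the dimension, modulo `𝓛₀`, of the space of solutions in `𝓛²(w)`; equivalently the
dimension of the space of those solutions as a subspace of `L²(w)`. For `l` in the open upper
half-plane this is the deficiency index `n₊`, for `l` in the open lower one it is `n₋`. -/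
noncomputable def deficiencyIndex (l : ℂ) : Cardinal :=
  Module.rank ℂ ((Submodule.span ℂ (S.finiteNormSolutions l)).map
    (Submodule.span ℂ S.nullSolutions).mkQ)

end Coefficients

/-!
All coefficients are written as densities `Q`, `W = Sᴴ S` with respect to one positive measure
`ν` (`Coefficients.exists_hasDensity`), so that solutions are balanced primitives with respect
to `ν`. The product rule for balanced functions has no jump terms, and Lagrange's identity takes
the same form as for ordinary differential equations. Write `U` for the fundamental matrix at
`l` with `U(0+) = 1` and `Y` for its left-continuous version, and `V`, `Z` for those at
`star l`.

The determinant of `Y` solves a scalar Volterra equation `dF = h F dν`, whose solution is a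
product over the atoms times an exponential; this is the function `τ` (`tau_eq_det`). Lagrange's
identity says `Zᴴ J Y = J`, so that `Z` is the conjugate of `Y / det Y`. Hence
`star (τ(c, star l)) τ(c, l) = 1`, and if one of the two tends to `0`, the modulus of the other tends to `∞`.
Moreover the indefinite form `y* J y / i` of a solution at `l` and that of the conjugate
solution at `star l` differ by the factor `-|τ|⁻²`. Since the increments of the form are
multiples of the squared norm of the solution, two things follow.

* By a compactness argument of Weyl there is a nontrivial solution of finite norm at `l`, whose
  conjugate yields one at `star l` (`exists_hermForm_nonpos`, `hermForm_conj_nonpos`).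
* If all solutions at `l` have finite norm and `τ(c, l)` does not tend to `0`, then all
  solutions at `star l` have finite norm (`sqNorm_lt_top_of_not_tendsto`).

The solutions of norm zero are the same at `l` and `star l`. Therefore `n(l) ≠ n(star l)` forces
one of the two solution spaces to consist of solutions of finite norm and the other one not, and
then the determinant tends to `0` for the former (`tendsto_det_of_rank_ne`).

It remains to see that `n` is constant in the open half-planes, including the points of `Λ`. The
Weyl solutions provide a Green's function at the regular point `l`, and Lagrange's identity
shows that its Cayley transform `C` is a contraction of `L²(ν)` (`exists_contraction`). For `μ`
in the half-plane of `l` the operator `1 - ((μ - l) / (μ - star l)) C` is thus invertible, and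
it maps the solutions of finite norm at `μ` onto those at `l` (`rank_range_toVecL2_eq`). Only
regularity of `l` is used here.
-/

/-! ### Volterra equations with respect to a measure -/

/-- The iterated integrals `∫_{0 < t_k < ⋯ < t_1 < x} dν(t_1) ⋯ dν(t_k)`. -/
noncomputable def iteratedMass (ν : Measure ℝ) : ℕ → ℝ → ENNReal
  | 0, _ => 1
  | k + 1, x => ∫⁻ t in Ioo 0 x, iteratedMass ν k t ∂ν

theorem measurable_lintegral_Ioo (ν : Measure ℝ) [SFinite ν] {f : ℝ → ENNReal}
    (hf : Measurable f) : Measurable fun x => ∫⁻ t in Ioo 0 x, f t ∂ν := by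
  have h : ∀ x, ∫⁻ t in Ioo 0 x, f t ∂ν
      = ∫⁻ t, {p : ℝ × ℝ | 0 < p.2 ∧ p.2 < p.1}.indicator (fun p => f p.2) (x, t) ∂ν := by
    intro x
    rw [← lintegral_indicator measurableSet_Ioo]
    rfl
  simp_rw [h]
  refine Measurable.lintegral_prod_right' (f := fun p : ℝ × ℝ =>
    {p : ℝ × ℝ | 0 < p.2 ∧ p.2 < p.1}.indicator (fun p => f p.2) p) ?_
  refine (hf.comp measurable_snd).indicator ?_
  exact (measurableSet_lt measurable_const measurable_snd).inter
    (measurableSet_lt measurable_snd measurable_fst)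

theorem stronglyMeasurable_integral_Ioo {E : Type*} [NormedAddCommGroup E] [NormedSpace ℝ E]
    (ν : Measure ℝ) [SFinite ν] {f : ℝ → E} (hf : StronglyMeasurable f) :
    StronglyMeasurable fun x => ∫ t in Ioo 0 x, f t ∂ν := by
  have h : ∀ x, ∫ t in Ioo 0 x, f t ∂ν
      = ∫ t, {p : ℝ × ℝ | 0 < p.2 ∧ p.2 < p.1}.indicator (fun p => f p.2) (x, t) ∂ν := by
    intro x
    rw [← integral_indicator measurableSet_Ioo]
    rfl
  simp_rw [h]
  refine StronglyMeasurable.integral_prod_right' (f := fun p : ℝ × ℝ =>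
    {p : ℝ × ℝ | 0 < p.2 ∧ p.2 < p.1}.indicator (fun p => f p.2) p) ?_
  refine (hf.comp_measurable measurable_snd).indicator ?_
  exact (measurableSet_lt measurable_const measurable_snd).inter
    (measurableSet_lt measurable_snd measurable_fst)

theorem measurable_iteratedMass (ν : Measure ℝ) [SFinite ν] (k : ℕ) :
    Measurable (iteratedMass ν k) := by
  induction k with
  | zero => exact measurable_const
  | succ k ih => exact measurable_lintegral_Ioo ν ih

/-- Fubini on the square: the product of two integrals over `(0, x)` dominates the sum of the
iterated integrals over the two open triangles. -/
theorem lintegral_triangles_le (ν : Measure ℝ) [SFinite ν] {f : ℝ → ENNReal} (hf : Measurable f)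
    (x : ℝ) :
    (∫⁻ s in Ioo 0 x, (∫⁻ t in Ioo 0 s, f t ∂ν) ∂ν) + ∫⁻ t in Ioo 0 x, ν (Ioo 0 t) * f t ∂ν
      ≤ ν (Ioo 0 x) * ∫⁻ t in Ioo 0 x, f t ∂ν := by
  set m := ν.restrict (Ioo 0 x) with hm
  have e1 : ∫⁻ s in Ioo 0 x, (∫⁻ t in Ioo 0 s, f t ∂ν) ∂ν
      = ∫⁻ t, (∫⁻ s, (Ioi t).indicator (fun _ => f t) s ∂m) ∂m := by
    rw [lintegral_lintegral_swap]
    · refine setLIntegral_congr_fun measurableSet_Ioo fun s hs => ?_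
      have : Ioo 0 s = Iio s ∩ Ioo 0 x := by
        ext t; simp only [mem_Ioo, mem_inter_iff, mem_Iio]
        constructor
        · rintro ⟨h1, h2⟩; exact ⟨h2, h1, h2.trans hs.2⟩
        · rintro ⟨h1, h2, _⟩; exact ⟨h2, h1⟩
      change ∫⁻ t in Ioo 0 s, f t ∂ν = _
      rw [this, ← Measure.restrict_restrict measurableSet_Iio,
        ← lintegral_indicator measurableSet_Iio]
      refine lintegral_congr fun t => ?_
      by_cases h : t < s <;> simp [h]
    · have : Measurable (({p : ℝ × ℝ | p.1 < p.2}).indicator fun p => f p.1) :=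
        (hf.comp measurable_fst).indicator (measurableSet_lt measurable_fst measurable_snd)
      refine AEMeasurable.congr this.aemeasurable (ae_of_all _ fun p => ?_)
      simp only [Function.uncurry, indicator, mem_ofPred_eq, mem_Ioi]
  have e2 : ∫⁻ t in Ioo 0 x, ν (Ioo 0 t) * f t ∂ν
      = ∫⁻ t, (∫⁻ s, (Iio t).indicator (fun _ => f t) s ∂m) ∂m := by
    refine setLIntegral_congr_fun measurableSet_Ioo fun t ht => ?_
    rw [lintegral_indicator measurableSet_Iio, setLIntegral_const, mul_comm, hm,
      Measure.restrict_apply measurableSet_Iio]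
    congr 2
    ext s; simp only [mem_Ioo, mem_inter_iff, mem_Iio]
    constructor
    · rintro ⟨h1, h2⟩; exact ⟨h2, h1, h2.trans ht.2⟩
    · rintro ⟨h1, h2, _⟩; exact ⟨h2, h1⟩
  have e3 : ν (Ioo 0 x) * ∫⁻ t in Ioo 0 x, f t ∂ν = ∫⁻ t, (∫⁻ _, f t ∂m) ∂m := by
    simp only [lintegral_const]
    rw [lintegral_mul_const _ hf, mul_comm, hm, Measure.restrict_apply_univ]
  rw [e1, e2, e3, ← lintegral_add_left]
  · refine lintegral_mono fun t => ?_
    rw [← lintegral_add_left (measurable_const.indicator measurableSet_Ioi)]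
    refine lintegral_mono fun s => ?_
    rcases lt_trichotomy s t with h | h | h
    · simp [h, h.le]
    · simp [h]
    · simp [h, h.le]
  · simp only [lintegral_indicator measurableSet_Ioi, setLIntegral_const]
    refine hf.mul ?_
    exact (Antitone.measurable fun a c h => measure_mono (Ioi_subset_Ioi h))

theorem succ_mul_iteratedMass_le (ν : Measure ℝ) [SFinite ν] (k : ℕ) (x : ℝ) :
    (k + 1) * iteratedMass ν (k + 1) x ≤ ν (Ioo 0 x) * iteratedMass ν k x := by
  induction k generalizing x with
  | zero => simp [iteratedMass]
  | succ k ih =>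
    calc ((k + 1 : ℕ) + 1) * iteratedMass ν (k + 1 + 1) x
        = iteratedMass ν (k + 1 + 1) x
            + (∫⁻ t in Ioo 0 x, (k + 1) * iteratedMass ν (k + 1) t ∂ν) := by
          rw [lintegral_const_mul _ (measurable_iteratedMass ν _)]
          change _ = _ + (k + 1) * iteratedMass ν (k + 1 + 1) x
          push_cast; ring
      _ ≤ iteratedMass ν (k + 1 + 1) x
            + ∫⁻ t in Ioo 0 x, ν (Ioo 0 t) * iteratedMass ν k t ∂ν := by
          refine add_le_add_right (lintegral_mono fun t => ih t) _
      _ ≤ _ := lintegral_triangles_le ν (measurable_iteratedMass ν k) x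

/-- The simplex `0 < t_k < ⋯ < t_1 < x` has at most the `k!`-th part of the mass of the cube. -/
theorem factorial_mul_iteratedMass_le (ν : Measure ℝ) [SFinite ν] (k : ℕ) (x : ℝ) :
    (k.factorial : ENNReal) * iteratedMass ν k x ≤ ν (Ioo 0 x) ^ k := by
  induction k with
  | zero => simp [iteratedMass]
  | succ k ih =>
    calc ((k + 1).factorial : ENNReal) * iteratedMass ν (k + 1) x
        = k.factorial * ((k + 1) * iteratedMass ν (k + 1) x) := by
          rw [Nat.factorial_succ]; push_cast; ring
      _ ≤ k.factorial * (ν (Ioo 0 x) * iteratedMass ν k x) := by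
          exact mul_le_mul_right (succ_mul_iteratedMass_le ν k x) _
      _ = ν (Ioo 0 x) * (k.factorial * iteratedMass ν k x) := by ring
      _ ≤ ν (Ioo 0 x) * ν (Ioo 0 x) ^ k := by gcongr
      _ = _ := by ring

theorem tsum_pow_mul_iteratedMass_lt_top (ν : Measure ℝ) [SFinite ν] {x : ℝ}
    (hx : ν (Ioo 0 x) < ⊤) {C : ENNReal} (hC : C < ⊤) :
    ∑' k, C ^ k * iteratedMass ν k x < ⊤ := by
  set c := (C * ν (Ioo 0 x)).toReal
  have hc : C * ν (Ioo 0 x) = ENNReal.ofReal c :=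
    (ENNReal.ofReal_toReal (ENNReal.mul_lt_top hC hx).ne).symm
  have hb : ∀ k, C ^ k * iteratedMass ν k x ≤ ENNReal.ofReal (c ^ k / k.factorial) := by
    intro k
    have h := mul_le_mul_right (factorial_mul_iteratedMass_le ν k x) (C ^ k)
    rw [← mul_pow, hc, ← ENNReal.ofReal_pow ENNReal.toReal_nonneg] at h
    rw [ENNReal.ofReal_div_of_pos (by positivity), ENNReal.ofReal_natCast,
      ENNReal.le_div_iff_mul_le (Or.inl (by simp [Nat.factorial_ne_zero])) (Or.inl (by simp))]
    calc _ = C ^ k * (k.factorial * iteratedMass ν k x) := by ring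
      _ ≤ _ := h
  refine (ENNReal.tsum_le_tsum hb).trans_lt ?_
  exact (Real.summable_pow_div_factorial c).tsum_ofReal_lt_top

/-- Grönwall's lemma: a function bounded by a multiple of its integral over `(0, x)` vanishes. -/
theorem eq_zero_of_enorm_le_lintegral {E : Type*} [NormedAddCommGroup E] (ν : Measure ℝ)
    [SFinite ν] {d : ℝ} (hd : ν (Ioo 0 d) < ⊤) {C M : ENNReal} (hC : C < ⊤) (hM : M < ⊤)
    {z : ℝ → E} (hz : ∀ x ∈ Ioc 0 d, ‖z x‖ₑ ≤ M)
    (h : ∀ x ∈ Ioc 0 d, ‖z x‖ₑ ≤ C * ∫⁻ t in Ioo 0 x, ‖z t‖ₑ ∂ν) :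
    ∀ x ∈ Ioc 0 d, z x = 0 := by
  have key : ∀ k, ∀ x ∈ Ioc 0 d, ‖z x‖ₑ ≤ M * (C ^ k * iteratedMass ν k x) := by
    intro k
    induction k with
    | zero => intro x hx; simpa [iteratedMass] using hz x hx
    | succ k ih =>
      intro x hx
      calc ‖z x‖ₑ ≤ C * ∫⁻ t in Ioo 0 x, ‖z t‖ₑ ∂ν := h x hx
        _ ≤ C * ∫⁻ t in Ioo 0 x, M * (C ^ k * iteratedMass ν k t) ∂ν := by
            refine mul_le_mul_right ?_ _
            refine setLIntegral_mono' measurableSet_Ioo fun t ht => ih t ⟨ht.1, ht.2.le.trans hx.2⟩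
        _ = _ := by
            rw [lintegral_const_mul _ ((measurable_iteratedMass ν k).const_mul _),
              lintegral_const_mul _ (measurable_iteratedMass ν k), iteratedMass]
            ring
  intro x hx
  have hx' : ν (Ioo 0 x) < ⊤ := (measure_mono (Ioo_subset_Ioo_right hx.2)).trans_lt hd
  have hs := ENNReal.tendsto_atTop_zero_of_tsum_ne_top
    (tsum_pow_mul_iteratedMass_lt_top ν hx' hC).ne
  have h0 : Tendsto (fun k => M * (C ^ k * iteratedMass ν k x)) atTop (𝓝 0) := by
    have := ENNReal.Tendsto.const_mul hs (Or.inr hM.ne)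
    simpa using this
  have : ‖z x‖ₑ ≤ 0 := ge_of_tendsto' h0 fun k => key k x hx
  simpa using this

section Volterra

variable {n : Type*} [Fintype n]

/-- The terms of the Neumann series for the equation `y(x) = g(x) + ∫_{(0,x)} N y dν`. -/
noncomputable def neumannTerm (ν : Measure ℝ) (N : ℝ → Matrix n n ℂ) (g : ℝ → n → ℂ) :
    ℕ → ℝ → n → ℂ
  | 0 => g
  | k + 1 => fun x => ∫ t in Ioo 0 x, (N t).mulVec (neumannTerm ν N g k t) ∂ν

theorem measurable_mulVec {N : ℝ → Matrix n n ℂ} (hN : ∀ i j, Measurable fun t => N t i j)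
    {y : ℝ → n → ℂ} (hy : Measurable y) : Measurable fun t => (N t).mulVec (y t) := by
  refine measurable_pi_lambda _ fun i => ?_
  simp only [Matrix.mulVec, dotProduct]
  exact Finset.measurable_fun_sum _ fun j _ => (hN i j).mul ((measurable_pi_apply j).comp hy)

theorem enorm_mulVec_le {A : Matrix n n ℂ} {C : NNReal} (hA : ∀ i j, ‖A i j‖₊ ≤ C) (v : n → ℂ) :
    ‖A.mulVec v‖ₑ ≤ (Fintype.card n * C : NNReal) * ‖v‖ₑ := by
  have : ‖A.mulVec v‖₊ ≤ (Fintype.card n * C : NNReal) * ‖v‖₊ := by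
    rw [pi_nnnorm_le_iff]
    intro i
    calc ‖A.mulVec v i‖₊ ≤ ∑ j, ‖A i j * v j‖₊ := nnnorm_sum_le _ _
      _ ≤ ∑ _j : n, C * ‖v‖₊ := by
          refine Finset.sum_le_sum fun j _ => ?_
          rw [nnnorm_mul]
          exact mul_le_mul' (hA i j) (nnnorm_le_pi_nnnorm v j)
      _ = _ := by simp [mul_assoc]
  simpa [enorm_eq_nnnorm, ← ENNReal.coe_mul] using ENNReal.coe_le_coe.2 this

theorem measurable_neumannTerm (ν : Measure ℝ) [SFinite ν] {N : ℝ → Matrix n n ℂ}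
    (hN : ∀ i j, Measurable fun t => N t i j) {g : ℝ → n → ℂ} (hg : Measurable g) (k : ℕ) :
    Measurable (neumannTerm ν N g k) := by
  induction k with
  | zero => exact hg
  | succ k ih =>
    exact (stronglyMeasurable_integral_Ioo ν
      (measurable_mulVec hN ih).stronglyMeasurable).measurable

/-- Existence for the Volterra equation `y(x) = g(x) + ∫_{(0,x)} N y dν` on the points `x` of a
set `s` which are such that `N` and `g` are bounded on `(0, x]`. -/
theorem exists_volterra_solution (ν : Measure ℝ) [SFinite ν] {N : ℝ → Matrix n n ℂ}
    (hN : ∀ i j, Measurable fun t => N t i j) {g : ℝ → n → ℂ} (hg : Measurable g) (s : Set ℝ)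
    (hs : ∀ d ∈ s, ν (Ioo 0 d) < ⊤)
    (hNb : ∀ d ∈ s, ∃ C : NNReal, ∀ t ∈ Ioc 0 d, ∀ i j, ‖N t i j‖₊ ≤ C)
    (hgb : ∀ d ∈ s, ∃ M : NNReal, ∀ t ∈ Ioc 0 d, ‖g t‖ₑ ≤ M) :
    ∃ y : ℝ → n → ℂ, Measurable y ∧
      (∀ d ∈ s, ∃ M : NNReal, ∀ t ∈ Ioc 0 d, ‖y t‖ₑ ≤ M) ∧
      ∀ x ∈ s, 0 < x → y x = g x + ∫ t in Ioo 0 x, (N t).mulVec (y t) ∂ν := by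
  -- The solution is the Neumann series, which `iteratedMass` dominates.
  set z := neumannTerm ν N g with hz
  have hzm : ∀ k, Measurable (z k) := measurable_neumannTerm ν hN hg
  have bound : ∀ d ∈ s, ∃ C M : NNReal,
      (∀ t ∈ Ioc 0 d, ∀ v : n → ℂ, ‖(N t).mulVec v‖ₑ ≤ C * ‖v‖ₑ) ∧
      ∀ k, ∀ t ∈ Ioc 0 d, ‖z k t‖ₑ ≤ M * (C ^ k * iteratedMass ν k t) := by
    intro d hd
    obtain ⟨C, hC⟩ := hNb d hd
    obtain ⟨M, hM⟩ := hgb d hd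
    refine ⟨Fintype.card n * C, M, fun t ht v => enorm_mulVec_le (hC t ht) v, ?_⟩
    intro k
    induction k with
    | zero => intro x hx; simpa [iteratedMass, hz, neumannTerm] using hM x hx
    | succ k ih =>
      intro x hx
      calc ‖z (k + 1) x‖ₑ ≤ ∫⁻ t in Ioo 0 x, ‖(N t).mulVec (z k t)‖ₑ ∂ν :=
            enorm_integral_le_lintegral_enorm _
        _ ≤ ∫⁻ t in Ioo 0 x, (Fintype.card n * C : NNReal) *
              (M * ((Fintype.card n * C : NNReal) ^ k * iteratedMass ν k t)) ∂ν := by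
            refine setLIntegral_mono' measurableSet_Ioo fun t ht => ?_
            have ht' : t ∈ Ioc 0 d := ⟨ht.1, ht.2.le.trans hx.2⟩
            exact (enorm_mulVec_le (hC t ht') _).trans (mul_le_mul_right (ih t ht') _)
        _ = _ := by
            have hm := measurable_iteratedMass ν k
            rw [lintegral_const_mul _ ((hm.const_mul _).const_mul _),
              lintegral_const_mul _ (hm.const_mul _),
              lintegral_const_mul _ hm, iteratedMass]
            ring
  have sumb : ∀ d ∈ s, ∃ M : NNReal, ∀ t ∈ Ioc 0 d, ∑' k, ‖z k t‖ₑ ≤ M := by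
    intro d hd
    obtain ⟨C, M, -, h⟩ := bound d hd
    have hlt : (M : ENNReal) * ∑' k, (C : ENNReal) ^ k * iteratedMass ν k d < ⊤ :=
      ENNReal.mul_lt_top ENNReal.coe_lt_top
        (tsum_pow_mul_iteratedMass_lt_top ν (hs d hd) ENNReal.coe_lt_top)
    refine ⟨(M * ∑' k, (C : ENNReal) ^ k * iteratedMass ν k d).toNNReal, fun t ht => ?_⟩
    rw [ENNReal.coe_toNNReal hlt.ne, ← ENNReal.tsum_mul_left]
    refine ENNReal.tsum_le_tsum fun k => (h k t ht).trans ?_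
    gcongr
    cases k with
    | zero => exact le_rfl
    | succ k => exact lintegral_mono_set (Ioo_subset_Ioo_right ht.2)
  refine ⟨fun x => ∑' k, z k x, ?_, ?_, ?_⟩
  · exact Measurable.tsum hzm
  · intro d hd
    obtain ⟨M, hM⟩ := sumb d hd
    refine ⟨M, fun t ht => enorm_tsum_le_tsum_enorm.trans (hM t ht)⟩
  · intro x hx hx0
    obtain ⟨C, M, hC, h⟩ := bound x hx
    obtain ⟨M', hM'⟩ := sumb x hx
    have hsum : ∀ t ∈ Ioc 0 x, Summable fun k => z k t := fun t ht =>
      Summable.of_enorm ((hM' t ht).trans_lt ENNReal.coe_lt_top).ne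
    have e1 : ∫ t in Ioo 0 x, (N t).mulVec (∑' k, z k t) ∂ν
        = ∫ t in Ioo 0 x, ∑' k, (N t).mulVec (z k t) ∂ν := by
      refine setIntegral_congr_fun measurableSet_Ioo fun t ht => ?_
      exact ((LinearMap.toContinuousLinearMap (Matrix.mulVecLin (N t))).map_tsum
        (hsum t ⟨ht.1, ht.2.le⟩))
    have e2 : ∫ t in Ioo 0 x, ∑' k, (N t).mulVec (z k t) ∂ν = ∑' k, z (k + 1) x := by
      refine integral_tsum (fun k => (measurable_mulVec hN (hzm k)).aestronglyMeasurable) ?_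
      have hle : ∑' k, ∫⁻ t in Ioo 0 x, ‖(N t).mulVec (z k t)‖ₑ ∂ν
          ≤ ∫⁻ t in Ioo 0 x, C * M' ∂ν := by
        rw [← lintegral_tsum fun k => (measurable_mulVec hN (hzm k)).enorm.aemeasurable]
        refine setLIntegral_mono' measurableSet_Ioo fun t ht => ?_
        have ht' : t ∈ Ioc 0 x := ⟨ht.1, ht.2.le⟩
        calc ∑' k, ‖(N t).mulVec (z k t)‖ₑ ≤ ∑' k, C * ‖z k t‖ₑ :=
              ENNReal.tsum_le_tsum fun k => hC t ht' _
          _ ≤ _ := by rw [ENNReal.tsum_mul_left]; exact mul_le_mul_right (hM' t ht') _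
      refine (hle.trans_lt ?_).ne
      rw [setLIntegral_const]
      exact ENNReal.mul_lt_top (by finiteness) (hs x hx)
    change (∑' k, z k x) = _
    rw [e1, e2, (hsum x ⟨hx0, le_rfl⟩).tsum_eq_zero_add]
    rfl

end Volterra

/-! ### The product rule and balanced primitives -/

/-- Fubini's theorem on the square, with the diagonal shared equally by the two triangles. -/
theorem integral_mul_integral_eq_balanced (m : Measure ℝ) [IsFiniteMeasure m] {φ ψ : ℝ → ℂ}
    (hφ : Integrable φ m) (hψ : Integrable ψ m) :
    Integrable (fun t => φ t * (∫ s in Iio t, ψ s ∂m + 1 / 2 * (m.real {t} * ψ t))) m ∧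
    Integrable (fun t => (∫ s in Iio t, φ s ∂m + 1 / 2 * (m.real {t} * φ t)) * ψ t) m ∧
    (∫ t, φ t ∂m) * (∫ t, ψ t ∂m)
      = ∫ t, φ t * (∫ s in Iio t, ψ s ∂m + 1 / 2 * (m.real {t} * ψ t)) ∂m
        + ∫ t, (∫ s in Iio t, φ s ∂m + 1 / 2 * (m.real {t} * φ t)) * ψ t ∂m := by
  -- `k s t` is `1` below the diagonal, `1 / 2` on it, `0` above it.
  set k : ℝ → ℝ → ℂ := fun s t => if s < t then 1 else if s = t then 1 / 2 else 0 with hk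
  have hk1 : ∀ s t, k s t + k t s = 1 := by
    intro s t
    rcases lt_trichotomy s t with h | h | h
    · simp [hk, h, h.not_gt, h.ne']
    · simp only [hk, h, lt_self_iff_false, if_false, if_true]; norm_num
    · simp [hk, h, h.not_gt, h.ne']
  have hkb : ∀ s t, ‖k s t‖ ≤ 1 := by
    intro s t
    simp only [hk]; split_ifs <;> norm_num
  have hkm : Measurable fun p : ℝ × ℝ => k p.1 p.2 :=
    Measurable.ite (measurableSet_lt measurable_fst measurable_snd) measurable_const
      (Measurable.ite (measurableSet_eq_fun measurable_fst measurable_snd) measurable_const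
        measurable_const)
  have hkm' : Measurable fun p : ℝ × ℝ => k p.2 p.1 := hkm.comp measurable_swap
  have half : ∀ {χ : ℝ → ℂ}, Integrable χ m → ∀ t,
      ∫ s, χ s * k s t ∂m = ∫ s in Iio t, χ s ∂m + 1 / 2 * (m.real {t} * χ t) := by
    intro χ hχ t
    have : ∀ s, χ s * k s t = (Iio t).indicator χ s + 1 / 2 * ({t} : Set ℝ).indicator χ s := by
      intro s
      rcases lt_trichotomy s t with h | h | h
      · simp [hk, h, h.ne]
      · simp [hk, h]; ring
      · simp [hk, h.not_gt, h.ne']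
    simp_rw [this]
    rw [integral_add (hχ.indicator measurableSet_Iio)
      ((hχ.indicator (measurableSet_singleton t)).const_mul _), integral_const_mul,
      integral_indicator measurableSet_Iio, integral_indicator (measurableSet_singleton t),
      integral_singleton]
    simp
  have hP : Integrable (fun p : ℝ × ℝ => φ p.1 * ψ p.2) (m.prod m) := hφ.mul_prod hψ
  have hP1 : Integrable (fun p : ℝ × ℝ => φ p.1 * ψ p.2 * k p.1 p.2) (m.prod m) :=
    hP.mul_bdd hkm.aestronglyMeasurable (ae_of_all _ fun p => hkb _ _)
  have hP2 : Integrable (fun p : ℝ × ℝ => φ p.1 * ψ p.2 * k p.2 p.1) (m.prod m) :=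
    hP.mul_bdd hkm'.aestronglyMeasurable (ae_of_all _ fun p => hkb _ _)
  have i1 : ∀ t, ∫ s, φ s * ψ t * k s t ∂m
      = (∫ s in Iio t, φ s ∂m + 1 / 2 * (m.real {t} * φ t)) * ψ t := by
    intro t
    rw [← half hφ, ← integral_mul_const]
    congr 1; ext s; ring
  have i2 : ∀ s, ∫ t, φ s * ψ t * k t s ∂m
      = φ s * (∫ t in Iio s, ψ t ∂m + 1 / 2 * (m.real {s} * ψ s)) := by
    intro s
    rw [← half hψ, ← integral_const_mul]
    congr 1; ext t; ring
  have j1 := hP1.integral_prod_right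
  have j2 := hP2.integral_prod_left
  simp only [i1] at j1
  simp only [i2] at j2
  refine ⟨j2, j1, ?_⟩
  calc (∫ t, φ t ∂m) * (∫ t, ψ t ∂m) = ∫ p, φ p.1 * ψ p.2 ∂(m.prod m) :=
        (integral_prod_mul φ ψ).symm
    _ = ∫ p, φ p.1 * ψ p.2 * k p.2 p.1 + φ p.1 * ψ p.2 * k p.1 p.2 ∂(m.prod m) := by
        congr 1; ext p; rw [← mul_add, hk1, mul_one]
    _ = _ := by
        rw [integral_add hP2 hP1, integral_prod _ hP2, integral_prod_symm _ hP1]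
        simp only [i1, i2]

/-- The product rule for balanced functions: if `u` and `v` are the balanced primitives on `(c, d)`
of `φ dν` and `ψ dν`, then `u v` has the derivative `(φ v + u ψ) dν`. -/
theorem mul_eq_mul_add_integral {ν : Measure ℝ} {c d : ℝ} (hν : ν (Ioo c d) < ⊤) {φ ψ : ℝ → ℂ}
    (hφ : IntegrableOn φ (Ioo c d) ν) (hψ : IntegrableOn ψ (Ioo c d) ν) {α β : ℂ} {u v : ℝ → ℂ}
    (hu : ∀ x ∈ Ioo c d, u x = α + ∫ t in Ioo c x, φ t ∂ν + 1 / 2 * (ν.real {x} * φ x))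
    (hv : ∀ x ∈ Ioo c d, v x = β + ∫ t in Ioo c x, ψ t ∂ν + 1 / 2 * (ν.real {x} * ψ x)) :
    IntegrableOn (fun t => φ t * v t + u t * ψ t) (Ioo c d) ν ∧
    (α + ∫ t in Ioo c d, φ t ∂ν) * (β + ∫ t in Ioo c d, ψ t ∂ν)
      = α * β + ∫ t in Ioo c d, (φ t * v t + u t * ψ t) ∂ν := by
  set m := ν.restrict (Ioo c d) with hm
  have : IsFiniteMeasure m := ⟨by rw [hm, Measure.restrict_apply_univ]; exact hν⟩
  obtain ⟨j1, j2, e⟩ := integral_mul_integral_eq_balanced m hφ hψ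
  have hset : ∀ x ∈ Ioo c d, Iio x ∩ Ioo c d = Ioo c x := by
    intro x hx; ext t; simp only [mem_inter_iff, mem_Iio, mem_Ioo]
    exact ⟨fun h => ⟨h.2.1, h.1⟩, fun h => ⟨h.2, h.1, h.2.trans hx.2⟩⟩
  have hI : ∀ x ∈ Ioo c d, ∀ χ : ℝ → ℂ, ∫ t in Iio x, χ t ∂m = ∫ t in Ioo c x, χ t ∂ν := by
    intro x hx χ
    rw [hm, Measure.restrict_restrict measurableSet_Iio, hset x hx]
  have hA : ∀ x ∈ Ioo c d, m.real {x} = ν.real {x} := by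
    intro x hx
    rw [hm, measureReal_restrict_apply (measurableSet_singleton x),
      inter_eq_left.2 (singleton_subset_iff.2 hx)]
  have hk : ∀ t ∈ Ioo c d, φ t * v t + u t * ψ t = (β * φ t + α * ψ t)
      + (φ t * (∫ s in Iio t, ψ s ∂m + 1 / 2 * (m.real {t} * ψ t))
        + (∫ s in Iio t, φ s ∂m + 1 / 2 * (m.real {t} * φ t)) * ψ t) := by
    intro t ht
    rw [hu t ht, hv t ht, hI t ht, hI t ht, hA t ht]; ring
  have k1 : Integrable (fun t => β * φ t + α * ψ t) m := (hφ.const_mul β).add (hψ.const_mul α)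
  have k2 : Integrable (fun t => φ t * (∫ s in Iio t, ψ s ∂m + 1 / 2 * (m.real {t} * ψ t))
      + (∫ s in Iio t, φ s ∂m + 1 / 2 * (m.real {t} * φ t)) * ψ t) m := j1.add j2
  refine ⟨((integrableOn_congr_fun hk measurableSet_Ioo).2 (k1.add k2)), ?_⟩
  rw [setIntegral_congr_fun measurableSet_Ioo hk, ← hm, integral_add k1 k2,
    integral_add j1 j2, ← e, integral_add (hφ.const_mul β) (hψ.const_mul α),
    integral_const_mul, integral_const_mul]
  ring

section BalancedPrimitive

variable {E : Type*} [NormedAddCommGroup E] [NormedSpace ℝ E]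

/-- Dominated convergence for integrals over sets whose indicators converge pointwise. -/
theorem tendsto_setIntegral_of_eventually_mem_iff {ν : Measure ℝ} {φ : ℝ → E} {s : Set ℝ}
    (hs : MeasurableSet s) (hφ : IntegrableOn φ s ν) {ι : Type*} {l : Filter ι}
    [l.IsCountablyGenerated] {A : ι → Set ℝ} {B : Set ℝ} (hA : ∀ᶠ i in l, MeasurableSet (A i))
    (hB : MeasurableSet B) (hAs : ∀ᶠ i in l, A i ⊆ s)
    (h : ∀ t, ∀ᶠ i in l, (t ∈ A i ↔ t ∈ B)) :
    Tendsto (fun i => ∫ t in A i, φ t ∂ν) l (𝓝 (∫ t in B, φ t ∂ν)) := by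
  rw [← integral_indicator hB]
  have hφ' : AEStronglyMeasurable (s.indicator φ) ν :=
    (hφ.integrable_indicator hs).aestronglyMeasurable
  have key : Tendsto (fun i => ∫ t, (A i).indicator φ t ∂ν) l
      (𝓝 (∫ t, B.indicator φ t ∂ν)) := by
    refine tendsto_integral_filter_of_dominated_convergence (fun t => ‖s.indicator φ t‖) ?_ ?_
      (hφ.integrable_indicator hs).norm (ae_of_all _ fun t => ?_)
    · filter_upwards [hA, hAs] with i hi his
      have : (A i).indicator φ = (A i).indicator (s.indicator φ) := by
        rw [indicator_indicator, inter_eq_left.2 his]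
      rw [this]
      exact hφ'.indicator hi
    · filter_upwards [hAs] with i his
      exact ae_of_all _ fun t => norm_indicator_le_of_subset his _ _
    · refine tendsto_const_nhds.congr' ?_
      filter_upwards [h t] with i hi
      by_cases ht : t ∈ B
      · rw [indicator_of_mem ht, indicator_of_mem (hi.2 ht)]
      · rw [indicator_of_notMem ht, indicator_of_notMem fun h => ht (hi.1 h)]
  refine key.congr' ?_
  filter_upwards [hA] with i hi
  rw [integral_indicator hi]

theorem isOpen_interval (b : EReal) : IsOpen (interval b) :=
  (isOpen_lt continuous_const continuous_id).inter
    (isOpen_lt continuous_coe_real_ereal continuous_const)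

theorem interval_mem_of_le {b : EReal} {x y : ℝ} (hy : y ∈ interval b) (hx : 0 < x) (h : x ≤ y) :
    x ∈ interval b := ⟨hx, (EReal.coe_le_coe_iff.2 h).trans_lt hy.2⟩

theorem exists_gt_interval {b : EReal} {x : ℝ} (hx : x ∈ interval b) :
    ∃ d, x < d ∧ d ∈ interval b := by
  have := (isOpen_interval b).mem_nhds hx
  obtain ⟨ε, hε, h⟩ := Metric.mem_nhds_iff.1 this
  refine ⟨x + ε / 2, by linarith, h ?_⟩
  rw [Metric.mem_ball, Real.dist_eq]
  rw [abs_of_pos] <;> linarith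

variable {b : EReal} {ν : Measure ℝ} {φ : ℝ → E} {a : E} {u : ℝ → E}

theorem setIntegral_Ioc_eq_Ioo_add {x : ℝ} (hx : 0 < x) (hφ : IntegrableOn φ (Ioc 0 x) ν)
    [CompleteSpace E] :
    ∫ t in Ioc 0 x, φ t ∂ν = ∫ t in Ioo 0 x, φ t ∂ν + ν.real {x} • φ x := by
  have : Ioc 0 x = Ioo 0 x ∪ {x} := (Ioo_union_right hx).symm
  rw [this, setIntegral_union (by simp) (measurableSet_singleton x)
    (hφ.mono_set Ioo_subset_Ioc_self) (hφ.mono_set (by simp [hx])), integral_singleton]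

theorem setIntegral_Ioo_split [CompleteSpace E] {x y : ℝ} (hx : 0 < x) (hxy : x < y)
    (hφ : IntegrableOn φ (Ioc 0 y) ν) :
    ∫ t in Ioo 0 y, φ t ∂ν
      = ∫ t in Ioo 0 x, φ t ∂ν + ν.real {x} • φ x + ∫ t in Ioo x y, φ t ∂ν := by
  have hs : Ioo 0 y = Ioc 0 x ∪ Ioo x y := (Ioc_union_Ioo_eq_Ioo hx.le hxy).symm
  rw [hs, setIntegral_union _ measurableSet_Ioo (hφ.mono_set (Ioc_subset_Ioc_right hxy.le))
    (hφ.mono_set fun t ht => ⟨hx.trans ht.1, ht.2.le⟩), setIntegral_Ioc_eq_Ioo_add hx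
    (hφ.mono_set (Ioc_subset_Ioc_right hxy.le))]
  exact Set.disjoint_left.2 fun t ht ht' => ht.2.not_gt ht'.1

/-- The left limits of a balanced primitive. The function is the average of two primitives, over
`(0, x)` and over `(0, x]`, which have the same one-sided limits. -/
theorem tendsto_nhdsLT_of_balanced [CompleteSpace E]
    (hφ : ∀ d ∈ interval b, IntegrableOn φ (Ioc 0 d) ν)
    (hu : ∀ x ∈ interval b, u x = a + ∫ t in Ioo 0 x, φ t ∂ν + (1 / 2 : ℝ) • ν.real {x} • φ x)
    {x : ℝ} (hx : x ∈ interval b) :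
    Tendsto u (𝓝[<] x) (𝓝 (a + ∫ t in Ioo 0 x, φ t ∂ν)) := by
  have ev : ∀ᶠ t in 𝓝[<] x, 0 < t ∧ t < x := Ioo_mem_nhdsLT hx.1
  have hm : ∀ s, ∀ᶠ t in 𝓝[<] x, (s < x → s < t) := by
    intro s
    by_cases h : s < x
    · filter_upwards [Ioo_mem_nhdsLT h] with t ht _ using ht.1
    · exact Eventually.of_forall fun t h' => absurd h' h
  have t1 : Tendsto (fun y => ∫ t in Ioo 0 y, φ t ∂ν) (𝓝[<] x) (𝓝 (∫ t in Ioo 0 x, φ t ∂ν)) := by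
    refine tendsto_setIntegral_of_eventually_mem_iff measurableSet_Ioc (hφ x hx)
      (Eventually.of_forall fun _ => measurableSet_Ioo) measurableSet_Ioo ?_ ?_
    · filter_upwards [ev] with t ht s hs using ⟨hs.1, (hs.2.trans ht.2).le⟩
    · intro s
      filter_upwards [ev, hm s] with t ht h
      exact ⟨fun hs => ⟨hs.1, hs.2.trans ht.2⟩, fun hs => ⟨hs.1, h hs.2⟩⟩
  have t2 : Tendsto (fun y => ∫ t in Ioc 0 y, φ t ∂ν) (𝓝[<] x) (𝓝 (∫ t in Ioo 0 x, φ t ∂ν)) := by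
    refine tendsto_setIntegral_of_eventually_mem_iff measurableSet_Ioc (hφ x hx)
      (Eventually.of_forall fun _ => measurableSet_Ioc) measurableSet_Ioo ?_ ?_
    · filter_upwards [ev] with t ht s hs using ⟨hs.1, (hs.2.trans ht.2.le)⟩
    · intro s
      filter_upwards [ev, hm s] with t ht h
      exact ⟨fun hs => ⟨hs.1, hs.2.trans_lt ht.2⟩, fun hs => ⟨hs.1, (h hs.2).le⟩⟩
  have t3 := (tendsto_const_nhds (x := a)).add ((t1.add t2).const_smul (1 / 2 : ℝ))
  have e : (1 / 2 : ℝ) • (∫ t in Ioo 0 x, φ t ∂ν + ∫ t in Ioo 0 x, φ t ∂ν)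
      = ∫ t in Ioo 0 x, φ t ∂ν := by
    rw [← two_smul ℝ, smul_smul]; norm_num
  rw [e] at t3
  refine t3.congr' ?_
  filter_upwards [ev] with t ht
  have htI := interval_mem_of_le hx ht.1 ht.2.le
  rw [hu t htI, setIntegral_Ioc_eq_Ioo_add ht.1 (hφ t htI), ← add_assoc, ← two_smul ℝ, smul_add,
    smul_smul]
  norm_num [add_assoc]

theorem tendsto_nhdsGT_of_balanced [CompleteSpace E]
    (hφ : ∀ d ∈ interval b, IntegrableOn φ (Ioc 0 d) ν)
    (hu : ∀ x ∈ interval b, u x = a + ∫ t in Ioo 0 x, φ t ∂ν + (1 / 2 : ℝ) • ν.real {x} • φ x)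
    {x : ℝ} (hx : x ∈ interval b) :
    Tendsto u (𝓝[>] x) (𝓝 (a + ∫ t in Ioo 0 x, φ t ∂ν + ν.real {x} • φ x)) := by
  obtain ⟨d, hxd, hd⟩ := exists_gt_interval hx
  have ev : ∀ᶠ t in 𝓝[>] x, x < t ∧ t < d := Ioo_mem_nhdsGT hxd
  have hm : ∀ s, ∀ᶠ t in 𝓝[>] x, (x < s → t < s) := by
    intro s
    by_cases h : x < s
    · filter_upwards [Ioo_mem_nhdsGT h] with t ht _ using ht.2
    · exact Eventually.of_forall fun t h' => absurd h' h
  have t1 : Tendsto (fun y => ∫ t in Ioo 0 y, φ t ∂ν) (𝓝[>] x) (𝓝 (∫ t in Ioc 0 x, φ t ∂ν)) := by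
    refine tendsto_setIntegral_of_eventually_mem_iff measurableSet_Ioc (hφ d hd)
      (Eventually.of_forall fun _ => measurableSet_Ioo) measurableSet_Ioc ?_ ?_
    · filter_upwards [ev] with t ht s hs using ⟨hs.1, (hs.2.trans ht.2).le⟩
    · intro s
      filter_upwards [ev, hm s] with t ht h
      refine ⟨fun hs => ⟨hs.1, ?_⟩, fun hs => ⟨hs.1, hs.2.trans_lt ht.1⟩⟩
      by_contra hc
      exact absurd hs.2 (h (not_le.1 hc)).not_gt
  have t2 : Tendsto (fun y => ∫ t in Ioc 0 y, φ t ∂ν) (𝓝[>] x) (𝓝 (∫ t in Ioc 0 x, φ t ∂ν)) := by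
    refine tendsto_setIntegral_of_eventually_mem_iff measurableSet_Ioc (hφ d hd)
      (Eventually.of_forall fun _ => measurableSet_Ioc) measurableSet_Ioc ?_ ?_
    · filter_upwards [ev] with t ht s hs using ⟨hs.1, (hs.2.trans ht.2.le)⟩
    · intro s
      filter_upwards [ev, hm s] with t ht h
      refine ⟨fun hs => ⟨hs.1, ?_⟩, fun hs => ⟨hs.1, hs.2.trans ht.1.le⟩⟩
      by_contra hc
      exact absurd hs.2 (h (not_le.1 hc)).not_ge
  have t3 := (tendsto_const_nhds (x := a)).add ((t1.add t2).const_smul (1 / 2 : ℝ))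
  have e : (1 / 2 : ℝ) • (∫ t in Ioc 0 x, φ t ∂ν + ∫ t in Ioc 0 x, φ t ∂ν)
      = ∫ t in Ioc 0 x, φ t ∂ν := by
    rw [← two_smul ℝ, smul_smul]; norm_num
  rw [e, setIntegral_Ioc_eq_Ioo_add hx.1 (hφ x hx), ← add_assoc] at t3
  refine t3.congr' ?_
  filter_upwards [ev] with t ht
  have htI := interval_mem_of_le hd (hx.1.trans ht.1) ht.2.le
  rw [hu t htI, setIntegral_Ioc_eq_Ioo_add htI.1 (hφ t htI), ← add_assoc, ← two_smul ℝ, smul_add,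
    smul_smul]
  norm_num [add_assoc]

theorem eVariationOn_le_of_edist_le {F G : Type*} [PseudoEMetricSpace F] [PseudoEMetricSpace G]
    {f : ℝ → F} {g : ℝ → G} {s : Set ℝ}
    (h : ∀ x ∈ s, ∀ y ∈ s, x ≤ y → edist (f y) (f x) ≤ edist (g y) (g x)) :
    eVariationOn f s ≤ eVariationOn g s := by
  refine iSup_le fun p => le_trans ?_ (le_iSup _ p)
  exact Finset.sum_le_sum fun i _ =>
    h _ (p.2.2.2 _) _ (p.2.2.2 _) (p.2.2.1 (Nat.le_succ i))

theorem locallyBoundedVariationOn_of_balanced [CompleteSpace E]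
    (hφ : ∀ d ∈ interval b, IntegrableOn φ (Ioc 0 d) ν)
    (hu : ∀ x ∈ interval b, u x = a + ∫ t in Ioo 0 x, φ t ∂ν + (1 / 2 : ℝ) • ν.real {x} • φ x) :
    LocallyBoundedVariationOn u (interval b) := by
  -- The increments of `u` are dominated by those of the balanced primitive `g` of `‖φ‖ dν`.
  set g : ℝ → ℝ := fun x => ∫ t in Ioo 0 x, ‖φ t‖ ∂ν + (1 / 2 : ℝ) * (ν.real {x} * ‖φ x‖) with hg
  have diff : ∀ x ∈ interval b, ∀ y ∈ interval b, x ≤ y → ‖u y - u x‖ ≤ g y - g x := by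
    intro x hx y hy hxy
    rcases hxy.eq_or_lt with rfl | hlt
    · simp
    have hi := hφ y hy
    have e1 : u y - u x = (1 / 2 : ℝ) • ν.real {x} • φ x + ∫ t in Ioo x y, φ t ∂ν
        + (1 / 2 : ℝ) • ν.real {y} • φ y := by
      rw [hu x hx, hu y hy, setIntegral_Ioo_split hx.1 hlt hi]
      module
    have e2 : g y - g x = (1 / 2 : ℝ) * (ν.real {x} * ‖φ x‖) + ∫ t in Ioo x y, ‖φ t‖ ∂ν
        + (1 / 2 : ℝ) * (ν.real {y} * ‖φ y‖) := by
      simp only [hg]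
      rw [setIntegral_Ioo_split hx.1 hlt hi.norm, smul_eq_mul]
      ring
    rw [e1, e2]
    refine (norm_add₃_le).trans ?_
    have n1 : ∀ z, ‖(1 / 2 : ℝ) • ν.real {z} • φ z‖ = (1 / 2 : ℝ) * (ν.real {z} * ‖φ z‖) := by
      intro z; rw [norm_smul, norm_smul]; simp
    rw [n1, n1]
    gcongr
    exact norm_integral_le_integral_norm _
  have gmono : MonotoneOn g (interval b) := fun x hx y hy hxy =>
    sub_nonneg.1 ((norm_nonneg _).trans (diff x hx y hy hxy))
  intro x y hx hy
  refine ((eVariationOn_le_of_edist_le fun s hs t ht hst => ?_).trans_lt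
    (lt_top_iff_ne_top.2 (gmono.locallyBoundedVariationOn x y hx hy))).ne
  rw [edist_dist, edist_dist]
  refine ENNReal.ofReal_le_ofReal ?_
  rw [dist_eq_norm, Real.dist_eq]
  exact (diff s hs.1 t ht.1 hst).trans (le_abs_self _)

end BalancedPrimitive

/-! ### Densities of local measures -/

theorem exists_strictMono_cutoffs {b : EReal} (hb : 0 < b) :
    ∃ β : ℕ → ℝ, StrictMono β ∧ (∀ n, β n ∈ interval b) ∧ ∀ x ∈ interval b, ∃ n, x < β n := by
  obtain ⟨u, hu, hmem, hlim⟩ := exists_seq_strictMono_tendsto' hb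
  have hreal : ∀ n, ((u n).toReal : EReal) = u n := fun n =>
    EReal.coe_toReal (ne_top_of_lt (hmem n).2) (ne_bot_of_gt (hmem n).1)
  refine ⟨fun n => (u n).toReal, fun m n h => ?_, fun n => ⟨?_, ?_⟩, fun x hx => ?_⟩
  · rw [← EReal.coe_lt_coe_iff, hreal, hreal]; exact hu h
  · have := (hmem n).1
    rw [← hreal] at this
    exact EReal.coe_pos.1 this
  · rw [hreal]; exact (hmem n).2
  · obtain ⟨n, hn⟩ := (hlim.eventually (lt_mem_nhds hx.2)).exists
    refine ⟨n, ?_⟩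
    rw [← EReal.coe_lt_coe_iff, hreal]; exact hn

theorem isFiniteMeasure_variation_complexMeasure (c : ComplexMeasure ℝ) :
    IsFiniteMeasure c.variation := by
  have h : c.variation ≤ (ComplexMeasure.re c).totalVariation
      + (ComplexMeasure.im c).totalVariation := by
    refine VectorMeasure.variation_le_of_forall_enorm_le fun s hs => ?_
    have h1 := SignedMeasure.enorm_le_totalVariation (ComplexMeasure.re c) s
    have h2 := SignedMeasure.enorm_le_totalVariation (ComplexMeasure.im c) s
    rw [Measure.add_apply]
    refine le_trans ?_ (add_le_add h1 h2)
    have e : c s = ((c s).re : ℂ) + ((c s).im : ℂ) * Complex.I := (Complex.re_add_im _).symm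
    rw [e]
    refine (enorm_add_le _ _).trans ?_
    rw [enorm_mul]
    have e1 : ‖((c s).re : ℂ)‖ₑ = ‖(c s).re‖ₑ := by simp [enorm_eq_nnnorm]
    have e2 : ‖((c s).im : ℂ)‖ₑ = ‖(c s).im‖ₑ := by simp [enorm_eq_nnnorm]
    have e3 : ‖Complex.I‖ₑ = 1 := by simp [enorm_eq_nnnorm]
    rw [e1, e2, e3, mul_one]
    exact le_rfl
  have : IsFiniteMeasure (ComplexMeasure.re c).totalVariation := by
    unfold SignedMeasure.totalVariation; infer_instance
  have : IsFiniteMeasure (ComplexMeasure.im c).totalVariation := by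
    unfold SignedMeasure.totalVariation; infer_instance
  exact isFiniteMeasure_of_le _ h

/-- The Radon–Nikodym theorem for a complex measure dominated by a finite measure. -/
theorem ComplexMeasure.exists_density_of_variation_le (c : ComplexMeasure ℝ) (ν : Measure ℝ)
    [IsFiniteMeasure ν] (h : c.variation ≤ ν) :
    ∃ f : ℝ → ℂ, Measurable f ∧ (∀ x, ‖f x‖ ≤ 1) ∧
      ∀ s, MeasurableSet s → c s = ∫ x in s, f x ∂ν := by
  have hac : ∀ s, MeasurableSet s → ν s = 0 → c s = 0 := by
    intro s hs h0
    have := (VectorMeasure.enorm_measure_le_variation c s).trans (h s)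
    rw [h0] at this
    simpa using this
  have hre : ν.withDensityᵥ (SignedMeasure.rnDeriv (ComplexMeasure.re c) ν)
      = ComplexMeasure.re c := by
    refine SignedMeasure.withDensityᵥ_rnDeriv_eq _ _ ?_
    refine VectorMeasure.AbsolutelyContinuous.mk fun s hs h0 => ?_
    rw [Measure.toENNRealVectorMeasure_apply_measurable hs] at h0
    change (c s).re = 0
    rw [hac s hs h0]; rfl
  have him : ν.withDensityᵥ (SignedMeasure.rnDeriv (ComplexMeasure.im c) ν)
      = ComplexMeasure.im c := by
    refine SignedMeasure.withDensityᵥ_rnDeriv_eq _ _ ?_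
    refine VectorMeasure.AbsolutelyContinuous.mk fun s hs h0 => ?_
    rw [Measure.toENNRealVectorMeasure_apply_measurable hs] at h0
    change (c s).im = 0
    rw [hac s hs h0]; rfl
  set f := ComplexMeasure.rnDeriv c ν with hf
  have hfi : Integrable f ν := ComplexMeasure.integrable_rnDeriv c ν
  have hfm : Measurable f := by
    have h1 := SignedMeasure.measurable_rnDeriv (ComplexMeasure.re c) ν
    have h2 := SignedMeasure.measurable_rnDeriv (ComplexMeasure.im c) ν
    exact Complex.measurableEquivRealProd.symm.measurable.comp (h1.prodMk h2)
  have hcs : ν.withDensityᵥ f = c := by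
    ext s hs
    rw [withDensityᵥ_apply hfi hs]
    have r := setIntegral_re_add_im (𝕜 := ℂ) (hfi.integrableOn (s := s))
    have r1 : ∫ x in s, RCLike.re (f x) ∂ν = (c s).re := by
      have := congrArg (fun m : SignedMeasure ℝ => m s) hre
      simp only [withDensityᵥ_apply (SignedMeasure.integrable_rnDeriv _ _) hs] at this
      exact this
    have r2 : ∫ x in s, RCLike.im (f x) ∂ν = (c s).im := by
      have := congrArg (fun m : SignedMeasure ℝ => m s) him
      simp only [withDensityᵥ_apply (SignedMeasure.integrable_rnDeriv _ _) hs] at this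
      exact this
    rw [← r, r1, r2]
    exact Complex.re_add_im _
  have hb : ∀ᵐ x ∂ν, ‖f x‖ₑ ≤ 1 := by
    refine ae_le_of_forall_setLIntegral_le_of_sigmaFinite hfm.enorm fun s hs _ => ?_
    rw [← withDensity_apply _ hs, ← Measure.variation_withDensityᵥ hfi, hcs]
    simpa using h s
  refine ⟨{x | ‖f x‖ ≤ 1}.indicator f, ?_, fun x => ?_, fun s hs => ?_⟩
  · exact hfm.indicator (measurableSet_le hfm.norm measurable_const)
  · by_cases hx : ‖f x‖ ≤ 1
    · rwa [indicator_of_mem (by exact hx)]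
    · rw [indicator_of_notMem (by exact hx)]; simp
  · rw [← hcs, withDensityᵥ_apply hfi hs]
    refine setIntegral_congr_ae hs ?_
    filter_upwards [hb] with x hx _
    have : ‖f x‖ ≤ 1 := by
      rw [← ENNReal.coe_one, enorm_eq_nnnorm, ENNReal.coe_le_coe] at hx
      exact_mod_cast hx
    rw [indicator_of_mem (by exact this)]

theorem LocalMeasure.on_apply {b : EReal} (m : LocalMeasure b) {c d : ℝ} (hc : 0 < c) (hcd : c ≤ d)
    (hd : (d : EReal) < b) {s : Set ℝ} (hs : MeasurableSet s) :
    m.on c s = m.on d (s ∩ Ioc 0 c) := by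
  rw [← m.restrict_on c d hc hcd hd, VectorMeasure.restrict_apply _ measurableSet_Ioc hs]

/-- Finitely many local measures have bounded densities with respect to one positive measure on
`(0, b)` which is finite on `(0, d)` for every `d < b`. -/
theorem LocalMeasure.exists_density {b : EReal} (hb : 0 < b) {ι : Type} [Fintype ι]
    (m : ι → LocalMeasure b) :
    ∃ (ν : Measure ℝ) (f : ι → ℝ → ℂ), SFinite ν ∧ (∀ d ∈ interval b, ν (Ioc 0 d) < ⊤) ∧
      ν (interval b)ᶜ = 0 ∧ (∀ i, Measurable (f i)) ∧ (∀ i x, ‖f i x‖ ≤ 1) ∧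
      ∀ i, ∀ d ∈ interval b, ∀ s, MeasurableSet s →
        (m i).on d s = ∫ x in s ∩ Ioc 0 d, f i x ∂ν := by
  obtain ⟨β, hβ, hβI, hβx⟩ := exists_strictMono_cutoffs hb
  -- On the `n`-th of the disjoint pieces `P n` of `(0, b)` the measure `ν` is the sum of the
  -- variations of the `m i`. A global variation need not exist.
  set A : ℕ → Set ℝ := fun n => Ioc 0 (β n) with hA
  have hAm : Monotone A := fun n k h => Ioc_subset_Ioc_right (hβ.monotone h)
  set P := disjointed A with hP
  have hPm : ∀ n, MeasurableSet (P n) := fun n =>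
    MeasurableSet.disjointed (fun _ => measurableSet_Ioc) n
  have hPA : ∀ n, P n ⊆ A n := disjointed_subset A
  have hPd : Pairwise (Function.onFun Disjoint P) := disjoint_disjointed A
  have hPU : ⋃ n, P n = ⋃ n, A n := iUnion_disjointed
  have hPA' : ∀ n N, N < n → P n ∩ A N = ∅ := by
    intro n N h
    refine (Set.disjoint_left.2 fun x hx hxA => ?_).inter_eq
    obtain ⟨k, hk⟩ : ∃ k, n = k + 1 := ⟨n - 1, by omega⟩
    rw [hk, hP, hAm.disjointed_add_one] at hx
    exact hx.2 (hAm (show N ≤ k by omega) hxA)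
  have hAint : ⋃ n, A n = interval b := by
    ext x
    simp only [mem_iUnion, hA, mem_Ioc]
    constructor
    · rintro ⟨n, h0, h1⟩
      exact interval_mem_of_le (hβI n) h0 h1
    · intro hx
      obtain ⟨n, hn⟩ := hβx x hx
      exact ⟨n, hx.1, hn.le⟩
  set V : ι → ℕ → Measure ℝ := fun i n => ((m i).on (β n)).variation with hV
  have hVfin : ∀ i n, IsFiniteMeasure (V i n) := fun i n =>
    isFiniteMeasure_variation_complexMeasure _
  have hVr : ∀ i n N, n ≤ N → (V i N).restrict (A n) = V i n := by
    intro i n N h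
    rw [hV, ← VectorMeasure.variation_restrict measurableSet_Ioc,
      (m i).restrict_on _ _ (hβI n).1 (hβ.monotone h) (hβI N).2]
  set ν : Measure ℝ := Measure.sum fun n => (∑ i, V i n).restrict (P n) with hν
  have hVν : ∀ i N, V i N ≤ ν := by
    intro i N
    rw [← hVr i N N le_rfl]
    refine Measure.le_iff.2 fun s hs => ?_
    rw [Measure.restrict_apply hs, hν, Measure.sum_apply _ hs]
    have e : s ∩ A N = ⋃ n, (s ∩ A N) ∩ P n := by
      rw [← inter_iUnion, hPU]
      exact (inter_eq_left.2 (inter_subset_right.trans (subset_iUnion A N))).symm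
    rw [e]
    refine (measure_iUnion_le _).trans (ENNReal.tsum_le_tsum fun n => ?_)
    rcases le_or_gt n N with h | h
    · rw [Measure.restrict_apply hs, Measure.finsetSum_apply]
      calc V i N (s ∩ A N ∩ P n) ≤ V i N ((s ∩ P n) ∩ A n) :=
            measure_mono fun x hx => ⟨⟨hx.1.1, hx.2⟩, hPA n hx.2⟩
        _ = V i n (s ∩ P n) := by
            rw [← Measure.restrict_apply (hs.inter (hPm n)), hVr i n N h]
        _ ≤ ∑ j, V j n (s ∩ P n) :=
            Finset.single_le_sum (f := fun j => V j n (s ∩ P n)) (fun _ _ => zero_le)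
              (Finset.mem_univ i)
    · have : s ∩ A N ∩ P n = ∅ := by
        rw [inter_assoc, inter_comm (A N), hPA' n N h, inter_empty]
      rw [this]; simp
  have hνA : ∀ N, ν (A N) < ⊤ := by
    intro N
    rw [hν, Measure.sum_apply _ measurableSet_Ioc, tsum_eq_sum (s := Finset.range (N + 1))]
    · refine ENNReal.sum_lt_top.2 fun n _ => ?_
      have : IsFiniteMeasure (∑ i, V i n) := by infer_instance
      exact measure_lt_top _ _
    · intro n hn
      rw [Measure.restrict_apply measurableSet_Ioc, inter_comm, hPA' n N (by simpa using hn)]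
      simp
  have hνI : ν (interval b)ᶜ = 0 := by
    rw [hν, Measure.sum_apply _ (isOpen_interval b).measurableSet.compl, ENNReal.tsum_eq_zero]
    intro n
    rw [Measure.restrict_apply (isOpen_interval b).measurableSet.compl]
    have : (interval b)ᶜ ∩ P n = ∅ := by
      have hdis : Disjoint (interval b)ᶜ (P n) := Set.disjoint_left.2 fun x hx hxP =>
        hx (hAint ▸ mem_iUnion_of_mem n (hPA n hxP))
      exact hdis.inter_eq
    rw [this]; simp
  have hex : ∀ i N, ∃ f : ℝ → ℂ, Measurable f ∧ (∀ x, ‖f x‖ ≤ 1) ∧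
      ∀ s, MeasurableSet s → (m i).on (β N) s = ∫ x in s ∩ A N, f x ∂ν := by
    intro i N
    have : IsFiniteMeasure (ν.restrict (A N)) := ⟨by
      rw [Measure.restrict_apply_univ]; exact hνA N⟩
    obtain ⟨f, h1, h2, h3⟩ := ComplexMeasure.exists_density_of_variation_le ((m i).on (β N))
      (ν.restrict (A N)) (by
        change V i N ≤ _
        rw [← hVr i N N le_rfl]; exact Measure.restrict_mono le_rfl (hVν i N))
    refine ⟨f, h1, h2, fun s hs => ?_⟩
    rw [h3 s hs, Measure.restrict_restrict hs]
  choose g hgm hgb hg using hex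
  have hgi : ∀ i N M, IntegrableOn (g i N) (A M) ν := fun i N M =>
    IntegrableOn.of_bound (hνA M) (hgm i N).aestronglyMeasurable 1 (ae_of_all _ (hgb i N))
  -- The densities obtained on the sets `A N` agree almost everywhere and are glued along the
  -- pieces `P n`; each of the sums has at most one term which does not vanish.
  set f : ι → ℝ → ℂ := fun i x => ∑' n, (P n).indicator (g i n) x with hf
  have hfP : ∀ i n, ∀ x ∈ P n, f i x = g i n x := by
    intro i n x hx
    rw [hf]
    simp only
    rw [tsum_eq_single n, indicator_of_mem hx]
    intro k hk
    exact indicator_of_notMem (fun h => Set.disjoint_left.1 (hPd hk) h hx) _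
  have hagree : ∀ i n N, n ≤ N → ∀ᵐ x ∂ν, x ∈ P n → g i n x = g i N x := by
    intro i n N h
    rw [← ae_restrict_iff' (hPm n)]
    refine Integrable.ae_eq_of_forall_setIntegral_eq _ _ ((hgi i n n).mono_set (hPA n))
      ((hgi i N n).mono_set (hPA n)) fun s hs _ => ?_
    rw [Measure.restrict_restrict hs]
    have h1 := hg i n (s ∩ P n) (hs.inter (hPm n))
    have h2 := hg i N (s ∩ P n) (hs.inter (hPm n))
    have s1 : s ∩ P n ∩ A n = s ∩ P n := inter_eq_left.2 (inter_subset_right.trans (hPA n))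
    have s2 : s ∩ P n ∩ A N = s ∩ P n :=
      inter_eq_left.2 (inter_subset_right.trans ((hPA n).trans (hAm h)))
    rw [s1] at h1
    rw [s2] at h2
    rw [← h1, ← h2, (m i).on_apply (hβI n).1 (hβ.monotone h) (hβI N).2 (hs.inter (hPm n)), s1]
  have hfg : ∀ i N, ∀ᵐ x ∂ν, x ∈ A N → f i x = g i N x := by
    intro i N
    have := ae_all_iff.2 fun n : Fin (N + 1) => hagree i n N (by omega)
    filter_upwards [this] with x hx hxA
    have hxU : x ∈ ⋃ n, P n := by rw [hPU]; exact mem_iUnion_of_mem N hxA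
    obtain ⟨n, hn⟩ := mem_iUnion.1 hxU
    have hnN : n ≤ N := by
      by_contra hc
      have : x ∈ P n ∩ A N := ⟨hn, hxA⟩
      rw [hPA' n N (not_le.1 hc)] at this
      exact this
    rw [hfP i n x hn, hx ⟨n, by omega⟩ hn]
  refine ⟨ν, f, inferInstance, fun d hd => ?_, hνI, fun i => ?_, fun i x => ?_,
    fun i d hd s hs => ?_⟩
  · obtain ⟨n, hn⟩ := hβx d hd
    exact (measure_mono (Ioc_subset_Ioc_right hn.le)).trans_lt (hνA n)
  · exact Measurable.tsum fun n => (hgm i n).indicator (hPm n)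
  · by_cases hx : ∃ n, x ∈ P n
    · obtain ⟨n, hn⟩ := hx
      rw [hfP i n x hn]; exact hgb i n x
    · have : f i x = 0 := by
        rw [hf]; simp only
        rw [tsum_congr fun n => indicator_of_notMem (fun h => hx ⟨n, h⟩) (g i n)]
        simp
      rw [this]; simp
  · obtain ⟨N, hN⟩ := hβx d hd
    rw [(m i).on_apply hd.1 hN.le (hβI N).2 hs, hg i N _ (hs.inter measurableSet_Ioc)]
    have s1 : s ∩ Ioc 0 d ∩ A N = s ∩ Ioc 0 d :=
      inter_eq_left.2 (inter_subset_right.trans (Ioc_subset_Ioc_right hN.le))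
    rw [s1]
    refine setIntegral_congr_ae (hs.inter measurableSet_Ioc) ?_
    filter_upwards [hfg i N] with x hx hxs
    exact (hx ⟨hxs.2.1, hxs.2.2.trans hN.le⟩).symm

/-- Bounded measurable densities `Q` and `W` of the two coefficients with respect to a measure `ν`
on `(0, b)`, together with a factorisation `W = Sᴴ S` of the non-negative one. The factor `S` turns
`L²(w)` into a part of the space `L²(ν)` of vector-valued functions. The bounds and the algebraic
properties hold at every point, not only almost everywhere. -/
structure DensityData (b : EReal) where
  ν : Measure ℝ
  Q : ℝ → Matrix (Fin 2) (Fin 2) ℂ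
  W : ℝ → Matrix (Fin 2) (Fin 2) ℂ
  S : ℝ → Matrix (Fin 2) (Fin 2) ℂ
  sFinite : SFinite ν
  finite : ∀ d ∈ interval b, ν (Ioc 0 d) < ⊤
  compl_null : ν (interval b)ᶜ = 0
  measurable_Q : ∀ i j, Measurable fun x => Q x i j
  measurable_W : ∀ i j, Measurable fun x => W x i j
  measurable_S : ∀ i j, Measurable fun x => S x i j
  norm_Q_le : ∀ x i j, ‖Q x i j‖ ≤ 1
  norm_W_le : ∀ x i j, ‖W x i j‖ ≤ 1
  norm_S_le : ∀ x i j, ‖S x i j‖ ≤ 1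
  Q_hermitian : ∀ x, (Q x).IsHermitian
  W_eq : ∀ x, W x = (S x).conjTranspose * S x

/-- `D` consists of densities of the coefficients of `S`. -/
structure Coefficients.HasDensity {b : EReal} (S : Coefficients b) (D : DensityData b) : Prop where
  q_eq : ∀ d ∈ interval b, ∀ s, MeasurableSet s → ∀ i j,
    (S.q i j).on d s = ∫ x in s ∩ Ioc 0 d, D.Q x i j ∂D.ν
  w_eq : ∀ d ∈ interval b, ∀ s, MeasurableSet s → ∀ i j,
    (S.w i j).on d s = ∫ x in s ∩ Ioc 0 d, D.W x i j ∂D.ν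

/-- The factor `S` of `W = Sᴴ S` in the Cholesky decomposition. If `W 0 0 = 0`, the quotients are
zero by convention, which is correct since `W 0 1 = 0` for non-negative `W`. -/
noncomputable def cholesky (W : Matrix (Fin 2) (Fin 2) ℂ) : Matrix (Fin 2) (Fin 2) ℂ :=
  !![(√(W 0 0).re : ℂ), W 0 1 / (√(W 0 0).re : ℂ);
    0, (√((W 1 1).re - ‖W 0 1‖ ^ 2 / (W 0 0).re) : ℂ)]

theorem cholesky_eq {W : Matrix (Fin 2) (Fin 2) ℂ} (h : W.PosSemidef) :
    W = (cholesky W).conjTranspose * cholesky W := by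
  have h10 : W 1 0 = star (W 0 1) := (h.isHermitian.apply 1 0).symm
  have h00 := h.diag_nonneg (i := 0)
  have h11 := h.diag_nonneg (i := 1)
  have hdet := h.det_nonneg
  rw [Complex.le_def] at h00 h11 hdet
  simp only [Complex.zero_re, Complex.zero_im] at h00 h11 hdet
  obtain ⟨a0, a1⟩ := h00
  obtain ⟨d0, d1⟩ := h11
  have e00 : W 0 0 = ((W 0 0).re : ℂ) := Complex.ext (by simp) (by simp [← a1])
  have e11 : W 1 1 = ((W 1 1).re : ℂ) := Complex.ext (by simp) (by simp [← d1])
  set a := (W 0 0).re with ha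
  set d := (W 1 1).re with hd
  have hdet' : ‖W 0 1‖ ^ 2 ≤ a * d := by
    have := hdet.1
    rw [Matrix.det_fin_two, h10, e00, e11] at this
    have e : W 0 1 * star (W 0 1) = ((‖W 0 1‖ ^ 2 : ℝ) : ℂ) := by
      rw [← starRingEnd_apply, Complex.mul_conj, Complex.normSq_eq_norm_sq]
    rw [e, ← Complex.ofReal_mul, ← Complex.ofReal_sub, Complex.ofReal_re] at this
    linarith
  have hr : (√a : ℂ) * (√a : ℂ) = a := by rw [← Complex.ofReal_mul, Real.mul_self_sqrt a0]
  have k1 : W 0 1 = (√a : ℂ) * (W 0 1 / (√a : ℂ)) := by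
    rcases a0.eq_or_lt with h0 | h0
    · have : ‖W 0 1‖ ^ 2 ≤ 0 := by rw [← h0] at hdet'; linarith
      have h1 : W 0 1 = 0 := by simpa using this
      simp [h1]
    · rw [mul_div_cancel₀]
      exact_mod_cast (Real.sqrt_pos.2 h0).ne'
  have k2 : star (W 0 1 / (√a : ℂ)) * (W 0 1 / (√a : ℂ)) = ((‖W 0 1‖ ^ 2 / a : ℝ) : ℂ) := by
    rw [← starRingEnd_apply, mul_comm, Complex.mul_conj, Complex.normSq_eq_norm_sq, norm_div,
      Complex.norm_real, Real.norm_of_nonneg (Real.sqrt_nonneg _), div_pow, Real.sq_sqrt a0]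
  have k3 : 0 ≤ d - ‖W 0 1‖ ^ 2 / a := by
    rcases a0.eq_or_lt with h0 | h0
    · rw [← h0]; simpa using d0
    · rw [sub_nonneg, div_le_iff₀ h0]; linarith
  have k4 : (√(d - ‖W 0 1‖ ^ 2 / a) : ℂ) * (√(d - ‖W 0 1‖ ^ 2 / a) : ℂ)
      = ((d - ‖W 0 1‖ ^ 2 / a : ℝ) : ℂ) := by
    rw [← Complex.ofReal_mul, Real.mul_self_sqrt k3]
  have hstar : ∀ r : ℝ, star (r : ℂ) = r := fun r => Complex.conj_ofReal r
  ext i j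
  rw [Matrix.mul_apply, Fin.sum_univ_two]
  simp only [Matrix.conjTranspose_apply]
  fin_cases i <;> fin_cases j
  · change W 0 0 = star (√a : ℂ) * (√a : ℂ) + star (0 : ℂ) * 0
    rw [hstar, hr, e00]; simp
  · change W 0 1 = star (√a : ℂ) * (W 0 1 / (√a : ℂ)) + star (0 : ℂ) * _
    rw [hstar, ← k1]; simp
  · change W 1 0 = star (W 0 1 / (√a : ℂ)) * (√a : ℂ) + star (_ : ℂ) * 0
    rw [mul_zero, add_zero, h10]
    conv_lhs => rw [k1]
    rw [star_mul, hstar]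
  · change W 1 1 = star (W 0 1 / (√a : ℂ)) * (W 0 1 / (√a : ℂ))
      + star (√(d - ‖W 0 1‖ ^ 2 / a) : ℂ) * (√(d - ‖W 0 1‖ ^ 2 / a) : ℂ)
    rw [k2, hstar, k4, e11, ← Complex.ofReal_add]
    congr 1; ring

theorem norm_cholesky_le {W : Matrix (Fin 2) (Fin 2) ℂ} (h : W.PosSemidef)
    (hW : ∀ i j, ‖W i j‖ ≤ 1) (i j : Fin 2) : ‖cholesky W i j‖ ≤ 1 := by
  have e : W j j = ∑ k, star (cholesky W k j) * cholesky W k j := by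
    conv_lhs => rw [cholesky_eq h]
    simp [Matrix.mul_apply]
  have e2 : W j j = ((∑ k, ‖cholesky W k j‖ ^ 2 : ℝ) : ℂ) := by
    rw [e]; push_cast
    refine Finset.sum_congr rfl fun k _ => ?_
    rw [← starRingEnd_apply, mul_comm, Complex.mul_conj, Complex.normSq_eq_norm_sq]
    push_cast; rfl
  have h1 : ∑ k, ‖cholesky W k j‖ ^ 2 ≤ 1 := by
    have := hW j j
    rw [e2, Complex.norm_real, Real.norm_eq_abs] at this
    exact (le_abs_self _).trans this
  have h2 : ‖cholesky W i j‖ ^ 2 ≤ 1 :=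
    (Finset.single_le_sum (f := fun k => ‖cholesky W k j‖ ^ 2) (fun _ _ => by positivity)
      (Finset.mem_univ i)).trans h1
  exact (sq_le_one_iff₀ (norm_nonneg _)).1 h2

theorem measurable_cholesky {W : ℝ → Matrix (Fin 2) (Fin 2) ℂ}
    (hW : ∀ i j, Measurable fun x => W x i j) (i j : Fin 2) :
    Measurable fun x => cholesky (W x) i j := by
  have h00 : Measurable fun x => ((√(W x 0 0).re : ℝ) : ℂ) :=
    Complex.measurable_ofReal.comp (Complex.measurable_re.comp (hW 0 0)).sqrt
  fin_cases i <;> fin_cases j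
  · exact h00
  · exact (hW 0 1).div h00
  · exact measurable_const
  · refine Complex.measurable_ofReal.comp (Measurable.sqrt ?_)
    exact (Complex.measurable_re.comp (hW 1 1)).sub
      (((hW 0 1).norm.pow_const 2).div (Complex.measurable_re.comp (hW 0 0)))

theorem exists_measurableSet_of_ae {ν : Measure ℝ} {p : ℝ → Prop} (h : ∀ᵐ x ∂ν, p x) :
    ∃ G, MeasurableSet G ∧ (∀ x ∈ G, p x) ∧ ν Gᶜ = 0 := by
  obtain ⟨t, h1, h2, h3⟩ := exists_measurable_superset_of_null (ae_iff.1 h)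
  refine ⟨tᶜ, h2.compl, fun x hx => ?_, by rwa [compl_compl]⟩
  by_contra hp
  exact hx (h1 hp)

/-- The coefficients have densities. That `w` is non-negative on sets yields that its density is
non-negative almost everywhere; on the exceptional null set both densities are replaced by zero. -/
theorem Coefficients.exists_hasDensity {b : EReal} (hb : 0 < b) (S : Coefficients b) :
    ∃ D : DensityData b, S.HasDensity D := by
  obtain ⟨ν, f, hsf, hfin, hnull, hfm, hf1, hf⟩ := LocalMeasure.exists_density hb
    (fun i : Bool × Fin 2 × Fin 2 => if i.1 then S.q i.2.1 i.2.2 else S.w i.2.1 i.2.2)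
  set Q : ℝ → Matrix (Fin 2) (Fin 2) ℂ := fun x => Matrix.of fun i j => f (true, i, j) x with hQ
  set W : ℝ → Matrix (Fin 2) (Fin 2) ℂ := fun x => Matrix.of fun i j => f (false, i, j) x with hW
  have hq : ∀ d ∈ interval b, ∀ s, MeasurableSet s → ∀ i j,
      (S.q i j).on d s = ∫ x in s ∩ Ioc 0 d, Q x i j ∂ν := fun d hd s hs i j =>
    hf (true, i, j) d hd s hs
  have hw : ∀ d ∈ interval b, ∀ s, MeasurableSet s → ∀ i j,
      (S.w i j).on d s = ∫ x in s ∩ Ioc 0 d, W x i j ∂ν := fun d hd s hs i j =>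
    hf (false, i, j) d hd s hs
  obtain ⟨β, hβ, hβI, hβx⟩ := exists_strictMono_cutoffs hb
  have hcov : ∀ {p : ℝ → Prop}, (∀ n, ∀ᵐ x ∂(ν.restrict (Ioc 0 (β n))), p x) → ∀ᵐ x ∂ν, p x := by
    intro p h
    have h1 := ae_all_iff.2 fun n => (ae_restrict_iff' measurableSet_Ioc).1 (h n)
    have h2 : ∀ᵐ x ∂ν, x ∈ interval b := hnull
    filter_upwards [h1, h2] with x hx hxI
    obtain ⟨n, hn⟩ := hβx x hxI
    exact hx n ⟨hxI.1, hn.le⟩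
  have hint : ∀ (g : ℝ → ℂ), Measurable g → (∀ x, ‖g x‖ ≤ 1) → ∀ n,
      IntegrableOn g (Ioc 0 (β n)) ν := fun g hg hg1 n =>
    IntegrableOn.of_bound (hfin _ (hβI n)) hg.aestronglyMeasurable 1 (ae_of_all _ hg1)
  have hherm : ∀ k : Bool, (∀ n s, MeasurableSet s → ∀ i j,
      star (∫ x in s ∩ Ioc 0 (β n), f (k, j, i) x ∂ν) = ∫ x in s ∩ Ioc 0 (β n), f (k, i, j) x ∂ν) →
      ∀ᵐ x ∂ν, (Matrix.of fun i j => f (k, i, j) x).IsHermitian := by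
    intro k hk
    have : ∀ i j, ∀ᵐ x ∂ν, star (f (k, j, i) x) = f (k, i, j) x := by
      refine fun i j => hcov fun n => ?_
      have i1 : IntegrableOn (fun x => star (f (k, j, i) x)) (Ioc 0 (β n)) ν :=
        hint _ (continuous_star.measurable.comp (hfm _))
          (fun x => (norm_star _).le.trans (hf1 _ x)) n
      refine Integrable.ae_eq_of_forall_setIntegral_eq _ _ i1
        (hint _ (hfm _) (hf1 _) n) fun s hs _ => ?_
      rw [Measure.restrict_restrict hs, ← hk n s hs]
      exact integral_conj
    filter_upwards [ae_all_iff.2 fun i => ae_all_iff.2 (this i)] with x hx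
    exact Matrix.IsHermitian.ext hx
  have hQh : ∀ᵐ x ∂ν, (Q x).IsHermitian := by
    refine hherm true fun n s hs i j => ?_
    have := (S.q_hermitian _ (hβI n) s).apply i j
    simp only [Matrix.of_apply] at this
    rwa [hq _ (hβI n) s hs, hq _ (hβI n) s hs] at this
  have hWh : ∀ᵐ x ∂ν, (W x).IsHermitian := by
    refine hherm false fun n s hs i j => ?_
    have := (S.w_nonneg _ (hβI n) s).isHermitian.apply i j
    simp only [Matrix.of_apply] at this
    rwa [hw _ (hβI n) s hs, hw _ (hβI n) s hs] at this
  have hWp : ∀ᵐ x ∂ν, (W x).PosSemidef := by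
    -- Non-negativity is tested on countably many vectors only.
    have key : ∀ ξ : Fin 2 → ℂ, ∀ᵐ x ∂ν, 0 ≤ star ξ ⬝ᵥ (W x).mulVec ξ := by
      refine fun ξ => hcov fun n => ?_
      have hI : IntegrableOn (fun x => star ξ ⬝ᵥ (W x).mulVec ξ) (Ioc 0 (β n)) ν := by
        simp only [dotProduct, Matrix.mulVec]
        refine integrable_finsetSum _ fun i _ => Integrable.const_mul ?_ _
        exact integrable_finsetSum _ fun j _ => (hint _ (hfm _) (hf1 _) n).mul_const _
      have hset : ∀ s, MeasurableSet s →
          0 ≤ ∫ x in s ∩ Ioc 0 (β n), star ξ ⬝ᵥ (W x).mulVec ξ ∂ν := by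
        intro s hs
        have h1 := (S.w_nonneg _ (hβI n) s).dotProduct_mulVec_nonneg ξ
        convert h1 using 1
        simp only [dotProduct, Matrix.mulVec, Matrix.of_apply]
        have hI' : ∀ i j, IntegrableOn (fun x => W x i j * ξ j) (s ∩ Ioc 0 (β n)) ν := fun i j =>
          IntegrableOn.mono_set ((hint _ (hfm _) (hf1 _) n).mul_const _) inter_subset_right
        rw [integral_finsetSum _ fun i _ =>
          (integrable_finsetSum _ fun j _ => hI' i j).const_mul _]
        refine Finset.sum_congr rfl fun i _ => ?_
        rw [integral_const_mul, integral_finsetSum _ fun j _ => hI' i j]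
        congr 1
        refine Finset.sum_congr rfl fun j _ => ?_
        rw [integral_mul_const, hw _ (hβI n) s hs]
      have hre : ∀ᵐ x ∂(ν.restrict (Ioc 0 (β n))), 0 ≤ (star ξ ⬝ᵥ (W x).mulVec ξ).re := by
        refine ae_nonneg_of_forall_setIntegral_nonneg hI.re fun s hs _ => ?_
        have := hset s hs
        rw [Measure.restrict_restrict hs]
        have e := integral_re (𝕜 := ℂ) (hI.mono_set (inter_subset_right (s := s)))
        refine le_of_le_of_eq ?_ e.symm
        exact (Complex.le_def.1 this).1
      have him : ∀ᵐ x ∂(ν.restrict (Ioc 0 (β n))), (star ξ ⬝ᵥ (W x).mulVec ξ).im = 0 := by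
        refine Integrable.ae_eq_of_forall_setIntegral_eq _ (fun _ => (0 : ℝ)) hI.im
          (integrable_zero _ _ _) fun s hs _ => ?_
        have := hset s hs
        rw [Measure.restrict_restrict hs]
        have e := integral_im (𝕜 := ℂ) (hI.mono_set (inter_subset_right (s := s)))
        rw [integral_zero]
        refine e.trans ?_
        exact (Complex.le_def.1 this).2.symm
      filter_upwards [hre, him] with x h1 h2
      exact Complex.le_def.2 ⟨h1, h2.symm⟩
    filter_upwards [ae_all_iff.2 fun n => key (TopologicalSpace.denseSeq (Fin 2 → ℂ) n), hWh] with
      x hx hxh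
    have hall : ∀ ξ : Fin 2 → ℂ, 0 ≤ star ξ ⬝ᵥ (W x).mulVec ξ := by
      intro ξ
      have hc : Continuous fun ξ : Fin 2 → ℂ => star ξ ⬝ᵥ (W x).mulVec ξ := by
        unfold dotProduct Matrix.mulVec
        unfold dotProduct
        fun_prop
      have hcl : IsClosed {ξ : Fin 2 → ℂ | 0 ≤ star ξ ⬝ᵥ (W x).mulVec ξ} :=
        isClosed_le continuous_const hc
      have := (TopologicalSpace.denseRange_denseSeq (Fin 2 → ℂ)).closure_range
      have hsub : closure (range (TopologicalSpace.denseSeq (Fin 2 → ℂ)))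
          ⊆ {ξ : Fin 2 → ℂ | 0 ≤ star ξ ⬝ᵥ (W x).mulVec ξ} :=
        closure_minimal (range_subset_iff.2 hx) hcl
      rw [this] at hsub
      exact hsub (mem_univ ξ)
    exact Matrix.posSemidef_iff_dotProduct_mulVec.2 ⟨hxh, hall⟩
  obtain ⟨G, hGm, hG, hG0⟩ := exists_measurableSet_of_ae (hQh.and hWp)
  classical
  set Q' : ℝ → Matrix (Fin 2) (Fin 2) ℂ := fun x => if x ∈ G then Q x else 0 with hQ'
  set W' : ℝ → Matrix (Fin 2) (Fin 2) ℂ := fun x => if x ∈ G then W x else 0 with hW'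
  have hQm' : ∀ i j, Measurable fun x => Q' x i j := by
    intro i j
    have : (fun x => Q' x i j) = fun x => if x ∈ G then Q x i j else 0 := by
      ext x; simp only [hQ']; split_ifs <;> rfl
    rw [this]
    exact Measurable.ite hGm (hfm _) measurable_const
  have hWm' : ∀ i j, Measurable fun x => W' x i j := by
    intro i j
    have : (fun x => W' x i j) = fun x => if x ∈ G then W x i j else 0 := by
      ext x; simp only [hW']; split_ifs <;> rfl
    rw [this]
    exact Measurable.ite hGm (hfm _) measurable_const
  have hWP' : ∀ x, (W' x).PosSemidef := by
    intro x; simp only [hW']; split_ifs with h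
    · exact (hG x h).2
    · exact Matrix.PosSemidef.zero
  have hW1' : ∀ x i j, ‖W' x i j‖ ≤ 1 := by
    intro x i j; simp only [hW']; split_ifs with h
    · exact hf1 _ x
    · simp
  have hGae : ∀ᵐ x ∂ν, x ∈ G := hG0
  refine ⟨{ ν := ν, Q := Q', W := W', S := fun x => cholesky (W' x), sFinite := hsf, finite := hfin,
            compl_null := hnull, measurable_Q := hQm', measurable_W := hWm',
            measurable_S := measurable_cholesky hWm', norm_Q_le := ?_, norm_W_le := hW1',
            norm_S_le := fun x i j => norm_cholesky_le (hWP' x) (hW1' x) i j,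
            Q_hermitian := ?_, W_eq := fun x => cholesky_eq (hWP' x) }, ?_, ?_⟩
  · intro x i j; simp only [hQ']; split_ifs with h
    · exact hf1 _ x
    · simp
  · intro x; simp only [hQ']; split_ifs with h
    · exact (hG x h).1
    · exact Matrix.isHermitian_zero
  · intro d hd s hs i j
    rw [hq d hd s hs]
    refine integral_congr_ae (ae_restrict_of_ae ?_)
    filter_upwards [hGae] with x hx
    simp [hQ', hx]
  · intro d hd s hs i j
    rw [hw d hd s hs]
    refine integral_congr_ae (ae_restrict_of_ae ?_)
    filter_upwards [hGae] with x hx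
    simp [hW', hx]

/-! ### Integrals with respect to local measures -/

/-- The integral of `g` with respect to a complex measure with density `f` is `∫ g f dμ`. -/
theorem vectorMeasure_integral_eq_integral_mul (c : ComplexMeasure ℝ) (μ : Measure ℝ)
    [IsFiniteMeasure μ] {f : ℝ → ℂ} (hf : Measurable f) (hf1 : ∀ x, ‖f x‖ ≤ 1)
    (hc : ∀ s, MeasurableSet s → c s = ∫ x in s, f x ∂μ) {g : ℝ → ℂ} (hg : Integrable g μ) :
    ∫ᵛ x, g x ∂[ContinuousLinearMap.mul ℝ ℂ; c] = ∫ x, g x * f x ∂μ := by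
  have hvar : c.variation ≤ μ := by
    refine VectorMeasure.variation_le_of_forall_enorm_le fun s hs => ?_
    rw [hc s hs]
    refine (enorm_integral_le_lintegral_enorm _).trans ?_
    calc ∫⁻ x in s, ‖f x‖ₑ ∂μ ≤ ∫⁻ _ in s, 1 ∂μ := by
          refine lintegral_mono fun x => ?_
          rw [enorm_eq_nnnorm, ← ENNReal.coe_one, ENNReal.coe_le_coe]
          exact_mod_cast hf1 x
      _ = μ s := by simp
  have hfin : IsFiniteMeasure c.variation := isFiniteMeasure_of_le _ hvar
  have hfi : Integrable f μ := Integrable.of_bound hf.aestronglyMeasurable 1 (ae_of_all _ hf1)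
  have hmul : ∀ {g : ℝ → ℂ}, Integrable g μ → Integrable (fun x => g x * f x) μ := fun hg =>
    hg.mul_bdd hf.aestronglyMeasurable (ae_of_all _ hf1)
  refine Integrable.induction (P := fun g => ∫ᵛ x, g x ∂[ContinuousLinearMap.mul ℝ ℂ; c]
    = ∫ x, g x * f x ∂μ) ?_ ?_ ?_ ?_ hg
  · intro a s hs _
    rw [VectorMeasure.integral_indicator hs, VectorMeasure.setIntegral_const]
    have : ∀ x, s.indicator (fun _ => a) x * f x = s.indicator (fun x => a * f x) x := fun x => by
      by_cases h : x ∈ s <;> simp [h]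
    simp_rw [this]
    rw [integral_indicator hs, integral_const_mul, hc s hs]
    rfl
  · intro g h _ hg hh eg eh
    rw [VectorMeasure.integral_add (hg.mono_measure hvar) (hh.mono_measure hvar), eg, eh,
      ← integral_add (hmul hg) (hmul hh)]
    simp [add_mul]
  · refine isClosed_eq ?_ ?_
    · refine LipschitzWith.continuous (K := ‖ContinuousLinearMap.mul ℝ ℂ‖₊) fun g h => ?_
      refine (VectorMeasure.edist_integral_le_lintegral_edist
        ((L1.integrable_coeFn g).mono_measure hvar)
        ((L1.integrable_coeFn h).mono_measure hvar)).trans ?_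
      rw [enorm_eq_nnnorm]
      gcongr
      rw [L1.edist_def]
      exact lintegral_mono' hvar le_rfl
    · refine LipschitzWith.continuous (K := 1) fun g h => ?_
      rw [edist_eq_enorm_sub, ← integral_sub (hmul (L1.integrable_coeFn g))
        (hmul (L1.integrable_coeFn h)), L1.edist_def, ENNReal.coe_one, one_mul]
      refine (enorm_integral_le_lintegral_enorm _).trans (lintegral_mono fun x => ?_)
      rw [← sub_mul, enorm_mul, edist_eq_enorm_sub]
      refine (mul_le_mul_right ?_ _).trans (mul_one _).le
      rw [enorm_eq_nnnorm, ← ENNReal.coe_one, ENNReal.coe_le_coe]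
      exact_mod_cast hf1 x
  · intro g h hgh hg e
    rw [← VectorMeasure.integral_congr_ae
      (hgh.filter_mono (Measure.absolutelyContinuous_of_le hvar).ae_le), e]
    refine integral_congr_ae ?_
    filter_upwards [hgh] with x hx
    rw [hx]

theorem LocalMeasure.integral_eq {b : EReal} (m : LocalMeasure b) {ν : Measure ℝ} {f : ℝ → ℂ}
    (hf : Measurable f) (hf1 : ∀ x, ‖f x‖ ≤ 1) {c d : ℝ} (hc : 0 < c) (hν : ν (Ioc 0 d) < ⊤)
    (hm : ∀ s, MeasurableSet s → m.on d s = ∫ x in s ∩ Ioc 0 d, f x ∂ν) {g : ℝ → ℂ}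
    (hg : IntegrableOn g (Ioo c d) ν) :
    m.integral c d g = ∫ x in Ioo c d, g x * f x ∂ν := by
  have hsub : Ioo c d ⊆ Ioc 0 d := fun x hx => ⟨hc.trans hx.1, hx.2.le⟩
  have : IsFiniteMeasure (ν.restrict (Ioo c d)) :=
    ⟨by rw [Measure.restrict_apply_univ]; exact (measure_mono hsub).trans_lt hν⟩
  refine vectorMeasure_integral_eq_integral_mul _ _ hf hf1 (fun s hs => ?_) hg
  rw [VectorMeasure.restrict_apply _ measurableSet_Ioo hs, hm _ (hs.inter measurableSet_Ioo),
    Measure.restrict_restrict hs, inter_eq_left.2 (inter_subset_right.trans hsub)]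

/-- On a compact subinterval, a function of locally bounded variation is bounded and measurable: its
real and imaginary parts are differences of monotone functions. -/
theorem LocallyBoundedVariationOn.aemeasurable_and_exists_bound {b : EReal} {u : ℝ → Fin 2 → ℂ}
    (hu : LocallyBoundedVariationOn u (interval b)) {ν : Measure ℝ}
    {c d : ℝ} (hc : 0 < c) (hd : d ∈ interval b) :
    AEMeasurable u (ν.restrict (Ioo c d)) ∧ ∃ M, ∀ x ∈ Ioo c d, ‖u x‖ ≤ M := by
  have hsub : Icc c d ⊆ interval b := fun x hx =>
    interval_mem_of_le hd (hc.trans_le hx.1) hx.2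
  constructor
  · refine aemeasurable_pi_lambda _ fun i => ?_
    have key : ∀ p : (Fin 2 → ℂ) → ℝ, LipschitzWith 1 p →
        AEMeasurable (fun x => p (u x)) (ν.restrict (Ioo c d)) := by
      intro p hp
      have hbv : LocallyBoundedVariationOn (fun x => p (u x)) (interval b) :=
        hp.comp_locallyBoundedVariationOn hu
      obtain ⟨f, g, hf, hg, hfg⟩ := hbv.exists_monotoneOn_sub_monotoneOn
      rw [hfg]
      have hsub' : Ioo c d ⊆ interval b := Ioo_subset_Icc_self.trans hsub
      exact (aemeasurable_restrict_of_monotoneOn measurableSet_Ioo (hf.mono hsub')).sub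
        (aemeasurable_restrict_of_monotoneOn measurableSet_Ioo (hg.mono hsub'))
    have h1 := key (fun v => (v i).re) (LipschitzWith.of_dist_le_mul fun v w => by
      rw [Real.dist_eq, ← Complex.sub_re, NNReal.coe_one, one_mul, dist_eq_norm]
      exact (Complex.abs_re_le_norm _).trans (norm_le_pi_norm (v - w) i))
    have h2 := key (fun v => (v i).im) (LipschitzWith.of_dist_le_mul fun v w => by
      rw [Real.dist_eq, ← Complex.sub_im, NNReal.coe_one, one_mul, dist_eq_norm]
      exact (Complex.abs_im_le_norm _).trans (norm_le_pi_norm (v - w) i))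
    have h3 := (Complex.measurable_ofReal.comp_aemeasurable h1).add
      ((Complex.measurable_ofReal.comp_aemeasurable h2).mul_const Complex.I)
    refine h3.congr (ae_of_all _ fun x => ?_)
    exact Complex.re_add_im _
  · by_cases hcd : c ≤ d
    · have hbv := hu c d (hsub ⟨le_rfl, hcd⟩) hd
      have hbv' : BoundedVariationOn u (interval b ∩ Icc c d) := hbv
      refine ⟨‖u c‖ + (eVariationOn u (interval b ∩ Icc c d)).toReal, fun x hx => ?_⟩
      have h1 : dist (u x) (u c) ≤ _ := hbv'.dist_le ⟨hsub ⟨hx.1.le, hx.2.le⟩, hx.1.le, hx.2.le⟩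
        ⟨hsub ⟨le_rfl, hcd⟩, le_rfl, hcd⟩
      rw [dist_eq_norm] at h1
      have := norm_le_norm_add_norm_sub' (u x) (u c)
      linarith
    · exact ⟨0, fun x hx => absurd (hx.1.trans hx.2).le hcd⟩

/-! ### Solutions in integral form and Lagrange's identity -/

/-- The sesquilinear form `z* J y`. -/
def sympForm (z y : Fin 2 → ℂ) : ℂ := star (z 1) * y 0 - star (z 0) * y 1

/-- `u` is, on `(c, d)`, the balanced primitive of `φ dν` with right limit `y` at `c`. -/
def IsPrimitiveOn (ν : Measure ℝ) (c d : ℝ) (y : Fin 2 → ℂ) (φ u : ℝ → Fin 2 → ℂ) : Prop :=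
  IntegrableOn φ (Ioo c d) ν ∧
    ∀ x ∈ Ioo c d, u x = y + ∫ t in Ioo c x, φ t ∂ν + (1 / 2 : ℝ) • ν.real {x} • φ x

theorem integral_pi_apply {μ : Measure ℝ} {φ : ℝ → Fin 2 → ℂ} (h : Integrable φ μ) (i : Fin 2) :
    (∫ t, φ t ∂μ) i = ∫ t, φ t i ∂μ :=
  eval_integral (fun j => h.eval j) i

theorem IsPrimitiveOn.apply {ν : Measure ℝ} {c d : ℝ} {y : Fin 2 → ℂ} {φ u : ℝ → Fin 2 → ℂ}
    (h : IsPrimitiveOn ν c d y φ u) (i : Fin 2) {x : ℝ} (hx : x ∈ Ioo c d) :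
    u x i = y i + ∫ t in Ioo c x, φ t i ∂ν + 1 / 2 * (ν.real {x} * φ x i) := by
  rw [h.2 x hx, ← integral_pi_apply (h.1.mono_set (Ioo_subset_Ioo_right hx.2.le))]
  simp [Complex.real_smul]

/-- Integration by parts for `z* J y`; the averaging at the atoms makes it free of jump terms. -/
theorem IsPrimitiveOn.sympForm_eq {ν : Measure ℝ} {c d : ℝ} (hν : ν (Ioo c d) < ⊤)
    {y z : Fin 2 → ℂ} {φ ψ u v : ℝ → Fin 2 → ℂ} (hu : IsPrimitiveOn ν c d y φ u)
    (hv : IsPrimitiveOn ν c d z ψ v) :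
    IntegrableOn (fun t => sympForm (ψ t) (u t) + sympForm (v t) (φ t)) (Ioo c d) ν ∧
    sympForm (z + ∫ t in Ioo c d, ψ t ∂ν) (y + ∫ t in Ioo c d, φ t ∂ν)
      = sympForm z y + ∫ t in Ioo c d, (sympForm (ψ t) (u t) + sympForm (v t) (φ t)) ∂ν := by
  have hψ : ∀ i, IntegrableOn (fun t => star (ψ t i)) (Ioo c d) ν := fun i =>
    (LinearIsometryEquiv.integrable_comp_iff (Complex.conjLIE)).2 (hv.1.eval i)
  have hvs : ∀ i, ∀ x ∈ Ioo c d, star (v x i)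
      = star (z i) + ∫ t in Ioo c x, star (ψ t i) ∂ν + 1 / 2 * (ν.real {x} * star (ψ x i)) := by
    intro i x hx
    have : ∫ t in Ioo c x, star (ψ t i) ∂ν = star (∫ t in Ioo c x, ψ t i ∂ν) := integral_conj
    rw [hv.apply i hx, this]
    simp
  have hend : ∀ i, star ((z + ∫ t in Ioo c d, ψ t ∂ν) i)
      = star (z i) + ∫ t in Ioo c d, star (ψ t i) ∂ν := by
    intro i
    have : ∫ t in Ioo c d, star (ψ t i) ∂ν = star (∫ t in Ioo c d, ψ t i ∂ν) := integral_conj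
    rw [Pi.add_apply, integral_pi_apply hv.1, this, star_add]
  obtain ⟨i1, e1⟩ := mul_eq_mul_add_integral hν (hψ 1) (hu.1.eval 0) (hvs 1)
    (fun x hx => hu.apply 0 hx)
  obtain ⟨i0, e0⟩ := mul_eq_mul_add_integral hν (hψ 0) (hu.1.eval 1) (hvs 0)
    (fun x hx => hu.apply 1 hx)
  have hpt : ∀ t, sympForm (ψ t) (u t) + sympForm (v t) (φ t)
      = (star (ψ t 1) * u t 0 + star (v t 1) * φ t 0)
        - (star (ψ t 0) * u t 1 + star (v t 0) * φ t 1) := by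
    intro t; simp only [sympForm]; ring
  simp_rw [hpt]
  refine ⟨i1.sub i0, ?_⟩
  rw [integral_sub i1 i0]
  simp only [sympForm, hend]
  rw [Pi.add_apply, Pi.add_apply, integral_pi_apply hu.1, integral_pi_apply hu.1, e1, e0]
  ring

namespace DensityData

variable {b : EReal} (D : DensityData b)

instance : SFinite D.ν := D.sFinite

/-- The density `Q - l W` of `q - l w`. -/
noncomputable def A (l : ℂ) (x : ℝ) : Matrix (Fin 2) (Fin 2) ℂ := D.Q x - l • D.W x

theorem norm_A_le (l : ℂ) (x : ℝ) (i j : Fin 2) : ‖D.A l x i j‖ ≤ 1 + ‖l‖ := by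
  refine (norm_sub_le _ _).trans (add_le_add (D.norm_Q_le x i j) ?_)
  rw [Matrix.smul_apply, norm_smul]
  exact (mul_le_mul_of_nonneg_left (D.norm_W_le x i j) (norm_nonneg _)).trans (mul_one _).le

theorem measurable_A (l : ℂ) (i j : Fin 2) : Measurable fun x => D.A l x i j :=
  (D.measurable_Q i j).sub ((D.measurable_W i j).const_mul l)

theorem W_isHermitian (x : ℝ) : (D.W x).IsHermitian := by
  rw [D.W_eq]; exact Matrix.isHermitian_conjTranspose_mul_self _

/-- The density of `u'` if `J u' + (q - l w) u = f dν`; recall `J⁻¹ = -J`. -/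
noncomputable def rhs (l : ℂ) (f u : ℝ → Fin 2 → ℂ) (x : ℝ) : Fin 2 → ℂ :=
  Coefficients.J.mulVec ((D.A l x).mulVec (u x) - f x)

theorem J_mulVec (v : Fin 2 → ℂ) : Coefficients.J.mulVec v = ![-v 1, v 0] := by
  ext i
  fin_cases i <;> simp [Coefficients.J, Matrix.mulVec, dotProduct, Fin.sum_univ_two]

/-- The pointwise form of Lagrange's identity. -/
theorem sympForm_rhs (l l' : ℂ) (f g u v : ℝ → Fin 2 → ℂ) (x : ℝ) :
    sympForm (D.rhs l' g v x) (u x) + sympForm (v x) (D.rhs l f u x)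
      = star (v x) ⬝ᵥ f x - star (g x) ⬝ᵥ u x
        + (l - star l') * (star ((D.S x).mulVec (v x)) ⬝ᵥ (D.S x).mulVec (u x)) := by
  have hQ : ∀ i j, star (D.Q x i j) = D.Q x j i := fun i j => (D.Q_hermitian x).apply j i
  have hW : star ((D.S x).mulVec (v x)) ⬝ᵥ (D.S x).mulVec (u x)
      = star (v x) ⬝ᵥ (D.W x).mulVec (u x) := by
    rw [Matrix.star_mulVec, ← Matrix.dotProduct_mulVec, Matrix.mulVec_mulVec, ← D.W_eq]
  have hWs : ∀ i j, star (D.W x i j) = D.W x j i := fun i j => (D.W_isHermitian x).apply j i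
  rw [hW]
  simp only [sympForm, rhs, J_mulVec]
  simp only [A, Matrix.mulVec, dotProduct, Fin.sum_univ_two,
    Matrix.sub_apply, Matrix.smul_apply, Pi.sub_apply, Pi.star_apply, Matrix.cons_val_zero,
    Matrix.cons_val_one, star_sub, star_add, star_mul, star_neg, hQ, hWs, smul_eq_mul]
  ring

/-- Lagrange's identity on `(c, d)`. -/
theorem lagrange {c d : ℝ} (hν : D.ν (Ioo c d) < ⊤) {l l' : ℂ} {f g u v : ℝ → Fin 2 → ℂ}
    {y z : Fin 2 → ℂ} (hu : IsPrimitiveOn D.ν c d y (D.rhs l f u) u)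
    (hv : IsPrimitiveOn D.ν c d z (D.rhs l' g v) v) :
    IntegrableOn (fun t => star (v t) ⬝ᵥ f t - star (g t) ⬝ᵥ u t
      + (l - star l') * (star ((D.S t).mulVec (v t)) ⬝ᵥ (D.S t).mulVec (u t))) (Ioo c d) D.ν ∧
    sympForm (z + ∫ t in Ioo c d, D.rhs l' g v t ∂D.ν) (y + ∫ t in Ioo c d, D.rhs l f u t ∂D.ν)
      = sympForm z y + ∫ t in Ioo c d, (star (v t) ⬝ᵥ f t - star (g t) ⬝ᵥ u t
          + (l - star l') * (star ((D.S t).mulVec (v t)) ⬝ᵥ (D.S t).mulVec (u t))) ∂D.ν := by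
  have := IsPrimitiveOn.sympForm_eq hν hu hv
  simp_rw [D.sympForm_rhs] at this
  exact this

/-- `u` is a balanced function of locally bounded variation with `J u' + (q - l w) u = f dν`. -/
structure IsBVSolution (l : ℂ) (f u : ℝ → Fin 2 → ℂ) : Prop where
  eq_zero : ∀ x ∉ interval b, u x = 0
  locallyBV : LocallyBoundedVariationOn u (interval b)
  balanced : ∀ x ∈ interval b,
    u x = (1 / 2 : ℂ) • (Function.leftLim u x + Function.rightLim u x)
  equation : ∀ c d : ℝ, 0 < c → c < d → (d : EReal) < b →
    Function.leftLim u d - Function.rightLim u c = ∫ t in Ioo c d, D.rhs l f u t ∂D.ν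

/-- `u` solves the initial value problem `J u' + (q - l w) u = f dν`, `u(0+) = y`, in integral
form. -/
structure IsInitSolution (l : ℂ) (f : ℝ → Fin 2 → ℂ) (y : Fin 2 → ℂ) (u : ℝ → Fin 2 → ℂ) :
    Prop where
  eq_zero : ∀ x ∉ interval b, u x = 0
  integrable : ∀ d ∈ interval b, IntegrableOn (D.rhs l f u) (Ioc 0 d) D.ν
  eq_integral : ∀ x ∈ interval b,
    u x = y + ∫ t in Ioo 0 x, D.rhs l f u t ∂D.ν + (1 / 2 : ℝ) • D.ν.real {x} • D.rhs l f u x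

variable {D}

theorem ν_Ioo_lt_top {c d : ℝ} (hc : 0 ≤ c) (hd : d ∈ interval b) : D.ν (Ioo c d) < ⊤ :=
  (measure_mono (show Ioo c d ⊆ Ioc 0 d from fun _ hx =>
    ⟨hc.trans_lt hx.1, hx.2.le⟩)).trans_lt (D.finite d hd)

variable {l : ℂ} {f : ℝ → Fin 2 → ℂ} {y : Fin 2 → ℂ} {u : ℝ → Fin 2 → ℂ}

theorem IsInitSolution.isPrimitiveOn (h : D.IsInitSolution l f y u) {d : ℝ} (hd : d ∈ interval b) :
    IsPrimitiveOn D.ν 0 d y (D.rhs l f u) u :=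
  ⟨(h.integrable d hd).mono_set Ioo_subset_Ioc_self, fun _ hx =>
    h.eq_integral _ (interval_mem_of_le hd hx.1 hx.2.le)⟩

theorem IsInitSolution.tendsto_left (h : D.IsInitSolution l f y u) {x : ℝ} (hx : x ∈ interval b) :
    Tendsto u (𝓝[<] x) (𝓝 (y + ∫ t in Ioo 0 x, D.rhs l f u t ∂D.ν)) :=
  tendsto_nhdsLT_of_balanced h.integrable h.eq_integral hx

theorem IsInitSolution.leftLim_eq (h : D.IsInitSolution l f y u) {x : ℝ} (hx : x ∈ interval b) :
    Function.leftLim u x = y + ∫ t in Ioo 0 x, D.rhs l f u t ∂D.ν :=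
  leftLim_eq_of_tendsto (h.tendsto_left hx)

theorem IsInitSolution.rightLim_eq (h : D.IsInitSolution l f y u) {x : ℝ} (hx : x ∈ interval b) :
    Function.rightLim u x
      = y + ∫ t in Ioo 0 x, D.rhs l f u t ∂D.ν + D.ν.real {x} • D.rhs l f u x :=
  rightLim_eq_of_tendsto
    (tendsto_nhdsGT_of_balanced h.integrable h.eq_integral hx)

theorem IsInitSolution.isBVSolution (h : D.IsInitSolution l f y u) : D.IsBVSolution l f u where
  eq_zero := h.eq_zero
  locallyBV := locallyBoundedVariationOn_of_balanced h.integrable h.eq_integral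
  balanced := by
    intro x hx
    rw [h.leftLim_eq hx, h.rightLim_eq hx, h.eq_integral x hx]
    ext i
    simp [Complex.real_smul]
    ring
  equation := by
    intro c d hc hcd hd
    have hdI : d ∈ interval b := ⟨hc.trans hcd, hd⟩
    rw [h.leftLim_eq hdI, h.rightLim_eq (interval_mem_of_le hdI hc hcd.le),
      setIntegral_Ioo_split hc hcd (h.integrable d hdI)]
    abel

theorem integrableOn_rhs {c d : ℝ} (hc : 0 ≤ c) (hd : d ∈ interval b)
    (hu : AEMeasurable u (D.ν.restrict (Ioo c d))) (hb : ∃ M, ∀ x ∈ Ioo c d, ‖u x‖ ≤ M)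
    (hf : IntegrableOn f (Ioo c d) D.ν) : IntegrableOn (D.rhs l f u) (Ioo c d) D.ν := by
  obtain ⟨M, hM⟩ := hb
  have hui : IntegrableOn u (Ioo c d) D.ν :=
    IntegrableOn.of_bound (ν_Ioo_lt_top hc hd) hu.aestronglyMeasurable M
      ((ae_restrict_iff' measurableSet_Ioo).2 (ae_of_all _ hM))
  have hA : ∀ i j, IntegrableOn (fun t => D.A l t i j * u t j) (Ioo c d) D.ν := by
    intro i j
    exact (hui.eval j).bdd_mul (c := 1 + ‖l‖) (D.measurable_A l i j).aestronglyMeasurable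
      (ae_of_all _ fun t => D.norm_A_le l t i j)
  have hg : ∀ i, IntegrableOn (fun t => ((D.A l t).mulVec (u t) - f t) i) (Ioo c d) D.ν :=
    fun i => (integrable_finsetSum _ fun j _ => hA i j).sub (hf.eval i)
  refine Integrable.of_eval fun i => ?_
  simp only [rhs, J_mulVec]
  fin_cases i
  · exact (hg 1).neg
  · exact hg 0

theorem IsBVSolution.integrableOn (h : D.IsBVSolution l f u)
    (hf : ∀ d ∈ interval b, IntegrableOn f (Ioc 0 d) D.ν) {c d : ℝ} (hc : 0 < c)
    (hd : d ∈ interval b) : IntegrableOn (D.rhs l f u) (Ioo c d) D.ν := by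
  obtain ⟨h1, h2⟩ := h.locallyBV.aemeasurable_and_exists_bound (ν := D.ν) hc hd
  exact integrableOn_rhs hc.le hd h1 h2
    ((hf d hd).mono_set fun x hx => ⟨hc.trans hx.1, hx.2.le⟩)

theorem IsBVSolution.rightLim_eq (h : D.IsBVSolution l f u)
    (hf : ∀ d ∈ interval b, IntegrableOn f (Ioc 0 d) D.ν) {x : ℝ} (hx : x ∈ interval b) :
    Function.rightLim u x = Function.leftLim u x + D.ν.real {x} • D.rhs l f u x := by
  obtain ⟨d, hxd, hd⟩ := exists_gt_interval hx
  have hc : 0 < x / 2 := half_pos hx.1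
  have hcx : x / 2 < x := half_lt_self hx.1
  have e1 := h.equation (x / 2) x hc hcx hx.2
  have e2 := h.equation x d hx.1 hxd hd.2
  have e3 := h.equation (x / 2) d hc (hcx.trans hxd) hd.2
  have hi := h.integrableOn hf hc hd
  have hs : Ioo (x / 2) d = Ioo (x / 2) x ∪ {x} ∪ Ioo x d := by
    rw [Ioo_union_right hcx, Ioc_union_Ioo_eq_Ioo hcx.le hxd]
  rw [hs, setIntegral_union _ measurableSet_Ioo
      (hi.mono_set (by rw [hs]; exact subset_union_left))
      (hi.mono_set (Ioo_subset_Ioo_left hcx.le)),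
    setIntegral_union (by simp) (measurableSet_singleton x)
      (hi.mono_set (Ioo_subset_Ioo_right hxd.le))
      (hi.mono_set (singleton_subset_iff.2 ⟨hcx, hxd⟩)),
    integral_singleton, ← e1, ← e2] at e3
  · have : Function.rightLim u x - Function.leftLim u x = D.ν.real {x} • D.rhs l f u x := by
      rw [← sub_eq_zero] at e3 ⊢
      rw [← e3]; abel
    rw [← this]; abel
  · refine Set.disjoint_left.2 fun t ht ht' => ?_
    rw [Ioo_union_right hcx] at ht
    exact ht.2.not_gt ht'.1

theorem IsBVSolution.isPrimitiveOn (h : D.IsBVSolution l f u)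
    (hf : ∀ d ∈ interval b, IntegrableOn f (Ioc 0 d) D.ν) {c d : ℝ} (hc : 0 < c)
    (hd : d ∈ interval b) :
    IsPrimitiveOn D.ν c d (Function.rightLim u c) (D.rhs l f u) u := by
  refine ⟨h.integrableOn hf hc hd, fun x hx => ?_⟩
  have hxI := interval_mem_of_le hd (hc.trans hx.1) hx.2.le
  rw [← h.equation c x hc hx.1 hxI.2, h.balanced x hxI, h.rightLim_eq hf hxI]
  ext i
  simp [Complex.real_smul]
  ring

end DensityData

/-! ### From the coefficients to their densities -/

namespace DensityData

variable {b : EReal} (D : DensityData b)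

/-- The density `S u` of a function `u`, for which `u* w u = ‖S u‖² dν`. -/
noncomputable def weighted (u : ℝ → Fin 2 → ℂ) (t : ℝ) : EuclideanSpace ℂ (Fin 2) :=
  WithLp.toLp 2 ((D.S t).mulVec (u t))

theorem star_dotProduct_W_mulVec (v u : ℝ → Fin 2 → ℂ) (t : ℝ) :
    star (v t) ⬝ᵥ (D.W t).mulVec (u t)
      = star ((D.S t).mulVec (v t)) ⬝ᵥ (D.S t).mulVec (u t) := by
  rw [Matrix.star_mulVec, ← Matrix.dotProduct_mulVec, Matrix.mulVec_mulVec, ← D.W_eq]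

theorem star_dotProduct_self (v : Fin 2 → ℂ) :
    star v ⬝ᵥ v = ((‖(WithLp.toLp 2 v : EuclideanSpace ℂ (Fin 2))‖ ^ 2 : ℝ) : ℂ) := by
  rw [EuclideanSpace.norm_sq_eq]
  push_cast
  simp only [dotProduct, Pi.star_apply]
  refine Finset.sum_congr rfl fun i _ => ?_
  rw [← starRingEnd_apply, mul_comm, Complex.mul_conj, Complex.normSq_eq_norm_sq]
  push_cast; rfl

theorem aemeasurable_weighted {u : ℝ → Fin 2 → ℂ} {μ : Measure ℝ} (hu : AEMeasurable u μ) :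
    AEMeasurable (D.weighted u) μ := by
  refine (WithLp.measurable_toLp 2 (Fin 2 → ℂ)).comp_aemeasurable ?_
  refine aemeasurable_pi_lambda _ fun i => ?_
  simp only [Matrix.mulVec, dotProduct]
  exact Finset.aemeasurable_fun_sum _ fun j _ =>
    (D.measurable_S i j).aemeasurable.mul ((measurable_pi_apply j).comp_aemeasurable hu)

theorem norm_weighted_le (u : ℝ → Fin 2 → ℂ) (t : ℝ) : ‖D.weighted u t‖ ≤ 4 * ‖u t‖ := by
  have h : ∀ i, ‖(D.S t).mulVec (u t) i‖ ≤ 2 * ‖u t‖ := by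
    intro i
    simp only [Matrix.mulVec, dotProduct]
    refine (norm_sum_le _ _).trans ?_
    have : ∀ j ∈ Finset.univ, ‖D.S t i j * u t j‖ ≤ ‖u t‖ := fun j _ => by
      rw [norm_mul]
      exact (mul_le_mul (D.norm_S_le t i j) (norm_le_pi_norm _ j) (norm_nonneg _)
        zero_le_one).trans (one_mul _).le
    refine (Finset.sum_le_sum this).trans ?_
    simp
  have h2 : ‖D.weighted u t‖ ^ 2 ≤ (4 * ‖u t‖) ^ 2 := by
    rw [EuclideanSpace.norm_sq_eq, Fin.sum_univ_two]
    have h0 := pow_le_pow_left₀ (norm_nonneg _) (h 0) 2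
    have h1 := pow_le_pow_left₀ (norm_nonneg _) (h 1) 2
    change ‖(D.S t).mulVec (u t) 0‖ ^ 2 + ‖(D.S t).mulVec (u t) 1‖ ^ 2 ≤ _
    nlinarith [sq_nonneg ‖u t‖]
  exact (pow_le_pow_iff_left₀ (norm_nonneg _) (by positivity) two_ne_zero).1 h2

theorem interval_ae : ∀ᵐ x ∂D.ν, x ∈ interval b := D.compl_null

/-- Up to a null set, `(0, b)` is exhausted by an increasing sequence of intervals. -/
theorem exists_exhaustion (hb : 0 < b) : ∃ γ β : ℕ → ℝ,
    (∀ n, 0 < γ n ∧ γ n < β n ∧ β n ∈ interval b) ∧ Monotone (fun n => Ioo (γ n) (β n)) ∧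
    (⋃ n, Ioo (γ n) (β n) : Set ℝ) =ᵐ[D.ν] univ := by
  obtain ⟨β, hβ, hβI, hβx⟩ := exists_strictMono_cutoffs hb
  refine ⟨fun n => β 0 / (n + 2), β, fun n => ⟨div_pos (hβI 0).1 (by positivity), ?_, hβI n⟩,
    fun m n hmn => Ioo_subset_Ioo
      (div_le_div_of_nonneg_left (hβI 0).1.le (by positivity)
        (by have : (m : ℝ) ≤ n := by exact_mod_cast hmn
            linarith)) (hβ.monotone hmn), ?_⟩
  · have h1 : β 0 / (n + 2) < β 0 := div_lt_self (hβI 0).1 (by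
      have : (0 : ℝ) ≤ n := by positivity
      linarith)
    exact h1.trans_le (hβ.monotone (Nat.zero_le n))
  · rw [eventuallyEq_univ]
    filter_upwards [D.interval_ae] with x hx
    obtain ⟨n, hn⟩ := hβx x hx
    obtain ⟨m, hm⟩ := exists_nat_gt (β 0 / x)
    refine mem_iUnion.2 ⟨max m n, ?_, hn.trans_le (hβ.monotone (le_max_right _ _))⟩
    rw [div_lt_iff₀ (by positivity)]
    rw [div_lt_iff₀ hx.1] at hm
    have : (m : ℝ) ≤ (max m n : ℕ) := by exact_mod_cast le_max_left m n
    nlinarith [hx.1]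

theorem aemeasurable_of_locallyBV (hb : 0 < b) {u : ℝ → Fin 2 → ℂ}
    (hu : LocallyBoundedVariationOn u (interval b)) : AEMeasurable u D.ν := by
  obtain ⟨γ, β, hγβ, -, hU⟩ := D.exists_exhaustion hb
  have h : AEMeasurable u (D.ν.restrict (⋃ n, Ioo (γ n) (β n))) :=
    aemeasurable_iUnion_iff.2 fun n => (hu.aemeasurable_and_exists_bound (hγβ n).1 (hγβ n).2.2).1
  rwa [Measure.restrict_congr_set hU, Measure.restrict_univ] at h

end DensityData

namespace Coefficients

variable {b : EReal} {S : Coefficients b} {D : DensityData b}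

theorem HasDensity.atom_q (h : S.HasDensity D) {x : ℝ} (hx : x ∈ interval b) (i j : Fin 2) :
    (S.q i j).atom x = D.ν.real {x} * D.Q x i j := by
  rw [LocalMeasure.atom, h.q_eq x hx _ (measurableSet_singleton x), inter_eq_left.2
    (show ({x} : Set ℝ) ⊆ Ioc 0 x from
      singleton_subset_iff.2 ⟨hx.1, le_rfl⟩), integral_singleton, Complex.real_smul]

theorem HasDensity.atom_w (h : S.HasDensity D) {x : ℝ} (hx : x ∈ interval b) (i j : Fin 2) :
    (S.w i j).atom x = D.ν.real {x} * D.W x i j := by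
  rw [LocalMeasure.atom, h.w_eq x hx _ (measurableSet_singleton x), inter_eq_left.2
    (show ({x} : Set ℝ) ⊆ Ioc 0 x from
      singleton_subset_iff.2 ⟨hx.1, le_rfl⟩), integral_singleton, Complex.real_smul]

theorem HasDensity.Bplus_eq (h : S.HasDensity D) {x : ℝ} (hx : x ∈ interval b) (l : ℂ) :
    S.Bplus x l = J + ((D.ν.real {x} / 2 : ℝ) : ℂ) • D.A l x := by
  ext i j
  simp [Bplus, Δq, Δw, h.atom_q hx, h.atom_w hx, DensityData.A]
  ring

theorem HasDensity.Bminus_eq (h : S.HasDensity D) {x : ℝ} (hx : x ∈ interval b) (l : ℂ) :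
    S.Bminus x l = J - ((D.ν.real {x} / 2 : ℝ) : ℂ) • D.A l x := by
  ext i j
  simp [Bminus, Δq, Δw, h.atom_q hx, h.atom_w hx, DensityData.A]
  ring

theorem HasDensity.integral_q (h : S.HasDensity D) {c d : ℝ} (hc : 0 < c) (hd : d ∈ interval b)
    (i j : Fin 2) {g : ℝ → ℂ} (hg : IntegrableOn g (Ioo c d) D.ν) :
    (S.q i j).integral c d g = ∫ x in Ioo c d, g x * D.Q x i j ∂D.ν :=
  LocalMeasure.integral_eq _ (D.measurable_Q i j) (fun x => D.norm_Q_le x i j) hc (D.finite d hd)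
    (fun s hs => h.q_eq d hd s hs i j) hg

theorem HasDensity.integral_w (h : S.HasDensity D) {c d : ℝ} (hc : 0 < c) (hd : d ∈ interval b)
    (i j : Fin 2) {g : ℝ → ℂ} (hg : IntegrableOn g (Ioo c d) D.ν) :
    (S.w i j).integral c d g = ∫ x in Ioo c d, g x * D.W x i j ∂D.ν :=
  LocalMeasure.integral_eq _ (D.measurable_W i j) (fun x => D.norm_W_le x i j) hc (D.finite d hd)
    (fun s hs => h.w_eq d hd s hs i j) hg

theorem integrableOn_of_locallyBV {u : ℝ → Fin 2 → ℂ}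
    (hu : LocallyBoundedVariationOn u (interval b)) {c d : ℝ} (hc : 0 < c) (hd : d ∈ interval b) :
    IntegrableOn u (Ioo c d) D.ν := by
  obtain ⟨h1, M, hM⟩ := hu.aemeasurable_and_exists_bound (ν := D.ν) hc hd
  exact IntegrableOn.of_bound (DensityData.ν_Ioo_lt_top hc.le hd) h1.aestronglyMeasurable M
      ((ae_restrict_iff' measurableSet_Ioo).2 (ae_of_all _ hM))

/-- The equation on `(c, d)`, solved for the increment `z` of `u`. -/
theorem HasDensity.equation_iff (h : S.HasDensity D) {u : ℝ → Fin 2 → ℂ}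
    (hu : LocallyBoundedVariationOn u (interval b)) {c d : ℝ} (hc : 0 < c) (hd : d ∈ interval b)
    (l : ℂ) (z : Fin 2 → ℂ) :
    (∀ i, J.mulVec z i + ∑ j, (S.q i j).integral c d (fun x => u x j)
      = l * ∑ j, (S.w i j).integral c d (fun x => u x j)) ↔
    z = ∫ t in Ioo c d, D.rhs l 0 u t ∂D.ν := by
  have hi := integrableOn_of_locallyBV (D := D) hu hc hd
  obtain ⟨hm, hb⟩ := hu.aemeasurable_and_exists_bound (ν := D.ν) hc hd
  have hr : IntegrableOn (D.rhs l 0 u) (Ioo c d) D.ν :=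
    DensityData.integrableOn_rhs hc.le hd hm hb (integrable_zero _ _ _)
  have hQ : ∀ i j, IntegrableOn (fun t => u t j * D.Q t i j) (Ioo c d) D.ν := fun i j =>
    (hi.eval j).mul_bdd (D.measurable_Q i j).aestronglyMeasurable
      (ae_of_all _ fun t => D.norm_Q_le t i j)
  have hW : ∀ i j, IntegrableOn (fun t => u t j * D.W t i j) (Ioo c d) D.ν := fun i j =>
    (hi.eval j).mul_bdd (D.measurable_W i j).aestronglyMeasurable
      (ae_of_all _ fun t => D.norm_W_le t i j)
  have key : ∀ i, ∑ j, (S.q i j).integral c d (fun x => u x j)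
      - l * ∑ j, (S.w i j).integral c d (fun x => u x j)
      = ∫ t in Ioo c d, ((D.A l t).mulVec (u t)) i ∂D.ν := by
    intro i
    simp only [h.integral_q hc hd _ _ (hi.eval _), h.integral_w hc hd _ _ (hi.eval _)]
    rw [← integral_finsetSum _ fun j _ => hQ i j, ← integral_finsetSum _ fun j _ => hW i j,
      ← integral_const_mul, ← integral_sub (integrable_finsetSum _ fun j _ => hQ i j)
        ((integrable_finsetSum _ fun j _ => hW i j).const_mul l)]
    refine integral_congr_ae (ae_of_all _ fun t => ?_)
    simp only [DensityData.A, Matrix.mulVec, dotProduct, Fin.sum_univ_two, Matrix.sub_apply,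
      Matrix.smul_apply, smul_eq_mul]
    ring
  have e0 : (∫ t in Ioo c d, D.rhs l 0 u t ∂D.ν) 0
      = -∫ t in Ioo c d, ((D.A l t).mulVec (u t)) 1 ∂D.ν := by
    rw [integral_pi_apply hr, ← integral_neg]
    simp only [DensityData.rhs, DensityData.J_mulVec]
    simp
  have e1 : (∫ t in Ioo c d, D.rhs l 0 u t ∂D.ν) 1
      = ∫ t in Ioo c d, ((D.A l t).mulVec (u t)) 0 ∂D.ν := by
    rw [integral_pi_apply hr]
    simp only [DensityData.rhs, DensityData.J_mulVec]
    simp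
  rw [Fin.forall_fin_two, funext_iff, Fin.forall_fin_two, e0, e1, ← key, ← key,
    DensityData.J_mulVec]
  simp only [Matrix.cons_val_zero, Matrix.cons_val_one]
  constructor
  · rintro ⟨h0, h1⟩
    exact ⟨by linear_combination h1, by linear_combination -h0⟩
  · rintro ⟨h0, h1⟩
    exact ⟨by linear_combination -h1, by linear_combination h0⟩

theorem HasDensity.isSolution_iff (h : S.HasDensity D) {l : ℂ} {u : ℝ → Fin 2 → ℂ} :
    S.IsSolution l u ↔ D.IsBVSolution l 0 u := by
  constructor
  · intro hu
    refine ⟨hu.eq_zero, hu.locallyBV, hu.balanced, fun c d hc hcd hd => ?_⟩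
    exact (h.equation_iff hu.locallyBV hc ⟨hc.trans hcd, hd⟩ l _).1 (hu.equation c d hc hcd hd)
  · intro hu
    refine ⟨hu.eq_zero, hu.locallyBV, hu.balanced, fun c d hc hcd hd => ?_⟩
    exact (h.equation_iff hu.locallyBV hc ⟨hc.trans hcd, hd⟩ l _).2 (hu.equation c d hc hcd hd)

theorem HasDensity.energy_eq (h : S.HasDensity D) {u : ℝ → Fin 2 → ℂ}
    (hu : LocallyBoundedVariationOn u (interval b)) {c d : ℝ} (hc : 0 < c) (hd : d ∈ interval b) :
    ENNReal.ofReal (S.energy u c d) = ∫⁻ t in Ioo c d, ‖D.weighted u t‖ₑ ^ 2 ∂D.ν := by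
  obtain ⟨hm, M, hM⟩ := hu.aemeasurable_and_exists_bound (ν := D.ν) hc hd
  have hνf := DensityData.ν_Ioo_lt_top (D := D) hc.le hd
  have hprod : ∀ i j, IntegrableOn (fun t => star (u t i) * u t j) (Ioo c d) D.ν := by
    intro i j
    refine IntegrableOn.of_bound hνf ?_ (M * M)
      ((ae_restrict_iff' measurableSet_Ioo).2 (ae_of_all _ fun t ht => ?_))
    · exact ((continuous_star.measurable.comp_aemeasurable
        ((measurable_pi_apply i).comp_aemeasurable hm)).mul
          ((measurable_pi_apply j).comp_aemeasurable hm)).aestronglyMeasurable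
    · rw [norm_mul, norm_star]
      exact mul_le_mul ((norm_le_pi_norm _ i).trans (hM t ht))
        ((norm_le_pi_norm _ j).trans (hM t ht)) (norm_nonneg _)
        ((norm_nonneg _).trans (hM t ht))
  have hprodW : ∀ i j, IntegrableOn (fun t => star (u t i) * u t j * D.W t i j) (Ioo c d) D.ν :=
    fun i j => (hprod i j).mul_bdd (D.measurable_W i j).aestronglyMeasurable
      (ae_of_all _ fun t => D.norm_W_le t i j)
  have hwm := D.aemeasurable_weighted hm
  have hsq : IntegrableOn (fun t => ‖D.weighted u t‖ ^ 2) (Ioo c d) D.ν := by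
    refine IntegrableOn.of_bound hνf (hwm.norm.pow_const 2).aestronglyMeasurable ((4 * M) ^ 2)
      ((ae_restrict_iff' measurableSet_Ioo).2 (ae_of_all _ fun t ht => ?_))
    rw [Real.norm_of_nonneg (by positivity)]
    have := (D.norm_weighted_le u t).trans (mul_le_mul_of_nonneg_left (hM t ht) (by norm_num))
    exact pow_le_pow_left₀ (norm_nonneg _) this 2
  have e : S.energy u c d = ∫ t in Ioo c d, ‖D.weighted u t‖ ^ 2 ∂D.ν := by
    have : (∑ i, ∑ j, (S.w i j).integral c d (fun x => star (u x i) * u x j))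
        = ∫ t in Ioo c d, ((‖D.weighted u t‖ ^ 2 : ℝ) : ℂ) ∂D.ν := by
      simp only [h.integral_w hc hd _ _ (hprod _ _)]
      simp_rw [← integral_finsetSum Finset.univ fun j _ => hprodW _ j]
      rw [← integral_finsetSum _ fun i _ => integrable_finsetSum _ fun j _ => hprodW i j]
      refine integral_congr_ae (ae_of_all _ fun t => ?_)
      simp only [DensityData.weighted]
      rw [← DensityData.star_dotProduct_self, ← D.star_dotProduct_W_mulVec]
      simp only [Matrix.mulVec, dotProduct, Fin.sum_univ_two, Pi.star_apply]
      ring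
    rw [energy, this, integral_complex_ofReal]
    exact Complex.ofReal_re _
  rw [e, ofReal_integral_eq_lintegral_ofReal hsq (ae_of_all _ fun t => by positivity)]
  refine lintegral_congr fun t => ?_
  rw [ENNReal.ofReal_pow (norm_nonneg _), ofReal_norm]

theorem HasDensity.normSq_eq (hb : 0 < b) (h : S.HasDensity D) {u : ℝ → Fin 2 → ℂ}
    (hu : LocallyBoundedVariationOn u (interval b)) :
    S.normSq u = ∫⁻ t, ‖D.weighted u t‖ₑ ^ 2 ∂D.ν := by
  apply le_antisymm
  · refine iSup_le fun c => iSup_le fun d => iSup_le fun hcd => ?_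
    rw [h.energy_eq hu hcd.1 ⟨hcd.1.trans hcd.2.1, hcd.2.2⟩]
    exact setLIntegral_le_lintegral _ _
  · obtain ⟨γ, β, hγβ, hmono, hU⟩ := D.exists_exhaustion hb
    rw [← setLIntegral_univ, ← setLIntegral_congr hU,
      setLIntegral_iUnion_of_directed _ hmono.directed_le]
    refine iSup_le fun n => ?_
    obtain ⟨h0, h1, h2⟩ := hγβ n
    rw [← h.energy_eq hu h0 h2]
    exact le_iSup_of_le _ (le_iSup_of_le _ (le_iSup_of_le ⟨h0, h1, h2.2⟩ le_rfl))

end Coefficients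

/-! ### The matrices `B_±` and solvability of the initial value problem -/

theorem measurable_measureReal_singleton (ν : Measure ℝ) [SFinite ν] :
    Measurable fun x => ν.real {x} := by
  have h :=
    (measurable_measure_prodMk_left (ν := ν) (measurableSet_diagonal (α := ℝ))).ennreal_toReal
  convert h using 2 with x
  rw [Measure.real]
  congr 2
  ext y
  simp [eq_comm]

/-- The entries of `N` are bounded on `s`. -/
def EntrywiseBoundedOn (N : ℝ → Matrix (Fin 2) (Fin 2) ℂ) (s : Set ℝ) : Prop :=
  ∃ C : NNReal, ∀ t ∈ s, ∀ i j, ‖N t i j‖₊ ≤ C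

theorem EntrywiseBoundedOn.mul {N M : ℝ → Matrix (Fin 2) (Fin 2) ℂ} {s : Set ℝ}
    (hN : EntrywiseBoundedOn N s) (hM : EntrywiseBoundedOn M s) :
    EntrywiseBoundedOn (fun t => N t * M t) s := by
  obtain ⟨C, hC⟩ := hN
  obtain ⟨C', hC'⟩ := hM
  refine ⟨C * C' + C * C', fun t ht i j => ?_⟩
  beta_reduce
  rw [Matrix.mul_apply, Fin.sum_univ_two]
  refine (nnnorm_add_le _ _).trans (add_le_add ?_ ?_) <;> rw [nnnorm_mul] <;>
    exact mul_le_mul' (hC t ht _ _) (hC' t ht _ _)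

theorem EntrywiseBoundedOn.add {N M : ℝ → Matrix (Fin 2) (Fin 2) ℂ} {s : Set ℝ}
    (hN : EntrywiseBoundedOn N s) (hM : EntrywiseBoundedOn M s) :
    EntrywiseBoundedOn (fun t => N t + M t) s := by
  obtain ⟨C, hC⟩ := hN
  obtain ⟨C', hC'⟩ := hM
  exact ⟨C + C', fun t ht i j =>
    (nnnorm_add_le _ _).trans (add_le_add (hC t ht i j) (hC' t ht i j))⟩

theorem EntrywiseBoundedOn.smul {c : ℝ → ℂ} {M : ℝ → Matrix (Fin 2) (Fin 2) ℂ} {s : Set ℝ}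
    (hc : ∃ C : NNReal, ∀ t ∈ s, ‖c t‖₊ ≤ C) (hM : EntrywiseBoundedOn M s) :
    EntrywiseBoundedOn (fun t => c t • M t) s := by
  obtain ⟨C, hC⟩ := hc
  obtain ⟨C', hC'⟩ := hM
  refine ⟨C * C', fun t ht i j => ?_⟩
  beta_reduce
  rw [Matrix.smul_apply, smul_eq_mul, nnnorm_mul]
  exact mul_le_mul' (hC t ht) (hC' t ht _ _)

theorem EntrywiseBoundedOn.const (M : Matrix (Fin 2) (Fin 2) ℂ) (s : Set ℝ) :
    EntrywiseBoundedOn (fun _ => M) s :=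
  ⟨∑ i, ∑ j, ‖M i j‖₊, fun _ _ i j =>
    (Finset.single_le_sum (f := fun j => ‖M i j‖₊) (fun _ _ => zero_le)
      (Finset.mem_univ j)).trans (Finset.single_le_sum (f := fun i => ∑ j, ‖M i j‖₊)
        (fun _ _ => zero_le) (Finset.mem_univ i))⟩

theorem EntrywiseBoundedOn.adjugate {M : ℝ → Matrix (Fin 2) (Fin 2) ℂ} {s : Set ℝ}
    (hM : EntrywiseBoundedOn M s) : EntrywiseBoundedOn (fun t => (M t).adjugate) s := by
  obtain ⟨C, hC⟩ := hM
  refine ⟨C, fun t ht i j => ?_⟩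
  beta_reduce
  rw [Matrix.adjugate_fin_two]
  fin_cases i <;> fin_cases j <;> simpa using hC t ht _ _

theorem integrableOn_mulVec {ν : Measure ℝ} {N : ℝ → Matrix (Fin 2) (Fin 2) ℂ} {s : Set ℝ}
    (hs : MeasurableSet s) (hN : EntrywiseBoundedOn N s) (hNm : ∀ i j, Measurable fun t => N t i j)
    {f : ℝ → Fin 2 → ℂ} (hf : IntegrableOn f s ν) :
    IntegrableOn (fun t => (N t).mulVec (f t)) s ν := by
  obtain ⟨C, hC⟩ := hN
  refine Integrable.of_eval fun i => ?_
  simp only [Matrix.mulVec, dotProduct]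
  exact integrable_finsetSum _ fun j _ => (hf.eval j).bdd_mul (c := C)
    (hNm i j).aestronglyMeasurable ((ae_restrict_iff' hs).2 (ae_of_all _ fun t ht => hC t ht i j))

theorem measurable_mul_entries {N M : ℝ → Matrix (Fin 2) (Fin 2) ℂ}
    (hN : ∀ i j, Measurable fun t => N t i j) (hM : ∀ i j, Measurable fun t => M t i j) (i j) :
    Measurable fun t => (N t * M t) i j := by
  simp only [Matrix.mul_apply]
  exact Finset.measurable_fun_sum _ fun k _ => (hN i k).mul (hM k j)

namespace DensityData

variable {b : EReal} (D : DensityData b)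

/-- The matrix `B_+(x, l) = J + (q - l w)({x}) / 2` in terms of densities. -/
noncomputable def Bplus (l : ℂ) (x : ℝ) : Matrix (Fin 2) (Fin 2) ℂ :=
  Coefficients.J + ((D.ν.real {x} / 2 : ℝ) : ℂ) • D.A l x

/-- The matrix `B_-(x, l) = J - (q - l w)({x}) / 2` in terms of densities. -/
noncomputable def Bminus (l : ℂ) (x : ℝ) : Matrix (Fin 2) (Fin 2) ℂ :=
  Coefficients.J - ((D.ν.real {x} / 2 : ℝ) : ℂ) • D.A l x

/-- All the matrices `B_±(x, l)` are invertible. -/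
def IsRegular (l : ℂ) : Prop :=
  ∀ x ∈ interval b, (D.Bplus l x).det ≠ 0 ∧ (D.Bminus l x).det ≠ 0

theorem entrywiseBoundedOn_A (l : ℂ) (s : Set ℝ) : EntrywiseBoundedOn (D.A l) s :=
  ⟨1 + ‖l‖₊, fun t _ i j => D.norm_A_le l t i j⟩

theorem A_star (l : ℂ) (x : ℝ) (i j : Fin 2) : D.A (star l) x i j = star (D.A l x j i) := by
  simp only [A, Matrix.sub_apply, Matrix.smul_apply, star_sub, smul_eq_mul, star_mul',
    (D.Q_hermitian x).apply, (D.W_isHermitian x).apply]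

theorem det_Bplus (l : ℂ) (x : ℝ) : (D.Bplus l x).det
    = 1 + ((D.ν.real {x} / 2 : ℝ) : ℂ) * (D.A l x 1 0 - D.A l x 0 1)
      + ((D.ν.real {x} / 2 : ℝ) : ℂ) ^ 2 * (D.A l x).det := by
  rw [Matrix.det_fin_two, Matrix.det_fin_two]
  simp [Bplus, Coefficients.J]
  ring

theorem det_Bminus (l : ℂ) (x : ℝ) : (D.Bminus l x).det
    = 1 - ((D.ν.real {x} / 2 : ℝ) : ℂ) * (D.A l x 1 0 - D.A l x 0 1)
      + ((D.ν.real {x} / 2 : ℝ) : ℂ) ^ 2 * (D.A l x).det := by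
  rw [Matrix.det_fin_two, Matrix.det_fin_two]
  simp [Bminus, Coefficients.J]
  ring

variable {D}

/-- `det B_-` and `det B_+` are interchanged by conjugation, so regularity is symmetric with respect
to the real axis. -/
theorem det_Bminus_star (l : ℂ) (x : ℝ) :
    (D.Bminus (star l) x).det = star (D.Bplus l x).det := by
  rw [det_Bminus, det_Bplus, Matrix.det_fin_two, Matrix.det_fin_two]
  simp only [A_star]
  simp
  ring

theorem IsRegular.conj {l : ℂ} (h : D.IsRegular l) : D.IsRegular (star l) := by
  intro x hx
  obtain ⟨h1, h2⟩ := h x hx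
  refine ⟨?_, ?_⟩
  · have := det_Bminus_star (D := D) (star l) x
    rw [star_star] at this
    rw [this] at h2
    exact fun h0 => h2 (by rw [h0, star_zero])
  · rw [det_Bminus_star]
    exact fun h0 => h1 (star_eq_zero.1 h0)

theorem _root_.Coefficients.HasDensity.isRegular {S : Coefficients b} (h : S.HasDensity D) {l : ℂ}
    (hl : l ∉ S.badSet) : D.IsRegular l := by
  intro x hx
  have : (S.Bplus x l).det * (S.Bminus x l).det ≠ 0 := fun h0 => hl ⟨x, hx, h0⟩
  rw [h.Bplus_eq hx, h.Bminus_eq hx] at this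
  exact mul_ne_zero_iff.1 this

/-- `det B_+` is bounded away from zero on `(0, d]`, since only finitely many atoms are large. -/
theorem IsRegular.exists_le_norm_det {l : ℂ} (h : D.IsRegular l) {d : ℝ} (hd : d ∈ interval b) :
    ∃ ε > 0, ∀ x ∈ Ioc 0 d, ε ≤ ‖(D.Bplus l x).det‖ := by
  set C : ℝ := 1 + ‖l‖ with hC
  have hC1 : 1 ≤ C := by rw [hC]; linarith [norm_nonneg l]
  set T : Set ℝ := {x | x ∈ Ioc 0 d ∧ ENNReal.ofReal (1 / (4 * C)) ≤ D.ν {x}} with hT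
  have hTfin : T.Finite := by
    by_contra hinf
    have := Set.Infinite.meas_eq_top (μ := D.ν) hinf
      ⟨ENNReal.ofReal (1 / (4 * C)), by
        have : 0 < 1 / (4 * C) := by positivity
        simpa using this, fun x hx => hx.2⟩
    have hle : D.ν T ≤ D.ν (Ioc 0 d) := measure_mono fun x hx => hx.1
    rw [this] at hle
    exact (D.finite d hd).not_ge hle
  have small : ∀ x ∈ Ioc 0 d, x ∉ T → 1 / 2 ≤ ‖(D.Bplus l x).det‖ := by
    intro x hx hxT
    have hlt : D.ν {x} < ENNReal.ofReal (1 / (4 * C)) := by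
      by_contra h'
      exact hxT ⟨hx, not_lt.1 h'⟩
    have hp : D.ν.real {x} ≤ 1 / (4 * C) := ENNReal.toReal_le_of_le_ofReal (by positivity) hlt.le
    set p := D.ν.real {x} / 2 with hpdef
    have hp0 : 0 ≤ p := div_nonneg measureReal_nonneg two_pos.le
    have hpC : p * C ≤ 1 / 8 := by
      have := mul_le_mul_of_nonneg_right hp (by positivity : 0 ≤ C)
      rw [show 1 / (4 * C) * C = 1 / 4 by field_simp] at this
      rw [hpdef]; linarith
    have hA := D.norm_A_le l x
    rw [← hC] at hA
    have h1 : ‖(p : ℂ) * (D.A l x 1 0 - D.A l x 0 1)‖ ≤ 2 * (p * C) := by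
      rw [norm_mul, Complex.norm_real, Real.norm_of_nonneg hp0]
      have := (norm_sub_le (D.A l x 1 0) (D.A l x 0 1)).trans (add_le_add (hA 1 0) (hA 0 1))
      have := mul_le_mul_of_nonneg_left this hp0
      linarith
    have h2 : ‖(p : ℂ) ^ 2 * (D.A l x).det‖ ≤ 2 * (p * C) ^ 2 := by
      rw [norm_mul, norm_pow, Complex.norm_real, Real.norm_of_nonneg hp0, Matrix.det_fin_two]
      have : ‖D.A l x 0 0 * D.A l x 1 1 - D.A l x 0 1 * D.A l x 1 0‖ ≤ C * C + C * C := by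
        refine (norm_sub_le _ _).trans (add_le_add ?_ ?_) <;> rw [norm_mul] <;>
          exact mul_le_mul (hA _ _) (hA _ _) (norm_nonneg _) (by positivity)
      have := mul_le_mul_of_nonneg_left this (sq_nonneg p)
      nlinarith
    have h3 : ‖(D.Bplus l x).det - 1‖ ≤ 2 * (p * C) + 2 * (p * C) ^ 2 := by
      rw [det_Bplus, add_assoc, add_sub_cancel_left]
      exact (norm_add_le _ _).trans (add_le_add h1 h2)
    have h4 : (1 : ℝ) ≤ ‖(D.Bplus l x).det‖ + ‖(D.Bplus l x).det - 1‖ := by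
      have := norm_sub_le (D.Bplus l x).det ((D.Bplus l x).det - 1)
      simpa using this
    have h5 : 0 ≤ p * C := by positivity
    nlinarith
  by_cases hne : T.Nonempty
  · obtain ⟨a, ha, hmin⟩ := Set.exists_min_image T (fun x => ‖(D.Bplus l x).det‖) hTfin hne
    have hpos : 0 < ‖(D.Bplus l a).det‖ :=
      norm_pos_iff.2 (h a (interval_mem_of_le hd ha.1.1 ha.1.2)).1
    refine ⟨min (1 / 2) ‖(D.Bplus l a).det‖, lt_min (by norm_num) hpos, fun x hx => ?_⟩
    by_cases hxT : x ∈ T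
    · exact (min_le_right _ _).trans (hmin x hxT)
    · exact (min_le_left _ _).trans (small x hx hxT)
  · exact ⟨1 / 2, by norm_num, fun x hx => small x hx fun hxT => hne ⟨x, hxT⟩⟩

theorem measurable_Bplus (l : ℂ) (i j : Fin 2) : Measurable fun x => D.Bplus l x i j := by
  simp only [Bplus, Matrix.add_apply, Matrix.smul_apply, smul_eq_mul]
  exact (((Complex.measurable_ofReal.comp
    ((measurable_measureReal_singleton D.ν).div_const 2))).mul (D.measurable_A l i j)).const_add _

theorem measurable_inv_Bplus (l : ℂ) (i j : Fin 2) : Measurable fun x => (D.Bplus l x)⁻¹ i j := by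
  have hdet : Measurable fun x => (D.Bplus l x).det := by
    simp only [Matrix.det_fin_two]
    exact ((measurable_Bplus l 0 0).mul (measurable_Bplus l 1 1)).sub
      ((measurable_Bplus l 0 1).mul (measurable_Bplus l 1 0))
  have hadj : Measurable fun x => (D.Bplus l x).adjugate i j := by
    simp only [Matrix.adjugate_fin_two]
    fin_cases i <;> fin_cases j
    · exact measurable_Bplus l 1 1
    · exact (measurable_Bplus l 0 1).neg
    · exact (measurable_Bplus l 1 0).neg
    · exact measurable_Bplus l 0 0
  simp only [Matrix.inv_def, Ring.inverse_eq_inv', Matrix.smul_apply, smul_eq_mul]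
  exact hdet.inv.mul hadj

theorem exists_measureReal_le {d : ℝ} (hd : d ∈ interval b) :
    ∃ C : NNReal, ∀ t ∈ Ioc 0 d, ‖((D.ν.real {t} / 2 : ℝ) : ℂ)‖₊ ≤ C := by
  refine ⟨(D.ν.real (Ioc 0 d)).toNNReal, fun t ht => ?_⟩
  rw [← NNReal.coe_le_coe, Real.coe_toNNReal _ measureReal_nonneg, coe_nnnorm, Complex.norm_real,
    Real.norm_of_nonneg (div_nonneg measureReal_nonneg two_pos.le)]
  have : D.ν.real {t} ≤ D.ν.real (Ioc 0 d) :=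
    measureReal_mono (singleton_subset_iff.2 ht) (D.finite d hd).ne
  have h0 : 0 ≤ D.ν.real {t} := measureReal_nonneg
  linarith

theorem IsRegular.entrywiseBoundedOn_inv {l : ℂ} (h : D.IsRegular l) {d : ℝ} (hd : d ∈ interval b) :
    EntrywiseBoundedOn (fun x => (D.Bplus l x)⁻¹) (Ioc 0 d) := by
  obtain ⟨ε, hε, hle⟩ := h.exists_le_norm_det hd
  simp only [Matrix.inv_def, Ring.inverse_eq_inv']
  refine EntrywiseBoundedOn.smul ⟨ε⁻¹.toNNReal, fun t ht => ?_⟩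
    (EntrywiseBoundedOn.adjugate ?_)
  · rw [← NNReal.coe_le_coe, Real.coe_toNNReal _ (inv_nonneg.2 hε.le), coe_nnnorm, norm_inv]
    exact inv_anti₀ hε (hle t ht)
  · exact (EntrywiseBoundedOn.const _ _).add
      (EntrywiseBoundedOn.smul (exists_measureReal_le hd) (D.entrywiseBoundedOn_A l _))

end DensityData

/-! ### Existence and uniqueness for the initial value problem -/

namespace DensityData

variable {b : EReal} {D : DensityData b} {l : ℂ} {f g u v : ℝ → Fin 2 → ℂ} {y z : Fin 2 → ℂ}

/-- Solving `B_+ u = J y + ½ ν({x}) f` determines the balanced value `u` at `x` from the left limit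
`y`. -/
theorem Bplus_mulVec_eq_iff (l : ℂ) (x : ℝ) (u y f : Fin 2 → ℂ) :
    (D.Bplus l x).mulVec u = Coefficients.J.mulVec y + ((D.ν.real {x} / 2 : ℝ) : ℂ) • f ↔
    u = y + ((D.ν.real {x} / 2 : ℝ) : ℂ) • Coefficients.J.mulVec ((D.A l x).mulVec u - f) := by
  rw [Bplus, Matrix.add_mulVec, Matrix.smul_mulVec, J_mulVec, J_mulVec, J_mulVec]
  simp only [funext_iff, Fin.forall_fin_two, Pi.add_apply, Pi.smul_apply, Pi.sub_apply,
    Matrix.cons_val_zero, Matrix.cons_val_one, smul_eq_mul]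
  constructor
  · rintro ⟨h0, h1⟩
    exact ⟨by linear_combination h1, by linear_combination -h0⟩
  · rintro ⟨h0, h1⟩
    exact ⟨by linear_combination -h1, by linear_combination h0⟩

theorem half_smul_smul (r : ℝ) (v : Fin 2 → ℂ) :
    (1 / 2 : ℝ) • r • v = ((r / 2 : ℝ) : ℂ) • v := by
  ext i
  simp [Complex.real_smul]
  ring

theorem rhs_add (l : ℂ) (f g u v : ℝ → Fin 2 → ℂ) (x : ℝ) :
    D.rhs l (f + g) (u + v) x = D.rhs l f u x + D.rhs l g v x := by
  rw [rhs, rhs, rhs, ← Matrix.mulVec_add, Pi.add_apply, Pi.add_apply, Matrix.mulVec_add]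
  congr 1
  abel

theorem rhs_smul (l c : ℂ) (f u : ℝ → Fin 2 → ℂ) (x : ℝ) :
    D.rhs l (c • f) (c • u) x = c • D.rhs l f u x := by
  simp only [rhs, Pi.smul_apply, Matrix.mulVec_smul, ← smul_sub]

theorem IsInitSolution.add (hu : D.IsInitSolution l f y u) (hv : D.IsInitSolution l g z v) :
    D.IsInitSolution l (f + g) (y + z) (u + v) where
  eq_zero x hx := by rw [Pi.add_apply, hu.eq_zero x hx, hv.eq_zero x hx, add_zero]
  integrable d hd := by
    rw [show D.rhs l (f + g) (u + v) = D.rhs l f u + D.rhs l g v from funext (rhs_add l f g u v)]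
    exact (hu.integrable d hd).add (hv.integrable d hd)
  eq_integral x hx := by
    rw [Pi.add_apply, hu.eq_integral x hx, hv.eq_integral x hx]
    simp_rw [rhs_add]
    rw [integral_add ((hu.integrable x hx).mono_set Ioo_subset_Ioc_self)
      ((hv.integrable x hx).mono_set Ioo_subset_Ioc_self)]
    simp only [smul_add]
    abel

theorem IsInitSolution.smul (hu : D.IsInitSolution l f y u) (c : ℂ) :
    D.IsInitSolution l (c • f) (c • y) (c • u) where
  eq_zero x hx := by rw [Pi.smul_apply, hu.eq_zero x hx, smul_zero]
  integrable d hd := by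
    rw [show D.rhs l (c • f) (c • u) = c • D.rhs l f u from funext (rhs_smul l c f u)]
    exact (hu.integrable d hd).smul c
  eq_integral x hx := by
    rw [Pi.smul_apply, hu.eq_integral x hx]
    simp_rw [rhs_smul]
    rw [integral_smul]
    simp only [smul_add, smul_comm c]

theorem ae_singleton {p : ℝ → Prop} {ν : Measure ℝ} (h : ∀ᵐ t ∂ν, p t) {x : ℝ}
    (hx : ν.real {x} ≠ 0) : p x := by
  by_contra hp
  refine hx ?_
  have : ν {x} = 0 := measure_mono_null (singleton_subset_iff.2 hp) h
  rw [Measure.real, this, ENNReal.toReal_zero]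

theorem IsInitSolution.congr_ae (hu : D.IsInitSolution l f y u) (h : f =ᵐ[D.ν] g) :
    D.IsInitSolution l g y u := by
  have hr : D.rhs l f u =ᵐ[D.ν] D.rhs l g u := h.mono fun x hx => by simp only [rhs, hx]
  refine ⟨hu.eq_zero, fun d hd => (hu.integrable d hd).congr (ae_restrict_of_ae hr),
    fun x hx => ?_⟩
  rw [hu.eq_integral x hx, integral_congr_ae (ae_restrict_of_ae hr)]
  by_cases h0 : D.ν.real {x} = 0
  · simp [h0]
  · rw [show D.rhs l f u x = D.rhs l g u x from ae_singleton hr h0]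

theorem aestronglyMeasurable_of_integrableOn (hb : 0 < b) {E : Type*} [NormedAddCommGroup E]
    {f : ℝ → E} (hf : ∀ d ∈ interval b, IntegrableOn f (Ioc 0 d) D.ν) :
    AEStronglyMeasurable f D.ν := by
  obtain ⟨β, hβ, hβI, hβx⟩ := exists_strictMono_cutoffs hb
  have h : AEStronglyMeasurable f (D.ν.restrict (⋃ n, Ioc 0 (β n))) :=
    AEStronglyMeasurable.iUnion fun n => (hf _ (hβI n)).aestronglyMeasurable
  have hU : (⋃ n, Ioc 0 (β n)) =ᵐ[D.ν] univ := by
    rw [eventuallyEq_univ]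
    filter_upwards [D.interval_ae] with x hx
    obtain ⟨n, hn⟩ := hβx x hx
    exact mem_iUnion.2 ⟨n, hx.1, hn.le⟩
  rwa [Measure.restrict_congr_set hU, Measure.restrict_univ] at h

theorem IsRegular.exists_isInitSolution_of_measurable (h : D.IsRegular l) (hfm : Measurable f)
    (hf : ∀ d ∈ interval b, IntegrableOn f (Ioc 0 d) D.ν) (y₀ : Fin 2 → ℂ) :
    ∃ u, Measurable u ∧ D.IsInitSolution l f y₀ u := by
  -- With `w` the left-continuous version of `u` and `u = B_+⁻¹ (J w + p f)`, the equation is the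
  -- Volterra equation `w = y₀ + ∫ (N w + G f) dν`.
  set p : ℝ → ℂ := fun x => ((D.ν.real {x} / 2 : ℝ) : ℂ) with hp
  have hpm : Measurable p := Complex.measurable_ofReal.comp
    ((measurable_measureReal_singleton D.ν).div_const 2)
  set M : ℝ → Matrix (Fin 2) (Fin 2) ℂ := fun x =>
    Coefficients.J * (D.A l x * (D.Bplus l x)⁻¹) with hM
  set N : ℝ → Matrix (Fin 2) (Fin 2) ℂ := fun x => M x * Coefficients.J with hN
  set G : ℝ → Matrix (Fin 2) (Fin 2) ℂ := fun x => p x • M x + -Coefficients.J with hG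
  have hMm : ∀ i j, Measurable fun t => M t i j :=
    measurable_mul_entries (fun _ _ => measurable_const)
      (measurable_mul_entries (D.measurable_A l) (measurable_inv_Bplus l))
  have hNm : ∀ i j, Measurable fun t => N t i j :=
    measurable_mul_entries hMm (fun _ _ => measurable_const)
  have hGm : ∀ i j, Measurable fun t => G t i j := fun i j => (hpm.mul (hMm i j)).add_const _
  have hMb : ∀ d ∈ interval b, EntrywiseBoundedOn M (Ioc 0 d) := fun d hd =>
    (EntrywiseBoundedOn.const _ _).mul ((D.entrywiseBoundedOn_A l _).mul
      (h.entrywiseBoundedOn_inv hd))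
  have hNb : ∀ d ∈ interval b, EntrywiseBoundedOn N (Ioc 0 d) := fun d hd =>
    (hMb d hd).mul (EntrywiseBoundedOn.const _ _)
  have hGb : ∀ d ∈ interval b, EntrywiseBoundedOn G (Ioc 0 d) := fun d hd =>
    ((hMb d hd).smul (exists_measureReal_le hd)).add (EntrywiseBoundedOn.const _ _)
  have hGf : ∀ d ∈ interval b, IntegrableOn (fun t => (G t).mulVec (f t)) (Ioc 0 d) D.ν :=
    fun d hd => integrableOn_mulVec measurableSet_Ioc (hGb d hd) hGm (hf d hd)
  have hGfm : Measurable fun t => (G t).mulVec (f t) := measurable_mulVec hGm hfm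
  obtain ⟨w, hwm, hwb, hw⟩ := exists_volterra_solution D.ν hNm
    (g := fun x => y₀ + ∫ t in Ioo 0 x, (G t).mulVec (f t) ∂D.ν)
    ((stronglyMeasurable_integral_Ioo D.ν hGfm.stronglyMeasurable).measurable.const_add _)
    (interval b) (fun d hd => ν_Ioo_lt_top le_rfl hd) hNb (by
      intro d hd
      refine ⟨(‖y₀‖ₑ + ∫⁻ t in Ioc 0 d, ‖(G t).mulVec (f t)‖ₑ ∂D.ν).toNNReal, fun t ht => ?_⟩
      have hfin : (‖y₀‖ₑ + ∫⁻ t in Ioc 0 d, ‖(G t).mulVec (f t)‖ₑ ∂D.ν) < ⊤ :=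
        ENNReal.add_lt_top.2 ⟨enorm_lt_top, (hGf d hd).2⟩
      rw [ENNReal.coe_toNNReal hfin.ne]
      refine (enorm_add_le _ _).trans (add_le_add_right ?_ _)
      exact (enorm_integral_le_lintegral_enorm _).trans
        (lintegral_mono_set fun s hs => ⟨hs.1, hs.2.le.trans ht.2⟩))
  have hwi : ∀ d ∈ interval b, IntegrableOn w (Ioc 0 d) D.ν := by
    intro d hd
    obtain ⟨C, hC⟩ := hwb d hd
    refine IntegrableOn.of_bound (D.finite d hd) hwm.aestronglyMeasurable C
      ((ae_restrict_iff' measurableSet_Ioc).2 (ae_of_all _ fun t ht => ?_))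
    have := hC t ht
    rw [enorm_eq_nnnorm, ENNReal.coe_le_coe] at this
    exact this
  have hNw : ∀ d ∈ interval b, IntegrableOn (fun t => (N t).mulVec (w t)) (Ioc 0 d) D.ν :=
    fun d hd => integrableOn_mulVec measurableSet_Ioc (hNb d hd) hNm (hwi d hd)
  set u : ℝ → Fin 2 → ℂ := (interval b).indicator fun x =>
    ((D.Bplus l x)⁻¹).mulVec (Coefficients.J.mulVec (w x) + p x • f x) with hu
  have hrhs : ∀ t ∈ interval b, D.rhs l f u t = (N t).mulVec (w t) + (G t).mulVec (f t) := by
    intro t ht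
    simp only [rhs, hu, indicator_of_mem ht, hN, hG, hM]
    simp only [Matrix.mulVec_add, Matrix.mulVec_sub, Matrix.mulVec_smul, Matrix.add_mulVec,
      Matrix.smul_mulVec, Matrix.neg_mulVec, Matrix.mulVec_mulVec, Matrix.mul_assoc]
    abel
  have hsub : ∀ d ∈ interval b, EqOn (D.rhs l f u)
      (fun t => (N t).mulVec (w t) + (G t).mulVec (f t)) (Ioc 0 d) := fun d hd t ht =>
    hrhs t (interval_mem_of_le hd ht.1 ht.2)
  have hi : ∀ d ∈ interval b, IntegrableOn (D.rhs l f u) (Ioc 0 d) D.ν := fun d hd =>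
    IntegrableOn.congr_fun ((hNw d hd).add (hGf d hd)) (hsub d hd).symm measurableSet_Ioc
  refine ⟨u, ?_, fun x hx => indicator_of_notMem hx _, fun d hd => ?_, fun x hx => ?_⟩
  · have h1 : Measurable fun x => Coefficients.J.mulVec (w x) + p x • f x :=
      (measurable_mulVec (N := fun _ => Coefficients.J)
        (fun _ _ => measurable_const) hwm).add (hpm.smul hfm)
    exact (measurable_mulVec (measurable_inv_Bplus l) h1).indicator
      (isOpen_interval b).measurableSet
  · exact hi d hd
  · have hint : ∫ t in Ioo 0 x, D.rhs l f u t ∂D.ν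
        = ∫ t in Ioo 0 x, (N t).mulVec (w t) ∂D.ν + ∫ t in Ioo 0 x, (G t).mulVec (f t) ∂D.ν := by
      rw [setIntegral_congr_fun measurableSet_Ioo ((hsub x hx).mono Ioo_subset_Ioc_self),
        integral_add ((hNw x hx).mono_set Ioo_subset_Ioc_self)
          ((hGf x hx).mono_set Ioo_subset_Ioc_self)]
    have hwx : y₀ + ∫ t in Ioo 0 x, D.rhs l f u t ∂D.ν = w x := by
      rw [hint, hw x hx hx.1]; abel
    rw [hwx]
    have hB : (D.Bplus l x).mulVec (u x) = Coefficients.J.mulVec (w x) + p x • f x := by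
      rw [hu, indicator_of_mem hx, Matrix.mulVec_mulVec,
        Matrix.mul_nonsing_inv _ (isUnit_iff_ne_zero.2 (h x hx).1), Matrix.one_mulVec]
    rw [(Bplus_mulVec_eq_iff l x _ _ _).1 hB, half_smul_smul]
    rfl

/-- The initial value problem at the regular endpoint `0` is solvable. -/
theorem IsRegular.exists_isInitSolution (hb : 0 < b) (h : D.IsRegular l)
    (hf : ∀ d ∈ interval b, IntegrableOn f (Ioc 0 d) D.ν) (y₀ : Fin 2 → ℂ) :
    ∃ u, Measurable u ∧ D.IsInitSolution l f y₀ u := by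
  have hm := (aestronglyMeasurable_of_integrableOn hb hf).aemeasurable
  obtain ⟨u, hum, hu⟩ := h.exists_isInitSolution_of_measurable hm.measurable_mk
    (fun d hd => (hf d hd).congr (ae_restrict_of_ae hm.ae_eq_mk)) y₀
  exact ⟨u, hum, hu.congr_ae hm.ae_eq_mk.symm⟩

end DensityData

/-! ### Lagrange's identity and the fundamental matrices -/

theorem sympForm_smul_right (z y : Fin 2 → ℂ) (c : ℂ) :
    sympForm z (c • y) = c * sympForm z y := by
  simp only [sympForm, Pi.smul_apply, smul_eq_mul]; ring

theorem sympForm_nondegenerate {a a' : Fin 2 → ℂ} (h : ∀ w, sympForm w a = sympForm w a') :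
    a = a' := by
  have h0 := h ![0, 1]
  have h1 := h ![1, 0]
  simp [sympForm] at h0 h1
  ext i
  fin_cases i
  · exact h0
  · exact h1

namespace DensityData

variable {b : EReal} {D : DensityData b} {l l' : ℂ} {f g u v : ℝ → Fin 2 → ℂ} {y z : Fin 2 → ℂ}

theorem IsInitSolution.lagrange (hu : D.IsInitSolution l f y u) (hv : D.IsInitSolution l' g z v)
    {x : ℝ} (hx : x ∈ interval b) :
    IntegrableOn (fun t => star (v t) ⬝ᵥ f t - star (g t) ⬝ᵥ u t
      + (l - star l') * (star ((D.S t).mulVec (v t)) ⬝ᵥ (D.S t).mulVec (u t))) (Ioo 0 x) D.ν ∧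
    sympForm (Function.leftLim v x) (Function.leftLim u x)
      = sympForm z y + ∫ t in Ioo 0 x, (star (v t) ⬝ᵥ f t - star (g t) ⬝ᵥ u t
          + (l - star l') * (star ((D.S t).mulVec (v t)) ⬝ᵥ (D.S t).mulVec (u t))) ∂D.ν := by
  rw [hu.leftLim_eq hx, hv.leftLim_eq hx]
  exact D.lagrange (ν_Ioo_lt_top le_rfl hx) (hu.isPrimitiveOn hx) (hv.isPrimitiveOn hx)

theorem IsBVSolution.eq_leftLim_add (h : D.IsBVSolution l f u)
    (hf : ∀ d ∈ interval b, IntegrableOn f (Ioc 0 d) D.ν) {x : ℝ} (hx : x ∈ interval b) :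
    u x = Function.leftLim u x + ((D.ν.real {x} / 2 : ℝ) : ℂ) • D.rhs l f u x := by
  conv_lhs => rw [h.balanced x hx, h.rightLim_eq hf hx]
  ext i
  simp [Complex.real_smul]
  ring

/-- Lagrange's identity between the left limits at two points. -/
theorem IsBVSolution.lagrange (hu : D.IsBVSolution l f u)
    (hf : ∀ d ∈ interval b, IntegrableOn f (Ioc 0 d) D.ν) (hv : D.IsBVSolution l' g v)
    (hg : ∀ d ∈ interval b, IntegrableOn g (Ioc 0 d) D.ν) {c d : ℝ} (hc : 0 < c) (hcd : c < d)
    (hd : d ∈ interval b) :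
    sympForm (Function.leftLim v d) (Function.leftLim u d)
      = sympForm (Function.leftLim v c) (Function.leftLim u c)
        + D.ν.real {c} * (star (v c) ⬝ᵥ f c - star (g c) ⬝ᵥ u c
          + (l - star l') * (star ((D.S c).mulVec (v c)) ⬝ᵥ (D.S c).mulVec (u c)))
        + ∫ t in Ioo c d, (star (v t) ⬝ᵥ f t - star (g t) ⬝ᵥ u t
          + (l - star l') * (star ((D.S t).mulVec (v t)) ⬝ᵥ (D.S t).mulVec (u t))) ∂D.ν := by
  have hcI := interval_mem_of_le hd hc hcd.le
  have h1 := (D.lagrange (ν_Ioo_lt_top hc.le hd) (hu.isPrimitiveOn hf hc hd)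
    (hv.isPrimitiveOn hg hc hd)).2
  rw [← hu.equation c d hc hcd hd.2, ← hv.equation c d hc hcd hd.2, add_sub_cancel,
    add_sub_cancel] at h1
  rw [h1, ← D.sympForm_rhs, add_left_inj, hu.rightLim_eq hf hcI, hv.rightLim_eq hg hcI]
  have e1 := hu.eq_leftLim_add hf hcI
  have e2 := hv.eq_leftLim_add hg hcI
  generalize D.rhs l f u c = φ at *
  generalize D.rhs l' g v c = ψ at *
  rw [e1, e2]
  simp only [sympForm, Pi.add_apply, Pi.smul_apply, smul_eq_mul, Complex.real_smul, star_add,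
    star_mul', Complex.star_def, Complex.conj_ofReal]
  push_cast
  ring

/-- A solution is determined by its left limits, by invertibility of `B_+`. -/
theorem IsRegular.eq_of_leftLim_eq (h : D.IsRegular l) (hu : D.IsBVSolution l f u)
    (hv : D.IsBVSolution l f v) (hf : ∀ d ∈ interval b, IntegrableOn f (Ioc 0 d) D.ν)
    (huv : ∀ x ∈ interval b, Function.leftLim u x = Function.leftLim v x) : u = v := by
  funext x
  by_cases hx : x ∈ interval b
  · have e1 := (Bplus_mulVec_eq_iff l x _ _ _).2 (hu.eq_leftLim_add hf hx)
    have e2 := (Bplus_mulVec_eq_iff l x _ _ _).2 (hv.eq_leftLim_add hf hx)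
    rw [huv x hx, ← e2] at e1
    exact Matrix.mulVec_injective_of_isUnit
      ((Matrix.isUnit_iff_isUnit_det _).2 (isUnit_iff_ne_zero.2 (h x hx).1)) e1
  · rw [hu.eq_zero x hx, hv.eq_zero x hx]

/-- `U` is the fundamental matrix of `J u' + (q - l w) u = 0` with `U(0+) = 1`, and `Y` is
its left-continuous version. -/
structure IsFundamental (D : DensityData b) (l : ℂ) (U Y : ℝ → Matrix (Fin 2) (Fin 2) ℂ) :
    Prop where
  isInitSolution : ∀ k, D.IsInitSolution l 0 k (fun x => (U x).mulVec k)
  leftLim_eq : ∀ k, ∀ x ∈ interval b,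
    Function.leftLim (fun x => (U x).mulVec k) x = (Y x).mulVec k

theorem integrableOn_zero : ∀ d ∈ interval b, IntegrableOn (0 : ℝ → Fin 2 → ℂ) (Ioc 0 d) D.ν :=
  fun _ _ => integrable_zero _ _ _

theorem IsRegular.exists_isFundamental (hb : 0 < b) (h : D.IsRegular l) :
    ∃ U Y, D.IsFundamental l U Y := by
  obtain ⟨u, -, hu⟩ := h.exists_isInitSolution hb D.integrableOn_zero ![1, 0]
  obtain ⟨v, -, hv⟩ := h.exists_isInitSolution hb D.integrableOn_zero ![0, 1]
  have key : ∀ k : Fin 2 → ℂ, D.IsInitSolution l 0 k (k 0 • u + k 1 • v) := by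
    intro k
    have := (hu.smul (k 0)).add (hv.smul (k 1))
    rw [smul_zero, smul_zero, add_zero] at this
    convert this using 1
    ext i
    fin_cases i <;> simp
  have hU : ∀ (p q : ℝ → Fin 2 → ℂ) (k : Fin 2 → ℂ) (x : ℝ),
      (Matrix.of fun i j => ![p x i, q x i] j).mulVec k = k 0 • p x + k 1 • q x := by
    intro p q k x
    ext i
    simp [Matrix.mulVec, dotProduct, Fin.sum_univ_two]
    ring
  have hfun : ∀ k : Fin 2 → ℂ, (fun x => (Matrix.of fun i j => ![u x i, v x i] j).mulVec k)
      = k 0 • u + k 1 • v := fun k => funext fun x => hU u v k x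
  refine ⟨fun x => Matrix.of fun i j => ![u x i, v x i] j,
    fun x => Matrix.of fun i j => ![Function.leftLim u x i, Function.leftLim v x i] j,
    fun k => ?_, fun k x hx => ?_⟩
  · rw [hfun]; exact key k
  · rw [hfun]
    refine (leftLim_eq_of_tendsto (((((key k).tendsto_left hx).congr fun _ => rfl)))).trans ?_
    rw [← (key k).leftLim_eq hx]
    refine (leftLim_eq_of_tendsto (((hu.tendsto_left hx).const_smul (k 0)).add
      ((hv.tendsto_left hx).const_smul (k 1)))).trans ?_
    rw [← hu.leftLim_eq hx, ← hv.leftLim_eq hx]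
    exact (hU (Function.leftLim u) (Function.leftLim v) k x).symm

section pair

variable {U Y V Z : ℝ → Matrix (Fin 2) (Fin 2) ℂ}

/-- The form `z* J y` of solutions at `star l` and at `l` is constant. -/
theorem IsFundamental.sympForm_eq (hU : D.IsFundamental l U Y)
    (hV : D.IsFundamental (star l) V Z) {x : ℝ} (hx : x ∈ interval b) (z k : Fin 2 → ℂ) :
    sympForm ((Z x).mulVec z) ((Y x).mulVec k) = sympForm z k := by
  have := ((hU.isInitSolution k).lagrange (hV.isInitSolution z) hx).2
  rw [hU.leftLim_eq k x hx, hV.leftLim_eq z x hx] at this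
  simpa using this

/-- If `Zᴴ J Y = J`, then `Z` is the conjugate of `Y / det Y`. -/
theorem star_det_mul_det_of_sympForm {Z Y : Matrix (Fin 2) (Fin 2) ℂ}
    (h : ∀ z k, sympForm (Z.mulVec z) (Y.mulVec k) = sympForm z k) :
    star Z.det * Y.det = 1 ∧ ∀ i j, star (Z i j) * Y.det = Y i j := by
  have h00 := h ![1, 0] ![1, 0]
  have h01 := h ![1, 0] ![0, 1]
  have h10 := h ![0, 1] ![1, 0]
  have h11 := h ![0, 1] ![0, 1]
  simp [sympForm, Matrix.mulVec, dotProduct, Fin.sum_univ_two] at h00 h01 h10 h11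
  simp only [Matrix.det_fin_two, Complex.star_def, map_sub, map_mul]
  refine ⟨by
    linear_combination Y 0 0 * (starRingEnd ℂ) (Z 1 0) * h11
      - h01 * Y 0 0 * (starRingEnd ℂ) (Z 1 1) + h01 * Y 1 0 * (starRingEnd ℂ) (Z 0 1)
      - Y 1 0 * (starRingEnd ℂ) (Z 0 0) * h11 + h10, ?_⟩
  rw [Fin.forall_fin_two, Fin.forall_fin_two, Fin.forall_fin_two]
  exact ⟨⟨by linear_combination Y 0 1 * h00 - Y 0 0 * h01,
      by linear_combination Y 0 1 * h10 - Y 0 0 * h11⟩,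
    ⟨by linear_combination Y 1 1 * h00 - Y 1 0 * h01,
      by linear_combination Y 1 1 * h10 - Y 1 0 * h11⟩⟩

theorem IsFundamental.star_det_mul_det (hU : D.IsFundamental l U Y)
    (hV : D.IsFundamental (star l) V Z) {x : ℝ} (hx : x ∈ interval b) :
    star (Z x).det * (Y x).det = 1 :=
  (star_det_mul_det_of_sympForm (hU.sympForm_eq hV hx)).1

theorem IsFundamental.star_mul_det (hU : D.IsFundamental l U Y)
    (hV : D.IsFundamental (star l) V Z) {x : ℝ} (hx : x ∈ interval b) (i j : Fin 2) :
    star (Z x i j) * (Y x).det = Y x i j :=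
  (star_det_mul_det_of_sympForm (hU.sympForm_eq hV hx)).2 i j

theorem IsFundamental.det_ne_zero (hU : D.IsFundamental l U Y)
    (hV : D.IsFundamental (star l) V Z) {x : ℝ} (hx : x ∈ interval b) :
    (Y x).det ≠ 0 ∧ (Z x).det ≠ 0 := by
  have := hU.star_det_mul_det hV hx
  constructor
  · intro h0; simp [h0] at this
  · intro h0; simp [h0] at this

theorem eq_of_sympForm_mulVec {Z : Matrix (Fin 2) (Fin 2) ℂ} (hZ : Z.det ≠ 0) {a a' : Fin 2 → ℂ}
    (h : ∀ z, sympForm (Z.mulVec z) a = sympForm (Z.mulVec z) a') : a = a' := by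
  refine sympForm_nondegenerate fun w => ?_
  have := h (Z⁻¹.mulVec w)
  rwa [Matrix.mulVec_mulVec, Matrix.mul_nonsing_inv _ (isUnit_iff_ne_zero.2 hZ),
    Matrix.one_mulVec] at this

/-- A solution on `(0, b)` attains an initial value at `0`: it agrees with the solution of an
initial value problem to which it is equal at one point, since the pairing with all solutions at
`star l` propagates the equality to both sides. -/
theorem IsBVSolution.exists_isInitSolution (hb : 0 < b) (h : D.IsRegular l)
    (hu : D.IsBVSolution l f u) (hf : ∀ d ∈ interval b, IntegrableOn f (Ioc 0 d) D.ν) :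
    ∃ y, D.IsInitSolution l f y u := by
  obtain ⟨U, Y, hU⟩ := h.exists_isFundamental hb
  obtain ⟨V, Z, hV⟩ := h.conj.exists_isFundamental hb
  obtain ⟨p, -, hp⟩ := h.exists_isInitSolution hb hf 0
  obtain ⟨β, -, hβI, -⟩ := exists_strictMono_cutoffs hb
  set x₀ := β 0
  have hx₀ : x₀ ∈ interval b := hβI 0
  set k := (Y x₀)⁻¹.mulVec (Function.leftLim u x₀ - Function.leftLim p x₀) with hk
  have hv : D.IsInitSolution l f k (p + fun x => (U x).mulVec k) := by
    have := hp.add (hU.isInitSolution k)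
    rwa [add_zero, zero_add] at this
  refine ⟨k, ?_⟩
  have hv₀ : Function.leftLim (p + fun x => (U x).mulVec k) x₀ = Function.leftLim u x₀ := by
    refine (leftLim_eq_of_tendsto ((hp.tendsto_left hx₀).add
      ((hU.isInitSolution k).tendsto_left hx₀))).trans ?_
    rw [← hp.leftLim_eq hx₀, ← (hU.isInitSolution k).leftLim_eq hx₀, hU.leftLim_eq k x₀ hx₀, hk,
      Matrix.mulVec_mulVec, Matrix.mul_nonsing_inv _
        (isUnit_iff_ne_zero.2 (hU.det_ne_zero hV hx₀).1), Matrix.one_mulVec]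
    abel
  suffices u = p + fun x => (U x).mulVec k by rw [this]; exact hv
  refine h.eq_of_leftLim_eq hu hv.isBVSolution hf fun x hx => ?_
  refine eq_of_sympForm_mulVec (hU.det_ne_zero hV hx).2 fun z => ?_
  have hVz := (hV.isInitSolution z).isBVSolution
  rw [← hV.leftLim_eq z x hx]
  rcases lt_trichotomy x x₀ with hlt | heq | hgt
  · have e1 := hu.lagrange hf hVz integrableOn_zero hx.1 hlt hx₀
    have e2 := hv.isBVSolution.lagrange hf hVz integrableOn_zero hx.1 hlt hx₀
    rw [hv₀, e1] at e2
    simp only [star_star, sub_self, zero_mul, Pi.zero_apply, star_zero, zero_dotProduct, sub_zero,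
      add_zero] at e2
    linear_combination e2
  · rw [heq, hv₀]
  · have e1 := hu.lagrange hf hVz integrableOn_zero hx₀.1 hgt hx
    have e2 := hv.isBVSolution.lagrange hf hVz integrableOn_zero hx₀.1 hgt hx
    rw [hv₀] at e2
    simp only [star_star, sub_self, zero_mul, Pi.zero_apply, star_zero, zero_dotProduct, sub_zero,
      add_zero] at e1 e2
    rw [e1, e2]

theorem IsInitSolution.unique (hb : 0 < b) (h : D.IsRegular l) (hu : D.IsInitSolution l f y u)
    (hv : D.IsInitSolution l f y v) (hf : ∀ d ∈ interval b, IntegrableOn f (Ioc 0 d) D.ν) :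
    u = v := by
  obtain ⟨U, Y, hU⟩ := h.exists_isFundamental hb
  obtain ⟨V, Z, hV⟩ := h.conj.exists_isFundamental hb
  refine h.eq_of_leftLim_eq hu.isBVSolution hv.isBVSolution hf fun x hx => ?_
  refine eq_of_sympForm_mulVec (hU.det_ne_zero hV hx).2 fun z => ?_
  rw [← hV.leftLim_eq z x hx, (hu.lagrange (hV.isInitSolution z) hx).2,
    (hv.lagrange (hV.isInitSolution z) hx).2]
  simp

end pair

end DensityData

/-! ### Scalar equations `dF = h F dν` -/

theorem half_mul_eq {ν : Measure ℝ} {x : ℝ} {a : ℂ} (h : ν.real {x} = 0 ∨ a = 0) :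
    (1 / 2 : ℂ) * (ν.real {x} * a) = 0 := by
  rcases h with h | h <;> simp [h]

/-- If `M` is the primitive of `h dν` and `h` vanishes at the atoms of `ν`, then
`d (M ^ (k + 1)) = (k + 1) M ^ k h dν`. -/
theorem pow_setIntegral_eq {ν : Measure ℝ} {d : ℝ} (hν : ν (Ioo 0 d) < ⊤) {h : ℝ → ℂ}
    (hi : IntegrableOn h (Ioo 0 d) ν) (h0 : ∀ x, ν.real {x} = 0 ∨ h x = 0) (k : ℕ) :
    IntegrableOn (fun t => ((k : ℂ) + 1) * (∫ s in Ioo 0 t, h s ∂ν) ^ k * h t) (Ioo 0 d) ν ∧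
    ∀ x ∈ Ioc 0 d, (∫ s in Ioo 0 x, h s ∂ν) ^ (k + 1)
      = ∫ t in Ioo 0 x, ((k : ℂ) + 1) * (∫ s in Ioo 0 t, h s ∂ν) ^ k * h t ∂ν := by
  induction k with
  | zero =>
    simp only [Nat.cast_zero, zero_add, pow_zero, mul_one, one_mul, pow_one]
    exact ⟨hi, fun x _ => trivial⟩
  | succ k ih =>
    obtain ⟨ih1, ih2⟩ := ih
    have hpr : ∀ x ∈ Ioc 0 d,
        IntegrableOn (fun t => ((k + 1 : ℕ) + 1) * (∫ s in Ioo 0 t, h s ∂ν) ^ (k + 1) * h t)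
          (Ioo 0 x) ν ∧ (∫ s in Ioo 0 x, h s ∂ν) ^ (k + 1 + 1)
      = ∫ t in Ioo 0 x, (((k + 1 : ℕ) : ℂ) + 1) * (∫ s in Ioo 0 t, h s ∂ν) ^ (k + 1) * h t ∂ν := by
      intro x hx
      have hsub : Ioo 0 x ⊆ Ioo 0 d := Ioo_subset_Ioo_right hx.2
      have hνx : ν (Ioo 0 x) < ⊤ := (measure_mono hsub).trans_lt hν
      obtain ⟨p1, p2⟩ := mul_eq_mul_add_integral hνx (hi.mono_set hsub) (ih1.mono_set hsub)
        (α := 0) (β := 0) (u := fun t => ∫ s in Ioo 0 t, h s ∂ν)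
        (v := fun t => (∫ s in Ioo 0 t, h s ∂ν) ^ (k + 1))
        (fun t _ => by rw [half_mul_eq (h0 t)]; simp)
        (fun t ht => by
          rw [half_mul_eq ((h0 t).imp id fun h => by rw [h, mul_zero]),
            ← ih2 t ⟨ht.1, (ht.2.trans_le hx.2).le⟩]
          simp)
      have he : ∀ t, h t * (∫ s in Ioo 0 t, h s ∂ν) ^ (k + 1)
          + (∫ s in Ioo 0 t, h s ∂ν) * (((k : ℂ) + 1) * (∫ s in Ioo 0 t, h s ∂ν) ^ k * h t)
          = (((k + 1 : ℕ) : ℂ) + 1) * (∫ s in Ioo 0 t, h s ∂ν) ^ (k + 1) * h t := by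
        intro t; push_cast; ring
      simp_rw [he] at p1 p2
      refine ⟨p1, ?_⟩
      rw [zero_add, zero_add, ← ih2 x hx, zero_mul, zero_add] at p2
      rw [← p2]
      ring
    refine ⟨?_, fun x hx => (hpr x hx).2⟩
    by_cases hd : 0 < d
    · exact (hpr d ⟨hd, le_rfl⟩).1
    · rw [Ioo_eq_empty hd]; exact integrableOn_empty

/-- If `h` vanishes at the atoms of `ν`, the exponential of its primitive solves `dF = h F dν`. -/
theorem exp_setIntegral_eq {ν : Measure ℝ} {d : ℝ} (hν : ν (Ioo 0 d) < ⊤) {h : ℝ → ℂ}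
    (hi : IntegrableOn h (Ioo 0 d) ν) (h0 : ∀ x, ν.real {x} = 0 ∨ h x = 0) {x : ℝ}
    (hx : x ∈ Ioc 0 d) :
    IntegrableOn (fun t => h t * Complex.exp (∫ s in Ioo 0 t, h s ∂ν)) (Ioo 0 x) ν ∧
    Complex.exp (∫ s in Ioo 0 x, h s ∂ν)
      = 1 + ∫ t in Ioo 0 x, h t * Complex.exp (∫ s in Ioo 0 t, h s ∂ν) ∂ν := by
  have hsub : Ioo 0 x ⊆ Ioo 0 d := Ioo_subset_Ioo_right hx.2
  have hix := hi.mono_set hsub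
  set M : ℝ → ℂ := fun t => ∫ s in Ioo 0 t, h s ∂ν with hM
  set R : ℝ := ∫ s in Ioo 0 x, ‖h s‖ ∂ν with hR
  have hMR : ∀ t ∈ Ioo 0 x, ‖M t‖ ≤ R := fun t ht =>
    (norm_integral_le_integral_norm _).trans (setIntegral_mono_set hix.norm
      (ae_of_all _ fun _ => norm_nonneg _)
      (Ioo_subset_Ioo_right ht.2.le).eventuallyLE)
  have hR0 : 0 ≤ R := integral_nonneg fun _ => norm_nonneg _
  set F : ℕ → ℝ → ℂ := fun k t => h t * ((k.factorial : ℂ)⁻¹ * M t ^ k) with hF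
  have hFk : ∀ k, IntegrableOn (F k) (Ioo 0 x) ν ∧
      ∫ t in Ioo 0 x, F k t ∂ν = ((k + 1).factorial : ℂ)⁻¹ * M x ^ (k + 1) := by
    intro k
    obtain ⟨p1, p2⟩ := pow_setIntegral_eq hν hi h0 k
    have e : F k = fun t => ((k + 1).factorial : ℂ)⁻¹ * (((k : ℂ) + 1) * M t ^ k * h t) := by
      funext t
      have hk : ((k : ℂ) + 1) ≠ 0 := by exact_mod_cast Nat.succ_ne_zero k
      have hk' : (k.factorial : ℂ) ≠ 0 := by exact_mod_cast Nat.factorial_ne_zero k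
      rw [hF, Nat.factorial_succ]
      push_cast
      field_simp
    rw [e]
    refine ⟨(p1.mono_set hsub).const_mul _, ?_⟩
    rw [integral_const_mul, ← p2 x hx]
  have hnorm : ∀ k, ∫ t in Ioo 0 x, ‖F k t‖ ∂ν ≤ (R ^ k / k.factorial) * R := by
    intro k
    rw [hR, ← integral_const_mul]
    refine setIntegral_mono_on (hFk k).1.norm (hix.norm.const_mul _) measurableSet_Ioo
      fun t ht => ?_
    rw [hF, norm_mul, norm_mul, norm_pow, norm_inv, Complex.norm_natCast, mul_comm, div_eq_inv_mul]
    gcongr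
    exact hMR t ht
  have hsum : Summable fun k => ∫ t in Ioo 0 x, ‖F k t‖ ∂ν :=
    Summable.of_nonneg_of_le (fun k => integral_nonneg fun _ => norm_nonneg _) hnorm
      ((Real.summable_pow_div_factorial R).mul_right R)
  have hexp : ∀ z : ℂ, HasSum (fun k : ℕ => (k.factorial : ℂ)⁻¹ * z ^ k) (Complex.exp z) := by
    intro z
    rw [Complex.exp_eq_exp_ℂ]
    have := NormedSpace.exp_series_hasSum_exp' (𝕂 := ℂ) z
    simpa [smul_eq_mul] using this
  have hpt : ∀ t, ∑' k, F k t = h t * Complex.exp (M t) := fun t =>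
    ((hexp (M t)).mul_left (h t)).tsum_eq
  have hint := hasSum_integral_of_summable_integral_norm (fun k => (hFk k).1) hsum
  simp_rw [hpt] at hint
  refine ⟨?_, ?_⟩
  · have hMm : AEStronglyMeasurable (fun t => Complex.exp (M t)) (ν.restrict (Ioo 0 x)) := by
      have hm1 : AEStronglyMeasurable M (ν.restrict (Ioo 0 x)) := by
        have hf := hix.1.aemeasurable
        have : M =ᵐ[ν.restrict (Ioo 0 x)] fun t => ∫ s in Ioo 0 t, hf.mk h s
            ∂(ν.restrict (Ioo 0 x)) := by
          refine (ae_restrict_iff' measurableSet_Ioo).2 (ae_of_all _ fun t ht => ?_)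
          have hr : (ν.restrict (Ioo 0 x)).restrict (Ioo 0 t) = ν.restrict (Ioo 0 t) :=
            Measure.restrict_restrict_of_subset (Ioo_subset_Ioo_right ht.2.le)
          have hae := ae_restrict_of_ae (s := Ioo 0 t) hf.ae_eq_mk
          rw [hM]
          beta_reduce
          rw [← hr]
          exact integral_congr_ae hae
        have hfin : IsFiniteMeasure (ν.restrict (Ioo 0 x)) :=
          ⟨by rw [Measure.restrict_apply_univ]; exact (measure_mono hsub).trans_lt hν⟩
        exact ⟨_, stronglyMeasurable_integral_Ioo _ hf.measurable_mk.stronglyMeasurable, this⟩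
      exact Complex.continuous_exp.comp_aestronglyMeasurable hm1
    refine hix.mul_bdd hMm (c := Real.exp R) ?_
    refine (ae_restrict_iff' measurableSet_Ioo).2 (ae_of_all _ fun t ht => ?_)
    rw [Complex.norm_exp]
    exact Real.exp_le_exp.2 ((Complex.re_le_norm _).trans (hMR t ht))
  · rw [← hint.tsum_eq, ← (hexp (M x)).tsum_eq, (hexp (M x)).summable.tsum_eq_zero_add]
    congr 1
    · simp
    · exact tsum_congr fun k => (hFk k).2.symm

/-! ### Infinite products over the atoms -/

theorem norm_prod_one_add_indicator_le {p : ℝ → ℂ} (hp : Summable fun y => ‖p y‖) (s : Set ℝ)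
    (F : Finset ℝ) : ‖∏ y ∈ F, (1 + s.indicator p y)‖ ≤ Real.exp (∑' z, ‖p z‖) := by
  rw [norm_prod]
  calc ∏ z ∈ F, ‖1 + s.indicator p z‖ ≤ ∏ z ∈ F, Real.exp ‖p z‖ := by
        refine Finset.prod_le_prod (fun _ _ => norm_nonneg _) fun z _ => ?_
        refine (norm_add_le _ _).trans ?_
        rw [norm_one, add_comm]
        exact (add_le_add_left (norm_indicator_le_norm_self _ z) 1).trans (Real.add_one_le_exp _)
    _ = Real.exp (∑ z ∈ F, ‖p z‖) := (Real.exp_sum _ _).symm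
    _ ≤ _ := Real.exp_le_exp.2 (hp.sum_le_tsum _ fun _ _ => norm_nonneg _)

/-- The ordered expansion of an infinite product over the reals: the terms other than `1` are
grouped by their largest index `y`. -/
theorem tprod_one_add_eq_one_add_tsum {p : ℝ → ℂ} (hp : Summable fun y => ‖p y‖) (x : ℝ) :
    ∏' y, (1 + (Iio x).indicator p y)
      = 1 + ∑' y, (Iio x).indicator p y * ∏' z, (1 + (Iio y).indicator p z) := by
  have hind : ∀ (s : Set ℝ) y, ‖s.indicator p y‖ ≤ ‖p y‖ := fun s y =>
    norm_indicator_le_norm_self _ _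
  have hps : ∀ s : Set ℝ, Summable fun y => ‖s.indicator p y‖ := fun s =>
    Summable.of_nonneg_of_le (fun _ => norm_nonneg _) (hind s) hp
  have hmul : ∀ s : Set ℝ, Multipliable fun y => 1 + s.indicator p y := fun s =>
    multipliable_one_add_of_summable (hps s)
  have hfin : ∀ F : Finset ℝ, ∏ y ∈ F, (1 + (Iio x).indicator p y)
      = 1 + ∑' y, (if y ∈ F then (Iio x).indicator p y * ∏ z ∈ F, (1 + (Iio y).indicator p z)
          else 0) := by
    intro F
    rw [Finset.prod_one_add_ordered, tsum_eq_sum (s := F) (by intro y hy; rw [if_neg hy])]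
    congr 1
    refine Finset.sum_congr rfl fun y hy => ?_
    rw [if_pos hy]
    by_cases hyx : y < x
    · congr 1
      rw [Finset.prod_filter]
      refine Finset.prod_congr rfl fun z _ => ?_
      by_cases hzy : z < y
      · rw [if_pos hzy, indicator_of_mem (show z ∈ Iio x from hzy.trans hyx),
          indicator_of_mem (show z ∈ Iio y from hzy)]
      · rw [if_neg hzy, indicator_of_notMem (by exact hzy), add_zero]
    · rw [indicator_of_notMem (by exact hyx), zero_mul, zero_mul]
  have h1 : Tendsto (fun F : Finset ℝ => ∏ y ∈ F, (1 + (Iio x).indicator p y)) atTop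
      (𝓝 (∏' y, (1 + (Iio x).indicator p y))) := (hmul _).hasProd
  have h2 : Tendsto (fun F : Finset ℝ => 1 + ∑' y,
      (if y ∈ F then (Iio x).indicator p y * ∏ z ∈ F, (1 + (Iio y).indicator p z) else 0)) atTop
      (𝓝 (1 + ∑' y, (Iio x).indicator p y * ∏' z, (1 + (Iio y).indicator p z))) := by
    refine Tendsto.const_add _ (tendsto_tsum_of_dominated_convergence
      (bound := fun y => ‖p y‖ * Real.exp (∑' z, ‖p z‖)) (hp.mul_right _) (fun y => ?_)
      (Eventually.of_forall fun F y => ?_))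
    · have : Tendsto (fun F : Finset ℝ => (Iio x).indicator p y
          * ∏ z ∈ F, (1 + (Iio y).indicator p z)) atTop
          (𝓝 ((Iio x).indicator p y * ∏' z, (1 + (Iio y).indicator p z))) :=
        (hmul _).hasProd.const_mul _
      refine this.congr' ?_
      filter_upwards [eventually_ge_atTop {y}] with F hF
      rw [if_pos (hF (Finset.mem_singleton_self y))]
    · split_ifs with hy
      · rw [norm_mul]
        refine mul_le_mul (hind _ _) ?_ (norm_nonneg _) (norm_nonneg _)
        exact norm_prod_one_add_indicator_le hp _ F
      · rw [norm_zero]; positivity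
  exact tendsto_nhds_unique (h1.congr hfin) h2

theorem norm_tprod_one_add_le {p : ℝ → ℂ} (hp : Summable fun y => ‖p y‖) (x : ℝ) :
    ‖∏' y, (1 + (Iio x).indicator p y)‖ ≤ Real.exp (∑' z, ‖p z‖) := by
  have hind : ∀ (s : Set ℝ) y, ‖s.indicator p y‖ ≤ ‖p y‖ := fun s y =>
    norm_indicator_le_norm_self _ _
  have hps : Summable fun y => ‖(Iio x).indicator p y‖ :=
    Summable.of_nonneg_of_le (fun _ => norm_nonneg _) (hind _) hp
  have h1 : Tendsto (fun F : Finset ℝ => ∏ y ∈ F, (1 + (Iio x).indicator p y)) atTop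
      (𝓝 (∏' y, (1 + (Iio x).indicator p y))) := (multipliable_one_add_of_summable hps).hasProd
  refine le_of_tendsto h1.norm (Eventually.of_forall fun F => ?_)
  exact norm_prod_one_add_indicator_le hp _ F

theorem aemeasurable_restrict_of_countable {ν : Measure ℝ} {s : Set ℝ} (hs : s.Countable)
    (g : ℝ → ℂ) : AEMeasurable g (ν.restrict s) := by
  have := hs.to_subtype
  have hU : s = ⋃ a : s, {(a : ℝ)} := (iUnion_of_singleton_coe s).symm
  rw [hU, aemeasurable_iUnion_iff]
  intro a
  refine (aemeasurable_const (b := g a)).congr ?_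
  exact (ae_restrict_iff' (measurableSet_singleton _)).2
    (ae_of_all _ fun t ht => by rw [mem_singleton_iff.1 ht])

/-- The product `P` of `1 + h(y) ν({y})` over the atoms `y < x` solves `dP = h P dν_a` for the
atomic part `ν_a` of `ν`. -/
theorem tprod_atoms_eq {ν : Measure ℝ} {d : ℝ} (hν : ν (Ioo 0 d) < ⊤) {h : ℝ → ℂ} {C : ℝ}
    (hC : ∀ t ∈ Ioo 0 d, ‖h t‖ ≤ C) {P : ℝ → ℂ}
    (hP : ∀ x, P x = ∏' y, (1 + (Iio x).indicator ((Ioo 0 d).indicator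
      fun t => h t * ν.real {t}) y)) :
    (∃ R, ∀ x, ‖P x‖ ≤ R) ∧
    IntegrableOn (fun t => {t | ν.real {t} ≠ 0}.indicator h t * P t) (Ioo 0 d) ν ∧
    ∀ x ∈ Ioc 0 d, P x = 1 + ∫ t in Ioo 0 x, {t | ν.real {t} ≠ 0}.indicator h t * P t ∂ν := by
  set p : ℝ → ℂ := (Ioo 0 d).indicator fun t => h t * ν.real {t} with hp
  have hfin : IsFiniteMeasure (ν.restrict (Ioo 0 d)) :=
    ⟨by rwa [Measure.restrict_apply_univ]⟩
  have hatoms : Summable fun t => (ν.restrict (Ioo 0 d)).real {t} := by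
    refine ENNReal.summable_toReal ?_
    have := tsum_meas_le_meas_iUnion_of_disjoint (ν.restrict (Ioo 0 d))
      (fun t : ℝ => measurableSet_singleton t)
      (fun s t hst => disjoint_singleton.2 hst)
    exact ne_top_of_le_ne_top (measure_ne_top _ _) this
  have hnu : ∀ t ∈ Ioo 0 d, (ν.restrict (Ioo 0 d)).real {t} = ν.real {t} := by
    intro t ht
    rw [measureReal_restrict_apply (measurableSet_singleton t),
      inter_eq_left.2 (singleton_subset_iff.2 ht)]
  have hsum : Summable fun y => ‖p y‖ := by
    refine Summable.of_nonneg_of_le (fun _ => norm_nonneg _) (fun y => ?_) (hatoms.mul_left |C|)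
    by_cases hy : y ∈ Ioo 0 d
    · rw [hp, indicator_of_mem hy, hnu y hy, norm_mul, Complex.norm_real,
        Real.norm_of_nonneg measureReal_nonneg]
      exact mul_le_mul_of_nonneg_right ((hC y hy).trans (le_abs_self C)) measureReal_nonneg
    · rw [hp, indicator_of_notMem hy, norm_zero]
      positivity
  have hPb : ∀ x, ‖P x‖ ≤ Real.exp (∑' z, ‖p z‖) := fun x => by
    rw [hP]; exact norm_tprod_one_add_le hsum x
  set T : Set ℝ := {t | ν.real {t} ≠ 0} ∩ Ioo 0 d with hT
  have hTc : T.Countable := by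
    refine hatoms.countable_support.mono fun t ht => ?_
    rw [Function.mem_support, hnu t ht.2]
    exact ht.1
  have hgT : IntegrableOn (fun t => h t * P t) T ν := by
    refine IntegrableOn.of_bound ((measure_mono inter_subset_right).trans_lt hν)
      (aemeasurable_restrict_of_countable hTc _).aestronglyMeasurable
      (C * Real.exp (∑' z, ‖p z‖)) ((ae_restrict_iff' hTc.measurableSet).2
        (ae_of_all _ fun t ht => ?_))
    rw [norm_mul]
    exact mul_le_mul (hC t ht.2) (hPb t) (norm_nonneg _) ((norm_nonneg _).trans (hC t ht.2))
  have hind : EqOn (fun t => {t | ν.real {t} ≠ 0}.indicator h t * P t)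
      (T.indicator fun t => h t * P t) (Ioo 0 d) := by
    intro t ht
    by_cases h0 : ν.real {t} = 0
    · have h1 : t ∉ {t | ν.real {t} ≠ 0} := fun h => h h0
      have h2 : t ∉ T := fun h => h1 h.1
      simp only [indicator_of_notMem h1, indicator_of_notMem h2, zero_mul]
    · have h1 : t ∈ {t | ν.real {t} ≠ 0} := h0
      have h2 : t ∈ T := ⟨h1, ht⟩
      simp only [indicator_of_mem h1, indicator_of_mem h2]
  refine ⟨⟨_, hPb⟩, ?_, fun x hx => ?_⟩
  · refine IntegrableOn.congr_fun ?_ hind.symm measurableSet_Ioo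
    exact (hgT.integrable_indicator hTc.measurableSet).integrableOn
  · have hsub : Ioo 0 x ⊆ Ioo 0 d := Ioo_subset_Ioo_right hx.2
    rw [setIntegral_congr_fun measurableSet_Ioo (hind.mono hsub),
      setIntegral_indicator hTc.measurableSet,
      setIntegral_countable _ (hTc.mono inter_subset_right) (hgT.mono_set inter_subset_right),
      tsum_subtype (Ioo 0 x ∩ T) fun t => ν.real {t} • (h t * P t), hP,
      tprod_one_add_eq_one_add_tsum hsum]
    congr 1
    refine tsum_congr fun y => ?_
    rw [← hP]
    by_cases hy : y ∈ Ioo 0 x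
    · rw [indicator_of_mem (show y ∈ Iio x from hy.2), hp, indicator_of_mem (hsub hy)]
      by_cases h0 : ν.real {y} = 0
      · rw [h0, indicator_of_notMem (fun h => h.2.1 h0)]
        simp
      · rw [indicator_of_mem (show y ∈ Ioo 0 x ∩ T from ⟨hy, h0, hsub hy⟩), Complex.real_smul]
        ring
    · have hyT : y ∉ Ioo 0 x ∩ T := fun h => hy h.1
      rw [indicator_of_notMem hyT]
      by_cases hyx : y ∈ Iio x
      · have : y ∉ Ioo 0 d := fun h => hy ⟨h.1, hyx⟩
        rw [indicator_of_mem hyx, hp, indicator_of_notMem this, zero_mul]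
      · rw [indicator_of_notMem hyx, zero_mul]

/-- The solution of `dF = h F dν`, `F(0+) = 1`, is the product of the exponential of the
continuous part and of the product over the atoms. -/
theorem eq_tprod_mul_exp {ν : Measure ℝ} [SFinite ν] {d : ℝ} (hd : 0 < d) (hν : ν (Ioo 0 d) < ⊤)
    {h : ℝ → ℂ} (hm : Measurable h) {C : ℝ} (hC : ∀ t ∈ Ioo 0 d, ‖h t‖ ≤ C) {F : ℝ → ℂ} {M : ℝ}
    (hFb : ∀ x ∈ Ioc 0 d, ‖F x‖ ≤ M)
    (hFi : IntegrableOn (fun t => h t * F t) (Ioo 0 d) ν)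
    (hF : ∀ x ∈ Ioc 0 d, F x = 1 + ∫ t in Ioo 0 x, h t * F t ∂ν) :
    F d = (∏' y, (1 + (Ioo 0 d).indicator (fun t => h t * ν.real {t}) y))
      * Complex.exp (∫ t in Ioo 0 d, {t | ν.real {t} = 0}.indicator h t ∂ν) := by
  have hTm : MeasurableSet {t | ν.real {t} = 0} :=
    measurable_measureReal_singleton ν (measurableSet_singleton 0)
  set hc := {t | ν.real {t} = 0}.indicator h with hhc
  set ha := {t | ν.real {t} ≠ 0}.indicator h with hha
  have hi : IntegrableOn h (Ioo 0 d) ν := IntegrableOn.of_bound hν hm.aestronglyMeasurable C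
    ((ae_restrict_iff' measurableSet_Ioo).2 (ae_of_all _ hC))
  have hci : IntegrableOn hc (Ioo 0 d) ν := hi.indicator hTm
  have hc0 : ∀ x, ν.real {x} = 0 ∨ hc x = 0 := by
    intro x
    by_cases h0 : ν.real {x} = 0
    · exact Or.inl h0
    · exact Or.inr (indicator_of_notMem (show x ∉ {t | ν.real {t} = 0} from h0) _)
  have hsplit : ∀ x, h x = hc x + ha x := by
    intro x
    by_cases h0 : ν.real {x} = 0
    · have h1 : x ∈ {t | ν.real {t} = 0} := h0
      have h2 : x ∉ {t | ν.real {t} ≠ 0} := fun h => h h0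
      rw [hhc, hha, indicator_of_mem h1, indicator_of_notMem h2, add_zero]
    · have h1 : x ∉ {t | ν.real {t} = 0} := h0
      have h2 : x ∈ {t | ν.real {t} ≠ 0} := h0
      rw [hhc, hha, indicator_of_notMem h1, indicator_of_mem h2, zero_add]
  set E : ℝ → ℂ := fun x => Complex.exp (∫ t in Ioo 0 x, hc t ∂ν) with hE
  set P : ℝ → ℂ := fun x => ∏' y, (1 + (Iio x).indicator ((Ioo 0 d).indicator
      fun t => h t * ν.real {t}) y) with hP
  obtain ⟨⟨R, hR⟩, hPi, hPe⟩ := tprod_atoms_eq hν hC (P := P) (fun _ => rfl)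
  have hEe := fun x (hx : x ∈ Ioc 0 d) => (exp_setIntegral_eq hν hci hc0 hx)
  have hEb : ∀ x ∈ Ioc 0 d, ‖E x‖ ≤ Real.exp (∫ t in Ioo 0 d, ‖hc t‖ ∂ν) := by
    intro x hx
    rw [hE, Complex.norm_exp]
    refine Real.exp_le_exp.2 ((Complex.re_le_norm _).trans
      ((norm_integral_le_integral_norm _).trans (setIntegral_mono_set hci.norm
        (ae_of_all _ fun _ => norm_nonneg _) (Ioo_subset_Ioo_right hx.2).eventuallyLE)))
  have hPE : ∀ x ∈ Ioc 0 d, IntegrableOn (fun t => h t * (P t * E t)) (Ioo 0 x) ν ∧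
      P x * E x = 1 + ∫ t in Ioo 0 x, h t * (P t * E t) ∂ν := by
    intro x hx
    have hsub : Ioo 0 x ⊆ Ioo 0 d := Ioo_subset_Ioo_right hx.2
    have hmem : ∀ t ∈ Ioo 0 x, t ∈ Ioc 0 d := fun t ht => ⟨ht.1, (hsub ht).2.le⟩
    obtain ⟨p1, p2⟩ := mul_eq_mul_add_integral ((measure_mono hsub).trans_lt hν)
      (hPi.mono_set hsub) (hEe x hx).1 (α := 1) (β := 1)
      (u := fun t => P t + 1 / 2 * (ν.real {t} * (ha t * P t))) (v := E)
      (fun t ht => by rw [← hPe t (hmem t ht)])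
      (fun t ht => by
        rw [half_mul_eq ((hc0 t).imp id fun h => by rw [h, zero_mul]), add_zero]
        exact (hEe t (hmem t ht)).2)
    have he : ∀ t, ha t * P t * E t + (P t + 1 / 2 * (ν.real {t} * (ha t * P t))) * (hc t * E t)
        = h t * (P t * E t) := by
      intro t
      rw [hsplit t]
      rcases hc0 t with h0 | h0
      · rw [h0]; push_cast; ring
      · rw [h0]; ring
    have he' : (fun t => ha t * P t * E t + (P t + 1 / 2 * (ν.real {t} * (ha t * P t)))
        * (hc t * Complex.exp (∫ s in Ioo 0 t, hc s ∂ν))) = fun t => h t * (P t * E t) := funext he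
    rw [he'] at p1 p2
    refine ⟨p1, ?_⟩
    rw [← hPe x hx, ← (hEe x hx).2, one_mul] at p2
    exact p2
  have hres := eq_zero_of_enorm_le_lintegral ν hν (C := ENNReal.ofReal C)
    (M := ENNReal.ofReal (M + R * Real.exp (∫ t in Ioo 0 d, ‖hc t‖ ∂ν)))
    ENNReal.ofReal_lt_top ENNReal.ofReal_lt_top (z := fun x => F x - P x * E x)
    (fun x hx => by
      rw [← ofReal_norm]
      refine ENNReal.ofReal_le_ofReal ((norm_sub_le _ _).trans (add_le_add (hFb x hx) ?_))
      rw [norm_mul]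
      exact mul_le_mul (hR x) (hEb x hx) (norm_nonneg _) ((norm_nonneg _).trans (hR x)))
    (fun x hx => by
      have hsub : Ioo 0 x ⊆ Ioo 0 d := Ioo_subset_Ioo_right hx.2
      have : F x - P x * E x = ∫ t in Ioo 0 x, h t * (F t - P t * E t) ∂ν := by
        simp_rw [mul_sub]
        rw [integral_sub (hFi.mono_set hsub) (hPE x hx).1, hF x hx, (hPE x hx).2]
        ring
      rw [this, ← lintegral_const_mul' _ _ ENNReal.ofReal_ne_top]
      refine (enorm_integral_le_lintegral_enorm _).trans
        (setLIntegral_mono' measurableSet_Ioo fun t ht => ?_)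
      rw [enorm_mul]
      gcongr
      rw [← ofReal_norm]
      exact ENNReal.ofReal_le_ofReal (hC t (hsub ht)))
    d ⟨hd, le_rfl⟩
  rw [sub_eq_zero.1 hres]
  congr 1
  refine tprod_congr fun y => ?_
  congr 1
  by_cases hy : y ∈ Ioo 0 d
  · rw [indicator_of_mem (show y ∈ Iio d from hy.2)]
  · rw [indicator_of_notMem hy]
    exact indicator_apply_eq_zero.2 fun _ => indicator_of_notMem hy _

/-! ### The determinant of the fundamental matrix -/

namespace DensityData

variable {b : EReal} {D : DensityData b} {l : ℂ} {U Y : ℝ → Matrix (Fin 2) (Fin 2) ℂ}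

/-- The function `h = tr(J (Q - l W)) / det B_+`, for which the left-continuous fundamental matrix
`Y` satisfies `d (det Y) = h (det Y) dν`. -/
noncomputable def traceDensity (D : DensityData b) (l : ℂ) (x : ℝ) : ℂ :=
  (D.A l x 0 1 - D.A l x 1 0) / (D.Bplus l x).det

theorem measurable_traceDensity (l : ℂ) : Measurable (D.traceDensity l) := by
  have hdet : Measurable fun x => (D.Bplus l x).det := by
    simp only [Matrix.det_fin_two]
    exact ((measurable_Bplus l 0 0).mul (measurable_Bplus l 1 1)).sub
      ((measurable_Bplus l 0 1).mul (measurable_Bplus l 1 0))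
  exact ((D.measurable_A l 0 1).sub (D.measurable_A l 1 0)).div hdet

theorem IsRegular.exists_norm_traceDensity_le (h : D.IsRegular l) {d : ℝ} (hd : d ∈ interval b) :
    ∃ C, ∀ t ∈ Ioc 0 d, ‖D.traceDensity l t‖ ≤ C := by
  obtain ⟨ε, hε, hle⟩ := h.exists_le_norm_det hd
  refine ⟨(1 + ‖l‖ + (1 + ‖l‖)) / ε, fun t ht => ?_⟩
  rw [traceDensity, norm_div]
  exact div_le_div₀ (by positivity) ((norm_sub_le _ _).trans
    (add_le_add (D.norm_A_le l t 0 1) (D.norm_A_le l t 1 0))) hε (hle t ht)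

/-- The jumps of `det Y` are the factors of the product defining `τ`. -/
theorem one_add_traceDensity (h : D.IsRegular l) {x : ℝ} (hx : x ∈ interval b) :
    1 + D.traceDensity l x * D.ν.real {x} = (D.Bminus l x).det / (D.Bplus l x).det := by
  have h0 := (h x hx).1
  rw [traceDensity, eq_div_iff h0, add_mul, one_mul, mul_assoc, mul_comm (D.ν.real {x} : ℂ),
    ← mul_assoc, div_mul_cancel₀ _ h0, det_Bplus, det_Bminus]
  push_cast
  ring

theorem IsFundamental.det_mul_det (hU : D.IsFundamental l U Y) {x : ℝ} (hx : x ∈ interval b) :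
    (D.Bplus l x).det * (U x).det = (Y x).det := by
  have hmat : D.Bplus l x * U x = Coefficients.J * Y x := by
    apply Matrix.toLin'.injective
    refine LinearMap.ext fun k => ?_
    rw [Matrix.toLin'_apply, Matrix.toLin'_apply, ← Matrix.mulVec_mulVec, ← Matrix.mulVec_mulVec]
    have := (Bplus_mulVec_eq_iff l x _ _ _).2
      ((hU.isInitSolution k).isBVSolution.eq_leftLim_add integrableOn_zero hx)
    rw [hU.leftLim_eq k x hx] at this
    simpa using this
  rw [← Matrix.det_mul, hmat, Matrix.det_mul]
  simp [Coefficients.J, Matrix.det_fin_two]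

theorem IsFundamental.det_eq (h : D.IsRegular l) (hU : D.IsFundamental l U Y) {x : ℝ}
    (hx : x ∈ interval b) :
    IntegrableOn (fun t => D.traceDensity l t * (Y t).det) (Ioo 0 x) D.ν ∧
    (Y x).det = 1 + ∫ t in Ioo 0 x, D.traceDensity l t * (Y t).det ∂D.ν := by
  set u : ℝ → Fin 2 → ℂ := fun x => (U x).mulVec ![1, 0] with hu
  set v : ℝ → Fin 2 → ℂ := fun x => (U x).mulVec ![0, 1] with hv
  have hui : D.IsInitSolution l 0 ![1, 0] u := hU.isInitSolution _
  have hvi : D.IsInitSolution l 0 ![0, 1] v := hU.isInitSolution _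
  have hup := hui.isPrimitiveOn hx
  have hvp := hvi.isPrimitiveOn hx
  have hν : D.ν (Ioo 0 x) < ⊤ := ν_Ioo_lt_top le_rfl hx
  obtain ⟨i1, e1⟩ := mul_eq_mul_add_integral hν (hup.1.eval 0) (hvp.1.eval 1)
    (fun t ht => hup.apply 0 ht) (fun t ht => hvp.apply 1 ht)
  obtain ⟨i2, e2⟩ := mul_eq_mul_add_integral hν (hvp.1.eval 0) (hup.1.eval 1)
    (fun t ht => hvp.apply 0 ht) (fun t ht => hup.apply 1 ht)
  have hYu : ∀ i, Y x i 0 = ![(1 : ℂ), 0] i + ∫ t in Ioo 0 x, D.rhs l 0 u t i ∂D.ν := by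
    intro i
    rw [← integral_pi_apply hup.1, ← Pi.add_apply, ← hui.leftLim_eq hx, hU.leftLim_eq _ x hx]
    simp [Matrix.mulVec, dotProduct, Fin.sum_univ_two]
  have hYv : ∀ i, Y x i 1 = ![(0 : ℂ), 1] i + ∫ t in Ioo 0 x, D.rhs l 0 v t i ∂D.ν := by
    intro i
    rw [← integral_pi_apply hvp.1, ← Pi.add_apply, ← hvi.leftLim_eq hx, hU.leftLim_eq _ x hx]
    simp [Matrix.mulVec, dotProduct, Fin.sum_univ_two]
  have hpt : EqOn (fun t => (D.rhs l 0 u t 0 * v t 1 + u t 0 * D.rhs l 0 v t 1)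
      - (D.rhs l 0 v t 0 * u t 1 + v t 0 * D.rhs l 0 u t 1))
      (fun t => D.traceDensity l t * (Y t).det) (Ioo 0 x) := by
    intro t ht
    have htI := interval_mem_of_le hx ht.1 ht.2.le
    have hd := hU.det_mul_det htI
    have h0 := (h t htI).1
    have hu0 : ∀ i, u t i = U t i 0 := fun i => by
      fin_cases i <;> simp [hu]
    have hv0 : ∀ i, v t i = U t i 1 := fun i => by
      fin_cases i <;> simp [hv]
    change _ = D.traceDensity l t * (Y t).det
    rw [traceDensity, ← hd, ← mul_assoc, div_mul_cancel₀ _ h0, Matrix.det_fin_two]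
    simp only [rhs, J_mulVec, Pi.zero_apply, sub_zero, Matrix.cons_val_zero, Matrix.cons_val_one]
    simp only [Matrix.mulVec, dotProduct, Fin.sum_univ_two, hu0, hv0]
    ring
  refine ⟨(i1.sub i2).congr_fun hpt measurableSet_Ioo, ?_⟩
  rw [← setIntegral_congr_fun measurableSet_Ioo hpt, integral_sub i1 i2, Matrix.det_fin_two,
    hYu, hYu, hYv, hYv, mul_comm (![(0 : ℂ), 1] 0 + _), mul_comm]
  rw [mul_comm] at e1
  rw [mul_comm] at e2
  rw [e1, mul_comm (![(1 : ℂ), 0] 1 + _), mul_comm (![(0 : ℂ), 1] 0 + _), e2]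
  simp
  ring

/-- The determinant of the fundamental matrix as a product over atoms times an exponential. -/
theorem IsFundamental.det_eq_tprod (h : D.IsRegular l) (hU : D.IsFundamental l U Y) {x : ℝ}
    (hx : x ∈ interval b) :
    (Y x).det = (∏' y, (1 + (Ioo 0 x).indicator (fun t => D.traceDensity l t * D.ν.real {t}) y))
      * Complex.exp (∫ t in Ioo 0 x, {t | D.ν.real {t} = 0}.indicator (D.traceDensity l) t
        ∂D.ν) := by
  obtain ⟨C, hC⟩ := h.exists_norm_traceDensity_le hx
  have hd : ∀ t ∈ Ioc 0 x, _ := fun t ht => hU.det_eq h (interval_mem_of_le hx ht.1 ht.2)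
  have hi := (hU.det_eq h hx).1
  refine eq_tprod_mul_exp hx.1 (ν_Ioo_lt_top le_rfl hx) (measurable_traceDensity l)
    (fun t ht => hC t ⟨ht.1, ht.2.le⟩)
    (M := 1 + ∫ t in Ioo 0 x, ‖D.traceDensity l t * (Y t).det‖ ∂D.ν) (F := fun t => (Y t).det)
    (fun t ht => ?_) hi (fun t ht => (hd t ht).2)
  rw [(hd t ht).2]
  refine (norm_add_le _ _).trans (add_le_add norm_one.le ?_)
  exact (norm_integral_le_integral_norm _).trans (setIntegral_mono_set hi.norm
    (ae_of_all _ fun _ => norm_nonneg _) (Ioo_subset_Ioo_right ht.2).eventuallyLE)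

end DensityData

theorem LocalMeasure.contPart_eq {b : EReal} (m : LocalMeasure b) {ν : Measure ℝ} [SFinite ν]
    {f : ℝ → ℂ} (hf : Measurable f) {x : ℝ} (hx : x ∈ interval b)
    (hm : ∀ d ∈ interval b, ∀ s, MeasurableSet s → m.on d s = ∫ t in s ∩ Ioc 0 d, f t ∂ν) :
    m.contPart x = ∫ t in Ioo 0 x, {t | ν.real {t} = 0}.indicator f t ∂ν := by
  have hatom : ∀ t ∈ interval b, m.atom t = ν.real {t} * f t := by
    intro t ht
    rw [LocalMeasure.atom, hm t ht _ (measurableSet_singleton t), inter_eq_left.2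
      (show ({t} : Set ℝ) ⊆ Ioc 0 t from singleton_subset_iff.2 ⟨ht.1, le_rfl⟩),
      integral_singleton, Complex.real_smul]
  have hset : {y | y ∈ Ioo 0 x ∧ m.atom y = 0} = Ioo 0 x ∩ {t | (ν.real {t} : ℂ) * f t = 0} := by
    ext y
    refine and_congr_right fun hy => ?_
    rw [hatom y (interval_mem_of_le hx hy.1 hy.2.le)]
    rfl
  have hνm := measurable_measureReal_singleton ν
  have hm1 : MeasurableSet {t | (ν.real {t} : ℂ) * f t = 0} :=
    ((Complex.measurable_ofReal.comp hνm).mul hf) (measurableSet_singleton 0)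
  have hm2 : MeasurableSet {t | ν.real {t} = 0} := hνm (measurableSet_singleton 0)
  rw [LocalMeasure.contPart, hset, hm x hx _ (measurableSet_Ioo.inter hm1), inter_eq_left.2
    (inter_subset_left.trans Ioo_subset_Ioc_self), ← setIntegral_indicator hm1]
  congr 1
  funext t
  by_cases h0 : ν.real {t} = 0
  · have h1 : t ∈ {t | ν.real {t} = 0} := h0
    have h2 : t ∈ {t | (ν.real {t} : ℂ) * f t = 0} := by
      change (ν.real {t} : ℂ) * f t = 0
      rw [h0]; simp
    rw [indicator_of_mem h1, indicator_of_mem h2]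
  · have h1 : t ∉ {t | ν.real {t} = 0} := h0
    rw [indicator_of_notMem h1]
    refine indicator_apply_eq_zero.2 fun h2 => ?_
    have h3 : (ν.real {t} : ℂ) * f t = 0 := h2
    exact (mul_eq_zero.1 h3).resolve_left (by exact_mod_cast h0)

/-- The function `τ` is the determinant of the left-continuous fundamental matrix. -/
theorem Coefficients.HasDensity.tau_eq_det {b : EReal} {S : Coefficients b} {D : DensityData b}
    (hSD : S.HasDensity D) {l : ℂ} (h : D.IsRegular l) {U Y : ℝ → Matrix (Fin 2) (Fin 2) ℂ}
    (hU : D.IsFundamental l U Y) {x : ℝ} (hx : x ∈ interval b) : S.tau x l = (Y x).det := by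
  have hνx : D.ν (Ioo 0 x) < ⊤ := DensityData.ν_Ioo_lt_top le_rfl hx
  have hm2 : MeasurableSet {t | D.ν.real {t} = 0} :=
    measurable_measureReal_singleton D.ν (measurableSet_singleton 0)
  rw [hU.det_eq_tprod h hx, Coefficients.tau]
  congr 1
  · rw [tprod_subtype (Ioo 0 x) fun y => (S.Bminus y l).det / (S.Bplus y l).det]
    refine tprod_congr fun y => ?_
    by_cases hy : y ∈ Ioo 0 x
    · have hyI := interval_mem_of_le hx hy.1 hy.2.le
      rw [mulIndicator_of_mem hy, indicator_of_mem hy, DensityData.one_add_traceDensity h hyI,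
        hSD.Bplus_eq hyI, hSD.Bminus_eq hyI]
      rfl
    · rw [mulIndicator_of_notMem hy, indicator_of_notMem hy, add_zero]
  · congr 1
    rw [LocalMeasure.contPart_eq (S.q 0 1) (D.measurable_Q 0 1) hx
        (fun d hd s hs => hSD.q_eq d hd s hs 0 1),
      LocalMeasure.contPart_eq (S.w 0 1) (D.measurable_W 0 1) hx
        (fun d hd s hs => hSD.w_eq d hd s hs 0 1)]
    set T := {t | D.ν.real {t} = 0}
    set q : ℝ → ℂ := T.indicator fun t => D.Q t 0 1
    set w : ℝ → ℂ := T.indicator fun t => D.W t 0 1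
    have iQ : IntegrableOn q (Ioo 0 x) D.ν :=
      (IntegrableOn.of_bound hνx (D.measurable_Q 0 1).aestronglyMeasurable 1
        (ae_of_all _ fun t => D.norm_Q_le t 0 1)).indicator hm2
    have iW : IntegrableOn w (Ioo 0 x) D.ν :=
      (IntegrableOn.of_bound hνx (D.measurable_W 0 1).aestronglyMeasurable 1
        (ae_of_all _ fun t => D.norm_W_le t 0 1)).indicator hm2
    have iQ' : IntegrableOn (fun t => starRingEnd ℂ (q t)) (Ioo 0 x) D.ν :=
      (LinearIsometryEquiv.integrable_comp_iff Complex.conjLIE).2 iQ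
    have iW' : IntegrableOn (fun t => starRingEnd ℂ (w t)) (Ioo 0 x) D.ν :=
      (LinearIsometryEquiv.integrable_comp_iff Complex.conjLIE).2 iW
    have i1 : IntegrableOn (fun t => q t - starRingEnd ℂ (q t)) (Ioo 0 x) D.ν := iQ.sub iQ'
    have i2 : IntegrableOn (fun t => l * (w t - starRingEnd ℂ (w t))) (Ioo 0 x) D.ν :=
      (iW.sub iW').const_mul l
    have hpt : ∀ t, T.indicator (D.traceDensity l) t
        = (q t - starRingEnd ℂ (q t)) - l * (w t - starRingEnd ℂ (w t)) := by
      intro t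
      by_cases h0 : D.ν.real {t} = 0
      · have h1 : t ∈ T := h0
        simp only [q, w, indicator_of_mem h1]
        have hq : starRingEnd ℂ (D.Q t 0 1) = D.Q t 1 0 := (D.Q_hermitian t).apply 1 0
        have hw : starRingEnd ℂ (D.W t 0 1) = D.W t 1 0 := (D.W_isHermitian t).apply 1 0
        rw [hq, hw, DensityData.traceDensity, DensityData.det_Bplus, h0]
        simp [DensityData.A]
        ring
      · have h1 : t ∉ T := h0
        simp only [q, w, indicator_of_notMem h1]
        simp
    simp_rw [hpt]
    rw [integral_sub i1 i2, integral_const_mul, integral_sub iQ iQ', integral_sub iW iW']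
    have c1 := integral_conj (μ := D.ν.restrict (Ioo 0 x)) (f := q)
    have c2 := integral_conj (μ := D.ν.restrict (Ioo 0 x)) (f := w)
    rw [c1, c2, Complex.sub_conj, Complex.sub_conj]
    push_cast
    ring

/-! ### Nested Weyl sets and the dichotomy -/

theorem eventually_toEnd {b : EReal} {c : ℝ} (hc : c ∈ interval b) :
    ∀ᶠ x in toEnd b, c < x ∧ x ∈ interval b := by
  have h : Ioo (c : EReal) b ∈ 𝓝[<] b := Ioo_mem_nhdsLT hc.2
  filter_upwards [preimage_mem_comap h] with x hx
  have hcx : c < x := EReal.coe_lt_coe_iff.1 hx.1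
  exact ⟨hcx, hc.1.trans hcx, hx.2⟩

/-- The indefinite quadratic form with `y* J y = i (hermForm y)`. -/
noncomputable def hermForm (y : Fin 2 → ℂ) : ℝ := 2 * (star (y 1) * y 0).im

theorem sympForm_self (y : Fin 2 → ℂ) : sympForm y y = Complex.I * hermForm y := by
  apply Complex.ext <;> simp [sympForm, hermForm] <;> ring

theorem hermForm_star (y : Fin 2 → ℂ) : hermForm (star y) = -hermForm y := by
  simp [hermForm]; ring

theorem hermForm_smul (c : ℂ) (y : Fin 2 → ℂ) : hermForm (c • y) = ‖c‖ ^ 2 * hermForm y := by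
  rw [← Complex.normSq_eq_norm_sq, Complex.normSq_apply]
  simp [hermForm]; ring

theorem continuous_hermForm : Continuous hermForm := by
  unfold hermForm
  fun_prop

namespace DensityData

variable {b : EReal} {D : DensityData b} {l : ℂ} {f u : ℝ → Fin 2 → ℂ} {y : Fin 2 → ℂ}
  {U Y V Z : ℝ → Matrix (Fin 2) (Fin 2) ℂ}

theorem lintegral_le_of_forall_exists (hb : 0 < b) {g : ℝ → ENNReal} {M : ENNReal}
    (h : ∀ c ∈ interval b, ∃ d ∈ interval b, c ≤ d ∧ ∫⁻ t in Ioo 0 d, g t ∂D.ν ≤ M) :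
    ∫⁻ t, g t ∂D.ν ≤ M := by
  obtain ⟨γ, β, hγβ, hmono, hU⟩ := D.exists_exhaustion hb
  rw [← setLIntegral_univ, ← setLIntegral_congr hU,
      setLIntegral_iUnion_of_directed _ hmono.directed_le]
  refine iSup_le fun n => ?_
  obtain ⟨h0, h1, h2⟩ := hγβ n
  obtain ⟨d, hd, hcd, hle⟩ := h _ h2
  exact (lintegral_mono_set (Ioo_subset_Ioo h0.le hcd)).trans hle

theorem IsInitSolution.exists_bound (h : D.IsInitSolution l f y u) {d : ℝ} (hd : d ∈ interval b) :
    ∃ M, ∀ x ∈ Ioc 0 d, ‖u x‖ ≤ M := by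
  have hi := (h.integrable d hd).norm
  refine ⟨‖y‖ + (∫ t in Ioc 0 d, ‖D.rhs l f u t‖ ∂D.ν) + ∫ t in Ioc 0 d, ‖D.rhs l f u t‖ ∂D.ν,
    fun x hx => ?_⟩
  have hxI := interval_mem_of_le hd hx.1 hx.2
  rw [h.eq_integral x hxI]
  refine (norm_add₃_le).trans (add_le_add (add_le_add le_rfl ?_) ?_)
  · exact (norm_integral_le_integral_norm _).trans (setIntegral_mono_set hi
      (ae_of_all _ fun _ => norm_nonneg _)
      (LE.le.eventuallyLE fun t ht => ⟨ht.1, ht.2.le.trans hx.2⟩))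
  · have h1 : D.ν.real {x} * ‖D.rhs l f u x‖ ≤ ∫ t in Ioc 0 d, ‖D.rhs l f u t‖ ∂D.ν := by
      have := setIntegral_mono_set hi (ae_of_all _ fun _ => norm_nonneg _)
        (LE.le.eventuallyLE (singleton_subset_iff.2 hx))
      rwa [integral_singleton, smul_eq_mul] at this
    have h0 : 0 ≤ D.ν.real {x} * ‖D.rhs l f u x‖ := mul_nonneg measureReal_nonneg (norm_nonneg _)
    rw [norm_smul, norm_smul, Real.norm_of_nonneg (by norm_num : (0 : ℝ) ≤ 1 / 2),
      Real.norm_of_nonneg measureReal_nonneg]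
    linarith

theorem IsInitSolution.aemeasurable (hb : 0 < b) (h : D.IsInitSolution l f y u) :
    AEMeasurable u D.ν :=
  D.aemeasurable_of_locallyBV hb h.isBVSolution.locallyBV

theorem integrableOn_sq_weighted (hu : AEMeasurable u D.ν) {d : ℝ} (hd : d ∈ interval b)
    (hbd : ∃ M, ∀ x ∈ Ioc 0 d, ‖u x‖ ≤ M) :
    IntegrableOn (fun t => ‖D.weighted u t‖ ^ 2) (Ioc 0 d) D.ν := by
  obtain ⟨M, hM⟩ := hbd
  refine IntegrableOn.of_bound (D.finite d hd)
    ((D.aemeasurable_weighted hu).norm.pow_const 2).aestronglyMeasurable.restrict ((4 * M) ^ 2)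
    ((ae_restrict_iff' measurableSet_Ioc).2 (ae_of_all _ fun t ht => ?_))
  rw [Real.norm_of_nonneg (by positivity)]
  have := (D.norm_weighted_le u t).trans (mul_le_mul_of_nonneg_left (hM t ht) (by norm_num))
  exact pow_le_pow_left₀ (norm_nonneg _) this 2

theorem IsInitSolution.integrableOn_sq_weighted (hb : 0 < b) (h : D.IsInitSolution l f y u) {d : ℝ}
    (hd : d ∈ interval b) : IntegrableOn (fun t => ‖D.weighted u t‖ ^ 2) (Ioo 0 d) D.ν :=
  (DensityData.integrableOn_sq_weighted (h.aemeasurable hb) hd (h.exists_bound hd)).mono_set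
    Ioo_subset_Ioc_self

theorem lintegral_sq_eq_ofReal {g : ℝ → EuclideanSpace ℂ (Fin 2)} {s : Set ℝ}
    (h : IntegrableOn (fun t => ‖g t‖ ^ 2) s D.ν) :
    ∫⁻ t in s, ‖g t‖ₑ ^ 2 ∂D.ν = ENNReal.ofReal (∫ t in s, ‖g t‖ ^ 2 ∂D.ν) := by
  rw [ofReal_integral_eq_lintegral_ofReal h (ae_of_all _ fun t => by positivity)]
  refine lintegral_congr fun t => ?_
  rw [ENNReal.ofReal_pow (norm_nonneg _), ofReal_norm]

/-- `∫ ‖S u‖² dν`, the squared norm of `u` in `L²(w)`. -/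
noncomputable def sqNorm (D : DensityData b) (u : ℝ → Fin 2 → ℂ) : ENNReal :=
  ∫⁻ t, ‖D.weighted u t‖ₑ ^ 2 ∂D.ν

theorem IsInitSolution.hermForm_eq (h : D.IsInitSolution l 0 y u) {x : ℝ} (hx : x ∈ interval b) :
    hermForm (Function.leftLim u x)
      = hermForm y + 2 * l.im * ∫ t in Ioo 0 x, ‖D.weighted u t‖ ^ 2 ∂D.ν := by
  have e := (h.lagrange h hx).2
  rw [sympForm_self, sympForm_self] at e
  have e2 : ∫ t in Ioo 0 x, (star (u t) ⬝ᵥ (0 : ℝ → Fin 2 → ℂ) t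
      - star ((0 : ℝ → Fin 2 → ℂ) t) ⬝ᵥ u t
      + (l - star l) * (star ((D.S t).mulVec (u t)) ⬝ᵥ (D.S t).mulVec (u t))) ∂D.ν
      = Complex.I * ((2 * l.im * ∫ t in Ioo 0 x, ‖D.weighted u t‖ ^ 2 ∂D.ν : ℝ) : ℂ) := by
    simp only [Pi.zero_apply, dotProduct_zero, star_zero, zero_dotProduct, sub_zero, zero_add,
      star_dotProduct_self]
    rw [integral_const_mul, integral_complex_ofReal, ← starRingEnd_apply, Complex.sub_conj]
    simp only [weighted]
    push_cast
    ring
  rw [e2, ← mul_add] at e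
  exact_mod_cast mul_left_cancel₀ Complex.I_ne_zero e

theorem IsFundamental.hermForm_eq (hU : D.IsFundamental l U Y) {x : ℝ} (hx : x ∈ interval b)
    (k : Fin 2 → ℂ) : hermForm ((Y x).mulVec k) = hermForm k
      + 2 * l.im * ∫ t in Ioo 0 x, ‖D.weighted (fun t => (U t).mulVec k) t‖ ^ 2 ∂D.ν := by
  rw [← hU.leftLim_eq k x hx]
  exact (hU.isInitSolution k).hermForm_eq hx

/-- Conjugation maps solutions at `l` to multiples of solutions at `star l`. -/
theorem IsFundamental.mulVec_star (hU : D.IsFundamental l U Y) (hV : D.IsFundamental (star l) V Z)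
    {x : ℝ} (hx : x ∈ interval b) (k : Fin 2 → ℂ) :
    (Z x).mulVec (star k) = (star (Y x).det)⁻¹ • star ((Y x).mulVec k) := by
  have hd := (hU.det_ne_zero hV hx).1
  have hd' : star (Y x).det ≠ 0 := star_ne_zero.2 hd
  have h : ∀ i j, Z x i j = (star (Y x).det)⁻¹ * star (Y x i j) := by
    intro i j
    rw [← hU.star_mul_det hV hx i j, star_mul', star_star, mul_comm (Z x i j), ← mul_assoc,
      inv_mul_cancel₀ hd', one_mul]
  ext i
  simp only [Matrix.mulVec, dotProduct, Fin.sum_univ_two, h, Pi.smul_apply, Pi.star_apply,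
    star_add, star_mul', smul_eq_mul]
  ring

theorem IsFundamental.hermForm_star_eq (hU : D.IsFundamental l U Y)
    (hV : D.IsFundamental (star l) V Z) {x : ℝ} (hx : x ∈ interval b) (k : Fin 2 → ℂ) :
    hermForm ((Z x).mulVec (star k)) = -hermForm ((Y x).mulVec k) / ‖(Y x).det‖ ^ 2 := by
  rw [hU.mulVec_star hV hx, hermForm_smul, hermForm_star, norm_inv, norm_star]
  ring

theorem monotone_integral_sq (hb : 0 < b) (hu : D.IsInitSolution l f y u) {c d : ℝ} (hcd : c ≤ d)
    (hd : d ∈ interval b) : ∫ t in Ioo 0 c, ‖D.weighted u t‖ ^ 2 ∂D.ν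
      ≤ ∫ t in Ioo 0 d, ‖D.weighted u t‖ ^ 2 ∂D.ν :=
  setIntegral_mono_set (hu.integrableOn_sq_weighted hb hd)
    (ae_of_all _ fun _ => by positivity) (Ioo_subset_Ioo_right hcd).eventuallyLE

/-- Weyl's argument: by compactness there is an initial value for which the form
`(Im l) (u* J u) / i` remains nonpositive on all of `(0, b)`. -/
theorem IsFundamental.exists_hermForm_nonpos (hb : 0 < b) (hU : D.IsFundamental l U Y)
    (hV : D.IsFundamental (star l) V Z) :
    ∃ ψ : Fin 2 → ℂ, ψ ≠ 0 ∧ ∀ x ∈ interval b, l.im * hermForm ((Y x).mulVec ψ) ≤ 0 := by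
  obtain ⟨β, hβ, hβI, hβx⟩ := exists_strictMono_cutoffs hb
  have hmono : ∀ k : Fin 2 → ℂ, ∀ c ∈ interval b, ∀ d ∈ interval b, c ≤ d →
      l.im * hermForm ((Y c).mulVec k) ≤ l.im * hermForm ((Y d).mulVec k) := by
    intro k c hc d hd hcd
    rw [hU.hermForm_eq hc, hU.hermForm_eq hd]
    have := monotone_integral_sq hb (hU.isInitSolution k) hcd hd
    nlinarith [mul_nonneg (sq_nonneg l.im) (sub_nonneg.2 this)]
  -- The unit vectors for which the form is nonpositive at `β n`; these compact sets decrease.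
  set K : ℕ → Set (Fin 2 → ℂ) := fun n =>
    {k | ‖k‖ = 1 ∧ l.im * hermForm ((Y (β n)).mulVec k) ≤ 0} with hK
  have hKc : ∀ n, IsClosed (K n) := fun n => by
    have h1 : Continuous fun k : Fin 2 → ℂ => (Y (β n)).mulVec k :=
      Continuous.matrix_mulVec continuous_const continuous_id
    exact (isClosed_eq continuous_norm continuous_const).inter
      (isClosed_le (continuous_const.mul (continuous_hermForm.comp h1)) continuous_const)
  have hKn : ∀ n, (K n).Nonempty := by
    intro n
    -- `![1, 0]` is a null vector of the form.
    set k := ((Y (β n))⁻¹).mulVec ![1, 0] with hk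
    have hYk : (Y (β n)).mulVec k = ![1, 0] := by
      rw [hk, Matrix.mulVec_mulVec, Matrix.mul_nonsing_inv _
        (isUnit_iff_ne_zero.2 (hU.det_ne_zero hV (hβI n)).1), Matrix.one_mulVec]
    have hk0 : k ≠ 0 := by
      intro h0
      rw [h0, Matrix.mulVec_zero] at hYk
      have := congrFun hYk 0
      simp at this
    refine ⟨((‖k‖⁻¹ : ℝ) : ℂ) • k, ?_, ?_⟩
    · rw [norm_smul, Complex.norm_real, norm_inv, norm_norm,
        inv_mul_cancel₀ (norm_ne_zero_iff.2 hk0)]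
    · rw [Matrix.mulVec_smul, hYk, hermForm_smul]
      simp [hermForm]
  have hsucc : ∀ n, K (n + 1) ⊆ K n := fun n k hk =>
    ⟨hk.1, (hmono k _ (hβI n) _ (hβI (n + 1)) (hβ.monotone (Nat.le_succ n))).trans hk.2⟩
  have hcomp : IsCompact (K 0) := by
    refine (isCompact_sphere (0 : Fin 2 → ℂ) 1).of_isClosed_subset (hKc 0) fun k hk => ?_
    rw [mem_sphere_zero_iff_norm]
    exact hk.1
  obtain ⟨ψ, hψ⟩ := IsCompact.nonempty_iInter_of_sequence_nonempty_isCompact_isClosed K hsucc hKn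
    hcomp hKc
  rw [mem_iInter] at hψ
  refine ⟨ψ, ?_, fun x hx => ?_⟩
  · intro h0
    have := (hψ 0).1
    rw [h0, norm_zero] at this
    exact zero_ne_one this
  · obtain ⟨n, hn⟩ := hβx x hx
    exact (hmono ψ x hx _ (hβI n) hn.le).trans (hψ n).2

theorem IsFundamental.sqNorm_lt_top_of_bound (hb : 0 < b) (hU : D.IsFundamental l U Y)
    {k : Fin 2 → ℂ} {M : ℝ} (h : ∀ c ∈ interval b, ∃ d ∈ interval b, c ≤ d ∧
      ∫ t in Ioo 0 d, ‖D.weighted (fun t => (U t).mulVec k) t‖ ^ 2 ∂D.ν ≤ M) :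
    D.sqNorm (fun t => (U t).mulVec k) < ⊤ := by
  refine (lintegral_le_of_forall_exists hb (M := ENNReal.ofReal M) fun c hc => ?_).trans_lt
    ENNReal.ofReal_lt_top
  obtain ⟨d, hd, hcd, hle⟩ := h c hc
  refine ⟨d, hd, hcd, ?_⟩
  rw [lintegral_sq_eq_ofReal ((hU.isInitSolution k).integrableOn_sq_weighted hb hd)]
  exact ENNReal.ofReal_le_ofReal hle

theorem IsFundamental.sqNorm_lt_top_of_hermForm_nonpos (hb : 0 < b) (hl : l.im ≠ 0)
    (hU : D.IsFundamental l U Y) {ψ : Fin 2 → ℂ}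
    (h : ∀ x ∈ interval b, l.im * hermForm ((Y x).mulVec ψ) ≤ 0) :
    D.sqNorm (fun t => (U t).mulVec ψ) < ⊤ := by
  refine hU.sqNorm_lt_top_of_bound hb (M := -(l.im * hermForm ψ) / (2 * l.im ^ 2))
    fun c hc => ⟨c, hc, le_rfl, ?_⟩
  have h1 := h c hc
  rw [hU.hermForm_eq hc] at h1
  have hpos : 0 < 2 * l.im ^ 2 := by positivity
  rw [le_div_iff₀ hpos]
  linarith

theorem IsFundamental.hermForm_conj_nonpos (hU : D.IsFundamental l U Y)
    (hV : D.IsFundamental (star l) V Z) {ψ : Fin 2 → ℂ}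
    (h : ∀ x ∈ interval b, l.im * hermForm ((Y x).mulVec ψ) ≤ 0) :
    ∀ x ∈ interval b, (star l).im * hermForm ((Z x).mulVec (star ψ)) ≤ 0 := by
  intro x hx
  rw [hU.hermForm_star_eq hV hx, Complex.star_def, Complex.conj_im]
  have h1 := h x hx
  have : -l.im * (-hermForm ((Y x).mulVec ψ) / ‖(Y x).det‖ ^ 2)
      = (l.im * hermForm ((Y x).mulVec ψ)) / ‖(Y x).det‖ ^ 2 := by ring
  rw [this]
  exact div_nonpos_of_nonpos_of_nonneg h1 (by positivity)

/-- If all solutions at `l` have finite norm and the determinant does not tend to zero, then all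
solutions at `star l` have finite norm. -/
theorem IsFundamental.sqNorm_lt_top_of_not_tendsto (hb : 0 < b) (hl : l.im ≠ 0)
    (hU : D.IsFundamental l U Y) (hV : D.IsFundamental (star l) V Z)
    (hfin : ∀ k, D.sqNorm (fun t => (U t).mulVec k) < ⊤)
    (hlim : ¬ Tendsto (fun c => ‖(Y c).det‖) (toEnd b) (𝓝 0)) (k : Fin 2 → ℂ) :
    D.sqNorm (fun t => (V t).mulVec k) < ⊤ := by
  rw [Metric.tendsto_nhds] at hlim
  push Not at hlim
  obtain ⟨ε, hε, hfr⟩ := hlim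
  -- `|hermForm (Y (star k))| ≤ A` on all of `(0, b)`, and `hermForm (Z k)` arises from it by
  -- division by `-‖det Y‖²`, which is at least `ε²` in modulus at points `d` arbitrarily close
  -- to `b`.
  set N := (D.sqNorm (fun t => (U t).mulVec (star k))).toReal with hN
  have hN0 : 0 ≤ N := ENNReal.toReal_nonneg
  set A := |hermForm (star k)| + 2 * |l.im| * N with hA
  have hA0 : 0 ≤ A := by positivity
  refine hV.sqNorm_lt_top_of_bound hb (M := (|hermForm k| + A / ε ^ 2) / (2 * |l.im|))
    fun c hc => ?_
  obtain ⟨d, hd1, hcd, hd⟩ := (hfr.and_eventually (eventually_toEnd hc)).exists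
  refine ⟨d, hd, hcd.le, ?_⟩
  have hd2 : ε ≤ ‖(Y d).det‖ := by
    simpa [Real.dist_eq] using hd1
  have e1 := hV.hermForm_eq hd k
  have e2 := hU.hermForm_star_eq hV hd (star k)
  have e3 := hU.hermForm_eq hd (star k)
  rw [star_star] at e2
  have hI := (hU.isInitSolution (star k)).integrableOn_sq_weighted hb hd
  have hle : ∫ t in Ioo 0 d, ‖D.weighted (fun t => (U t).mulVec (star k)) t‖ ^ 2 ∂D.ν ≤ N := by
    rw [← ENNReal.ofReal_le_iff_le_toReal (hfin _).ne, ← lintegral_sq_eq_ofReal hI]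
    exact setLIntegral_le_lintegral _ _
  have h0 : 0 ≤ ∫ t in Ioo 0 d, ‖D.weighted (fun t => (U t).mulVec (star k)) t‖ ^ 2 ∂D.ν :=
    integral_nonneg fun _ => by positivity
  have h0' : 0 ≤ ∫ t in Ioo 0 d, ‖D.weighted (fun t => (V t).mulVec k) t‖ ^ 2 ∂D.ν :=
    integral_nonneg fun _ => by positivity
  generalize (∫ t in Ioo 0 d, ‖D.weighted (fun t => (U t).mulVec (star k)) t‖ ^ 2 ∂D.ν) = IU at *
  generalize (∫ t in Ioo 0 d, ‖D.weighted (fun t => (V t).mulVec k) t‖ ^ 2 ∂D.ν) = IV at *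
  have hY : |hermForm ((Y d).mulVec (star k))| ≤ A := by
    rw [e3]
    refine (abs_add_le _ _).trans (add_le_add le_rfl ?_)
    rw [abs_mul, abs_mul, abs_two, abs_of_nonneg h0]
    exact mul_le_mul_of_nonneg_left hle (by positivity)
  have hZ : |hermForm ((Z d).mulVec k)| ≤ A / ε ^ 2 := by
    rw [e2, abs_div, abs_neg, abs_of_nonneg (by positivity : 0 ≤ ‖(Y d).det‖ ^ 2)]
    exact div_le_div₀ hA0 hY (by positivity) (pow_le_pow_left₀ hε.le hd2 2)
  rw [le_div_iff₀ (by positivity)]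
  have e4 : IV * (2 * |l.im|) = |2 * (star l).im * IV| := by
    rw [abs_mul, abs_mul, abs_two, abs_of_nonneg h0', Complex.star_def, Complex.conj_im, abs_neg]
    ring
  have e5 : 2 * (star l).im * IV = hermForm ((Z d).mulVec k) - hermForm k := by
    rw [e1]; ring
  rw [e4, e5]
  refine (abs_sub _ _).trans ?_
  linarith

theorem IsFundamental.tendsto_det (hb : 0 < b) (hU : D.IsFundamental l U Y)
    (hV : D.IsFundamental (star l) V Z)
    (hlim : Tendsto (fun c => ‖(Y c).det‖) (toEnd b) (𝓝 0)) :
    Tendsto (fun c => ‖(Z c).det‖) (toEnd b) atTop := by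
  obtain ⟨β, -, hβI, -⟩ := exists_strictMono_cutoffs hb
  have h1 : Tendsto (fun c => ‖(Y c).det‖) (toEnd b) (𝓝[>] 0) := by
    refine tendsto_nhdsWithin_iff.2 ⟨hlim, ?_⟩
    filter_upwards [eventually_toEnd (hβI 0)] with c hc
    exact norm_pos_iff.2 (hU.det_ne_zero hV hc.2).1
  refine (tendsto_inv_nhdsGT_zero.comp h1).congr' ?_
  filter_upwards [eventually_toEnd (hβI 0)] with c hc
  have := congrArg norm (hU.star_det_mul_det hV hc.2)
  rw [norm_mul, norm_star, norm_one] at this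
  exact (eq_inv_of_mul_eq_one_left this).symm

end DensityData

/-! ### Contractions from Weyl solutions -/

namespace DensityData

variable {b : EReal} {D : DensityData b} {l : ℂ} {f u v : ℝ → Fin 2 → ℂ} {y : Fin 2 → ℂ}
  {U Y V Z : ℝ → Matrix (Fin 2) (Fin 2) ℂ} {h g : ℝ → EuclideanSpace ℂ (Fin 2)}

/-- The forcing term `Sᴴ h` associated with an element `h` of `L²(ν)`. -/
noncomputable def forcing (D : DensityData b) (h : ℝ → EuclideanSpace ℂ (Fin 2)) (t : ℝ) :
    Fin 2 → ℂ :=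
  (D.S t).conjTranspose.mulVec (h t).ofLp

theorem forcing_weighted (u : ℝ → Fin 2 → ℂ) (t : ℝ) :
    D.forcing (D.weighted u) t = (D.W t).mulVec (u t) := by
  simp only [forcing, weighted, Matrix.mulVec_mulVec, ← D.W_eq]

theorem forcing_add (h g : ℝ → EuclideanSpace ℂ (Fin 2)) (t : ℝ) :
    D.forcing (fun t => h t + g t) t = D.forcing h t + D.forcing g t := by
  simp only [forcing, WithLp.ofLp_add, Matrix.mulVec_add]

theorem forcing_smul (c : ℂ) (h : ℝ → EuclideanSpace ℂ (Fin 2)) (t : ℝ) :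
    D.forcing (fun t => c • h t) t = c • D.forcing h t := by
  simp only [forcing, WithLp.ofLp_smul, Matrix.mulVec_smul]

theorem weighted_add (u v : ℝ → Fin 2 → ℂ) (t : ℝ) :
    D.weighted (u + v) t = D.weighted u t + D.weighted v t := by
  simp only [weighted, Pi.add_apply, Matrix.mulVec_add, WithLp.toLp_add]

theorem weighted_smul (c : ℂ) (u : ℝ → Fin 2 → ℂ) (t : ℝ) :
    D.weighted (c • u) t = c • D.weighted u t := by
  simp only [weighted, Pi.smul_apply, Matrix.mulVec_smul, WithLp.toLp_smul]

theorem star_dotProduct_forcing (v : ℝ → Fin 2 → ℂ) (h : ℝ → EuclideanSpace ℂ (Fin 2)) (t : ℝ) :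
    star (v t) ⬝ᵥ D.forcing h t = inner ℂ (D.weighted v t) (h t) := by
  rw [EuclideanSpace.inner_eq_star_dotProduct, forcing, weighted, Matrix.dotProduct_mulVec,
    dotProduct_comm]
  congr 1
  rw [Matrix.star_mulVec]

theorem star_forcing_dotProduct (v : ℝ → Fin 2 → ℂ) (h : ℝ → EuclideanSpace ℂ (Fin 2)) (t : ℝ) :
    star (D.forcing h t) ⬝ᵥ v t = inner ℂ (h t) (D.weighted v t) := by
  rw [← inner_conj_symm, ← star_dotProduct_forcing, starRingEnd_apply,
    ← Matrix.star_dotProduct_star,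
    star_star, dotProduct_comm]

theorem star_weighted_dotProduct (v u : ℝ → Fin 2 → ℂ) (t : ℝ) :
    star ((D.S t).mulVec (v t)) ⬝ᵥ (D.S t).mulVec (u t)
      = inner ℂ (D.weighted v t) (D.weighted u t) := by
  rw [EuclideanSpace.inner_eq_star_dotProduct, dotProduct_comm]
  rfl

theorem integrableOn_forcing (hh : MemLp h 2 D.ν) :
    ∀ d ∈ interval b, IntegrableOn (D.forcing h) (Ioc 0 d) D.ν := by
  intro d hd
  have hfin : IsFiniteMeasure (D.ν.restrict (Ioc 0 d)) :=
    ⟨by rw [Measure.restrict_apply_univ]; exact D.finite d hd⟩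
  have h1 : IntegrableOn h (Ioc 0 d) D.ν := (hh.restrict _).integrable one_le_two
  have h2 : IntegrableOn (fun t => (h t).ofLp) (Ioc 0 d) D.ν :=
    (PiLp.continuousLinearEquiv 2 ℂ fun _ : Fin 2 => ℂ).toContinuousLinearMap.integrable_comp h1
  refine integrableOn_mulVec measurableSet_Ioc ⟨1, fun t _ i j => ?_⟩ (fun i j => ?_) h2
  · rw [Matrix.conjTranspose_apply, nnnorm_star]
    exact D.norm_S_le t j i
  · exact continuous_star.measurable.comp (D.measurable_S j i)

/-- The energy balance for `J u' + (q - l w) u = Sᴴ h dν`: the norm of `h + (l - star l) S v` on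
`(0, d)` differs from that of `h` by boundary terms only. -/
theorem IsInitSolution.integral_sq_eq (hb : 0 < b) (hh : MemLp h 2 D.ν)
    (hv : D.IsInitSolution l (D.forcing h) y v) {d : ℝ} (hd : d ∈ interval b) :
    IntegrableOn (fun t => ‖h t + (l - star l) • D.weighted v t‖ ^ 2) (Ioo 0 d) D.ν ∧
    ∫ t in Ioo 0 d, ‖h t + (l - star l) • D.weighted v t‖ ^ 2 ∂D.ν
      = ∫ t in Ioo 0 d, ‖h t‖ ^ 2 ∂D.ν
        + 2 * l.im * (hermForm (Function.leftLim v d) - hermForm y) := by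
  have hw : MemLp (D.weighted v) 2 (D.ν.restrict (Ioo 0 d)) :=
    (memLp_two_iff_integrable_sq_norm (D.aemeasurable_weighted
      (hv.aemeasurable hb)).aestronglyMeasurable.restrict).2 (hv.integrableOn_sq_weighted hb hd)
  have hhd : MemLp h 2 (D.ν.restrict (Ioo 0 d)) := hh.restrict _
  have hsum : MemLp (fun t => h t + (l - star l) • D.weighted v t) 2 (D.ν.restrict (Ioo 0 d)) :=
    hhd.add (hw.const_smul (l - star l))
  have i1 := (memLp_two_iff_integrable_sq_norm hsum.1).1 hsum
  have i2 := (memLp_two_iff_integrable_sq_norm hhd.1).1 hhd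
  refine ⟨i1, ?_⟩
  have e := (hv.lagrange hv hd).2
  simp only [star_dotProduct_forcing, star_forcing_dotProduct, star_weighted_dotProduct] at e
  rw [sympForm_self, sympForm_self] at e
  have hpt : ∀ t, ((‖h t + (l - star l) • D.weighted v t‖ ^ 2 - ‖h t‖ ^ 2 : ℝ) : ℂ)
      = -(l - star l) * (inner ℂ (D.weighted v t) (h t) - inner ℂ (h t) (D.weighted v t)
        + (l - star l) * inner ℂ (D.weighted v t) (D.weighted v t)) := by
    intro t
    have n : ∀ x : EuclideanSpace ℂ (Fin 2), ((‖x‖ : ℝ) : ℂ) ^ 2 = inner ℂ x x := fun x =>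
      (inner_self_eq_norm_sq_to_K (𝕜 := ℂ) x).symm
    push_cast
    rw [n, n]
    simp only [inner_add_left, inner_add_right, inner_smul_left, inner_smul_right, map_sub,
      Complex.star_def, Complex.conj_conj]
    ring
  have hint : ((∫ t in Ioo 0 d, (‖h t + (l - star l) • D.weighted v t‖ ^ 2 - ‖h t‖ ^ 2) ∂D.ν : ℝ)
      : ℂ) = -(l - star l) * (Complex.I * hermForm (Function.leftLim v d)
        - Complex.I * hermForm y) := by
    rw [e, add_sub_cancel_left, ← integral_const_mul, ← integral_complex_ofReal]
    exact integral_congr_ae (ae_of_all _ hpt)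
  rw [integral_sub i1 i2] at hint
  have hc : l - star l = (2 * l.im : ℝ) * Complex.I := by
    rw [← starRingEnd_apply, Complex.sub_conj]
  have hfin : ((∫ t in Ioo 0 d, ‖h t + (l - star l) • D.weighted v t‖ ^ 2 ∂D.ν
      - ∫ t in Ioo 0 d, ‖h t‖ ^ 2 ∂D.ν : ℝ) : ℂ)
      = ((2 * l.im * (hermForm (Function.leftLim v d) - hermForm y) : ℝ) : ℂ) := by
    rw [hint, hc]
    push_cast
    linear_combination (-(2 * l.im) * (hermForm (Function.leftLim v d) - hermForm y) : ℂ)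
      * Complex.I_sq
  have := Complex.ofReal_injective hfin
  linarith

theorem exists_smul_of_sympForm_eq_zero {ψ k : Fin 2 → ℂ} (hψ : ψ ≠ 0)
    (h : sympForm (star ψ) k = 0) : ∃ c : ℂ, k = c • ψ := by
  simp only [sympForm, Pi.star_apply, star_star] at h
  by_cases h0 : ψ 0 = 0
  · have h1 : ψ 1 ≠ 0 := by
      intro h1
      apply hψ
      ext i
      fin_cases i
      · exact h0
      · exact h1
    refine ⟨k 1 / ψ 1, ?_⟩
    ext i
    fin_cases i
    · have : ψ 1 * k 0 = 0 := by rw [h0] at h; simpa using h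
      simp [h0, (mul_eq_zero.1 this).resolve_left h1]
    · simp [div_mul_cancel₀ _ h1]
  · refine ⟨k 0 / ψ 0, ?_⟩
    ext i
    fin_cases i
    · simp [div_mul_cancel₀ _ h0]
    · simp only [Fin.mk_one, Pi.smul_apply, smul_eq_mul]
      field_simp
      linear_combination -h

/-- If the pairing with the Weyl solution at `star l` vanishes at `d`, then the left limit at `d` is
a multiple of the value of the Weyl solution at `l`. -/
theorem IsInitSolution.leftLim_eq_smul (hv : D.IsInitSolution l (D.forcing h) y v)
    (hU : D.IsFundamental l U Y) (hV : D.IsFundamental (star l) V Z) {ψ : Fin 2 → ℂ} (hψ0 : ψ ≠ 0)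
    {d : ℝ} (hd : d ∈ interval b)
    (h0 : sympForm (star ψ) y
      + ∫ t in Ioo 0 d, inner ℂ (D.weighted (fun t => (V t).mulVec (star ψ)) t) (h t) ∂D.ν = 0) :
    ∃ c : ℂ, Function.leftLim v d = c • (Y d).mulVec ψ := by
  set k := ((Y d)⁻¹).mulVec (Function.leftLim v d) with hk
  have hYk : (Y d).mulVec k = Function.leftLim v d := by
    rw [hk, Matrix.mulVec_mulVec, Matrix.mul_nonsing_inv _
      (isUnit_iff_ne_zero.2 (hU.det_ne_zero hV hd).1), Matrix.one_mulVec]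
  have hpt : ∀ t, star ((V t).mulVec (star ψ)) ⬝ᵥ D.forcing h t
      = inner ℂ (D.weighted (fun t => (V t).mulVec (star ψ)) t) (h t) := fun t =>
    star_dotProduct_forcing (fun t => (V t).mulVec (star ψ)) h t
  have h1 : sympForm (star ψ) k = 0 := by
    rw [← hU.sympForm_eq hV hd, hYk, ← hV.leftLim_eq _ _ hd,
      (hv.lagrange (hV.isInitSolution (star ψ)) hd).2]
    simp only [hpt, star_star, sub_self, zero_mul, Pi.zero_apply, star_zero,
      zero_dotProduct, sub_zero, add_zero]
    exact h0
  obtain ⟨c, hc⟩ := exists_smul_of_sympForm_eq_zero hψ0 h1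
  exact ⟨c, by rw [← hYk, hc, Matrix.mulVec_smul]⟩

/-- A function with forcing `Sᴴ h` whose initial value is chosen so that the pairing with the
Weyl solution at `star l` vanishes at `b` is the limit of functions for which the energy
balance has the right sign. -/
theorem lintegral_sq_le_of_pairing (hb : 0 < b) (hU : D.IsFundamental l U Y)
    (hV : D.IsFundamental (star l) V Z) {ψ p : Fin 2 → ℂ} (hψ0 : ψ ≠ 0)
    (hψ : ∀ x ∈ interval b, l.im * hermForm ((Y x).mulVec ψ) ≤ 0)
    (hp : 0 ≤ l.im * hermForm p) (hp0 : sympForm (star ψ) p ≠ 0)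
    (hχ : MemLp (D.weighted fun t => (V t).mulVec (star ψ)) 2 D.ν) (hh : MemLp h 2 D.ν)
    (hv : D.IsInitSolution l (D.forcing h)
      ((-(∫ t, inner ℂ (D.weighted (fun t => (V t).mulVec (star ψ)) t) (h t) ∂D.ν)
        / sympForm (star ψ) p) • p) v) :
    ∫⁻ t, ‖h t + (l - star l) • D.weighted v t‖ₑ ^ 2 ∂D.ν ≤ ∫⁻ t, ‖h t‖ₑ ^ 2 ∂D.ν := by
  obtain ⟨β, hβ, hβI, hβx⟩ := exists_strictMono_cutoffs hb
  set X := D.weighted fun t => (V t).mulVec (star ψ) with hX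
  set c₀ := sympForm (star ψ) p with hc₀
  set α : ℂ := -(∫ t, inner ℂ (X t) (h t) ∂D.ν) / c₀ with hα
  -- The coefficients for which the pairing vanishes at `β n` instead of `b`.
  set αn : ℕ → ℂ := fun n => -(∫ t in Ioo 0 (β n), inner ℂ (X t) (h t) ∂D.ν) / c₀ with hαn
  have hXh : Integrable (fun t => inner ℂ (X t) (h t)) D.ν := by
    have := L2.integrable_inner (𝕜 := ℂ) hχ.toLp hh.toLp
    refine this.congr ?_
    filter_upwards [hχ.coeFn_toLp, hh.coeFn_toLp] with t h1 h2
    rw [h1, h2]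
  have hlim : Tendsto αn atTop (𝓝 α) := by
    refine Tendsto.div_const (Tendsto.neg ?_) _
    have := tendsto_setIntegral_of_eventually_mem_iff (l := atTop) (A := fun n => Ioo 0 (β n))
      (B := interval b) MeasurableSet.univ hXh.integrableOn
      (Eventually.of_forall fun n => measurableSet_Ioo) (isOpen_interval b).measurableSet
      (Eventually.of_forall fun n => subset_univ _) (fun t => by
        by_cases ht : t ∈ interval b
        · obtain ⟨n, hn⟩ := hβx t ht
          filter_upwards [eventually_ge_atTop n] with m hm
          exact ⟨fun _ => ht, fun _ => ⟨ht.1, hn.trans_le (hβ.monotone hm)⟩⟩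
        · refine Eventually.of_forall fun n => ⟨fun h => ?_, fun h => absurd h ht⟩
          exact interval_mem_of_le (hβI n) h.1 h.2.le)
    rwa [Measure.restrict_eq_self_of_ae_mem D.interval_ae] at this
  set P : ℝ → Fin 2 → ℂ := fun t => (U t).mulVec p with hP
  have hPi : D.IsInitSolution l 0 p P := hU.isInitSolution p
  set vn : ℕ → ℝ → Fin 2 → ℂ := fun n => v + (αn n - α) • P with hvn
  have hvni : ∀ n, D.IsInitSolution l (D.forcing h) (αn n • p) (vn n) := by
    intro n
    have := hv.add (hPi.smul (αn n - α))
    rw [smul_zero, add_zero, ← add_smul, add_sub_cancel] at this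
    exact this
  have bound : ∀ n, ∫⁻ t in Ioo 0 (β n), ‖h t + (l - star l) • D.weighted (vn n) t‖ₑ ^ 2 ∂D.ν
      ≤ ∫⁻ t, ‖h t‖ₑ ^ 2 ∂D.ν := by
    intro n
    obtain ⟨i1, e1⟩ := (hvni n).integral_sq_eq hb hh (hβI n)
    refine le_trans ?_ (setLIntegral_le_lintegral (Ioo 0 (β n)) _)
    have hhd : MemLp h 2 (D.ν.restrict (Ioo 0 (β n))) := hh.restrict _
    have i2 := (memLp_two_iff_integrable_sq_norm hhd.1).1 hhd
    rw [lintegral_sq_eq_ofReal i1, lintegral_sq_eq_ofReal i2, e1]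
    refine ENNReal.ofReal_le_ofReal ?_
    have hleft : ∃ c : ℂ, Function.leftLim (vn n) (β n) = c • (Y (β n)).mulVec ψ := by
      refine (hvni n).leftLim_eq_smul hU hV hψ0 (hβI n) ?_
      rw [sympForm_smul_right]
      exact (congrArg (· + _) (div_mul_cancel₀ _ hp0)).trans (neg_add_cancel _)
    obtain ⟨c, hc⟩ := hleft
    rw [hc, hermForm_smul, hermForm_smul]
    have h1 := mul_nonneg (sq_nonneg ‖c‖) (neg_nonneg.2 (hψ _ (hβI n)))
    have h2 := mul_nonneg (sq_nonneg ‖αn n‖) hp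
    linarith
  refine lintegral_le_of_forall_exists hb fun c hc => ⟨c, hc, le_rfl, ?_⟩
  obtain ⟨n₀, hn₀⟩ := hβx c hc
  have hmeas : ∀ n, AEMeasurable (fun t => ‖h t + (l - star l) • D.weighted (vn n) t‖ₑ ^ 2)
      (D.ν.restrict (Ioo 0 c)) := fun n => by
    have h1 : AEMeasurable (fun t => h t + (l - star l) • D.weighted (vn n) t) D.ν :=
      hh.1.aemeasurable.add ((D.aemeasurable_weighted
        ((hvni n).aemeasurable hb)).const_smul (l - star l))
    exact (h1.enorm.pow_const 2).restrict
  have hpt : ∀ t, Tendsto (fun n => ‖h t + (l - star l) • D.weighted (vn n) t‖ₑ ^ 2) atTop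
      (𝓝 (‖h t + (l - star l) • D.weighted v t‖ₑ ^ 2)) := by
    intro t
    have h1 : Tendsto (fun n => D.weighted (vn n) t) atTop (𝓝 (D.weighted v t)) := by
      have h2 : ∀ n, D.weighted (vn n) t = D.weighted v t + (αn n - α) • D.weighted P t := by
        intro n
        rw [hvn]
        beta_reduce
        rw [weighted_add, weighted_smul]
      simp_rw [h2]
      have h3 : Tendsto (fun n => αn n - α) atTop (𝓝 0) := by
        rw [← sub_self α]; exact hlim.sub_const α
      have := (h3.smul_const (D.weighted P t)).const_add (D.weighted v t)
      rwa [zero_smul, add_zero] at this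
    have h4 : Tendsto (fun n => h t + (l - star l) • D.weighted (vn n) t) atTop
        (𝓝 (h t + (l - star l) • D.weighted v t)) := (h1.const_smul (l - star l)).const_add (h t)
    exact ((ENNReal.continuous_pow 2).tendsto _).comp h4.enorm
  -- Fatou's lemma
  calc ∫⁻ t in Ioo 0 c, ‖h t + (l - star l) • D.weighted v t‖ₑ ^ 2 ∂D.ν
      = ∫⁻ t in Ioo 0 c, liminf (fun n => ‖h t + (l - star l) • D.weighted (vn n) t‖ₑ ^ 2)
          atTop ∂D.ν := lintegral_congr fun t => (hpt t).liminf_eq.symm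
    _ ≤ liminf (fun n => ∫⁻ t in Ioo 0 c, ‖h t + (l - star l) • D.weighted (vn n) t‖ₑ ^ 2 ∂D.ν)
          atTop := lintegral_liminf_le' hmeas
    _ ≤ ∫⁻ t, ‖h t‖ₑ ^ 2 ∂D.ν := by
        refine liminf_le_of_le (by isBoundedDefault) fun B hB => ?_
        obtain ⟨n, hn1, hn2⟩ := (hB.and (eventually_ge_atTop n₀)).exists
        exact hn1.trans ((lintegral_mono_set (Ioo_subset_Ioo_right
          (hn₀.le.trans (hβ.monotone hn2)))).trans (bound n))

end DensityData

/-- The space `L²(ν; ℂ²)`. -/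
abbrev VecL2 (ν : Measure ℝ) : Type := Lp (EuclideanSpace ℂ (Fin 2)) 2 ν

theorem eLpNorm_two_eq_lintegral {ν : Measure ℝ} (f : ℝ → EuclideanSpace ℂ (Fin 2)) :
    eLpNorm f 2 ν = (∫⁻ t, ‖f t‖ₑ ^ 2 ∂ν) ^ (1 / 2 : ℝ) := by
  rw [eLpNorm_eq_lintegral_rpow_enorm_toReal two_ne_zero ENNReal.ofNat_ne_top]
  simp

namespace DensityData

variable {b : EReal} {D : DensityData b} {l : ℂ} {f u v : ℝ → Fin 2 → ℂ} {y : Fin 2 → ℂ}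
  {U Y V Z : ℝ → Matrix (Fin 2) (Fin 2) ℂ} {h g : ℝ → EuclideanSpace ℂ (Fin 2)}

theorem memLp_weighted_iff (hu : AEMeasurable u D.ν) :
    MemLp (D.weighted u) 2 D.ν ↔ D.sqNorm u < ⊤ := by
  rw [MemLp, and_iff_right (D.aemeasurable_weighted hu).aestronglyMeasurable,
    eLpNorm_two_eq_lintegral, ENNReal.rpow_lt_top_iff_of_pos (by norm_num), sqNorm]

/-- There is a linear contraction of `L²(ν)` of the form `C h = h + (l - star l) S v` with a
solution `v` of the equation at `l` with forcing `Sᴴ h`. In the language of operators, `v` is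
given by the resolvent of a maximal dissipative or accumulative relation and `C` is its Cayley
transform. -/
theorem IsRegular.exists_contraction (hb : 0 < b) (hl : l.im ≠ 0) (hreg : D.IsRegular l) :
    ∃ C : VecL2 D.ν →L[ℂ] VecL2 D.ν, ‖C‖ ≤ 1 ∧ ∀ h : VecL2 D.ν, ∃ y v,
      D.IsInitSolution l (D.forcing h) y v ∧
      C h =ᵐ[D.ν] fun t => h t + (l - star l) • D.weighted v t := by
  obtain ⟨U, Y, hU⟩ := hreg.exists_isFundamental hb
  obtain ⟨V, Z, hV⟩ := hreg.conj.exists_isFundamental hb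
  obtain ⟨ψ, hψ0, hψ⟩ := hU.exists_hermForm_nonpos hb hV
  obtain ⟨β, -, hβI, -⟩ := exists_strictMono_cutoffs hb
  have hl' : (star l).im ≠ 0 := by rw [Complex.star_def, Complex.conj_im]; exact neg_ne_zero.2 hl
  have hχi := hV.isInitSolution (star ψ)
  have hχ : MemLp (D.weighted fun t => (V t).mulVec (star ψ)) 2 D.ν :=
    (memLp_weighted_iff (hχi.aemeasurable hb)).2
      (hV.sqNorm_lt_top_of_hermForm_nonpos hb hl' (hU.hermForm_conj_nonpos hV hψ))
  -- The boundary condition `u(0+) ∈ ℂ p` at `0`: the form is strictly positive on `p`, up to the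
  -- sign of `l.im`, while it is nonpositive on `ψ`, so that `p` and `ψ` are independent.
  set p : Fin 2 → ℂ := ![1, -(l.im * Complex.I)] with hp
  have hpform : hermForm p = 2 * l.im := by simp [hermForm, hp]
  have hp1 : 0 < l.im * hermForm p := by
    rw [hpform]
    have : 0 < l.im ^ 2 := by positivity
    nlinarith
  have hψ1 : l.im * hermForm ψ ≤ 0 := by
    have h1 := hψ _ (hβI 0)
    rw [hU.hermForm_eq (hβI 0)] at h1
    have h2 : 0 ≤ ∫ t in Ioo 0 (β 0), ‖D.weighted (fun t => (U t).mulVec ψ) t‖ ^ 2 ∂D.ν :=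
      integral_nonneg fun _ => by positivity
    nlinarith [mul_nonneg (sq_nonneg l.im) h2]
  have hp0 : sympForm (star ψ) p ≠ 0 := by
    intro h0
    obtain ⟨c, hc⟩ := exists_smul_of_sympForm_eq_zero hψ0 h0
    rw [hc, hermForm_smul] at hp1
    nlinarith [mul_nonneg (sq_nonneg ‖c‖) (neg_nonneg.2 hψ1)]
  set X : VecL2 D.ν := hχ.toLp with hX
  set α : VecL2 D.ν → ℂ := fun h => -inner ℂ X h / sympForm (star ψ) p with hα
  have hαadd : ∀ h g, α (h + g) = α h + α g := fun h g => by
    simp only [hα, inner_add_right]; ring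
  have hαsmul : ∀ (c : ℂ) h, α (c • h) = c * α h := fun c h => by
    simp only [hα, inner_smul_right]; ring
  have hαint : ∀ h, α h = -(∫ t, inner ℂ (D.weighted (fun t => (V t).mulVec (star ψ)) t) (h t)
      ∂D.ν) / sympForm (star ψ) p := by
    intro h
    simp only [hα, L2.inner_def]
    congr 2
    refine integral_congr_ae ?_
    filter_upwards [hχ.coeFn_toLp] with t ht
    rw [hX, ht]
  have hF : ∀ h : VecL2 D.ν, ∀ d ∈ interval b, IntegrableOn (D.forcing h) (Ioc 0 d) D.ν :=
    fun h => integrableOn_forcing (Lp.memLp h)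
  choose v hvm hv using fun h : VecL2 D.ν => hreg.exists_isInitSolution hb (hF h) (α h • p)
  have hvadd : ∀ h g, v (h + g) = v h + v g := by
    intro h g
    refine (hv (h + g)).unique hb hreg ?_ (hF _)
    have := (hv h).add (hv g)
    rw [← add_smul, ← hαadd] at this
    refine this.congr_ae ?_
    filter_upwards [Lp.coeFn_add h g] with t ht
    rw [Pi.add_apply, ← forcing_add]
    simp only [forcing, ht, Pi.add_apply]
  have hvsmul : ∀ (c : ℂ) h, v (c • h) = c • v h := by
    intro c h
    refine (hv (c • h)).unique hb hreg ?_ (hF _)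
    have := (hv h).smul c
    rw [← mul_smul, ← hαsmul] at this
    refine this.congr_ae ?_
    filter_upwards [Lp.coeFn_smul c h] with t ht
    rw [Pi.smul_apply, ← forcing_smul]
    simp only [forcing, ht, Pi.smul_apply]
  set G : VecL2 D.ν → ℝ → EuclideanSpace ℂ (Fin 2) := fun h t =>
    h t + (l - star l) • D.weighted (v h) t with hG
  have hle : ∀ h, ∫⁻ t, ‖G h t‖ₑ ^ 2 ∂D.ν ≤ ∫⁻ t, ‖h t‖ₑ ^ 2 ∂D.ν := by
    intro h
    refine lintegral_sq_le_of_pairing hb hU hV hψ0 hψ hp1.le hp0 hχ (Lp.memLp h) ?_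
    rw [← hαint]
    exact hv h
  have hle' : ∀ h, eLpNorm (G h) 2 D.ν ≤ eLpNorm h 2 D.ν := by
    intro h
    rw [eLpNorm_two_eq_lintegral, eLpNorm_two_eq_lintegral]
    exact ENNReal.rpow_le_rpow (hle h) (by norm_num)
  have hGm : ∀ h, AEMeasurable (G h) D.ν := fun h =>
    (Lp.aestronglyMeasurable h).aemeasurable.add
      ((D.aemeasurable_weighted (hvm h).aemeasurable).const_smul (l - star l))
  have hGL : ∀ h, MemLp (G h) 2 D.ν := fun h =>
    ⟨(hGm h).aestronglyMeasurable, (hle' h).trans_lt (Lp.eLpNorm_lt_top h)⟩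
  let L : VecL2 D.ν →ₗ[ℂ] VecL2 D.ν :=
    { toFun := fun h => (hGL h).toLp
      map_add' := fun h g => by
        refine Lp.ext ?_
        filter_upwards [(hGL (h + g)).coeFn_toLp, (hGL h).coeFn_toLp, (hGL g).coeFn_toLp,
          Lp.coeFn_add h g, Lp.coeFn_add (hGL h).toLp (hGL g).toLp] with t h1 h2 h3 h4 h5
        rw [h1, h5, Pi.add_apply, h2, h3]
        simp only [hG, h4, hvadd, weighted_add, Pi.add_apply, smul_add]
        abel
      map_smul' := fun c h => by
        refine Lp.ext ?_
        filter_upwards [(hGL (c • h)).coeFn_toLp, (hGL h).coeFn_toLp,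
          Lp.coeFn_smul c h, Lp.coeFn_smul c (hGL h).toLp] with t h1 h2 h4 h5
        rw [h1, RingHom.id_apply, h5, Pi.smul_apply, h2]
        simp only [hG, h4, hvsmul, weighted_smul, Pi.smul_apply, smul_add]
        rw [smul_comm] }
  have hLn : ∀ h, ‖L h‖ ≤ 1 * ‖h‖ := by
    intro h
    rw [one_mul]
    change ‖(hGL h).toLp‖ ≤ ‖h‖
    rw [Lp.norm_toLp, Lp.norm_def]
    exact ENNReal.toReal_mono (Lp.eLpNorm_ne_top h) (hle' h)
  refine ⟨L.mkContinuous 1 hLn, L.mkContinuous_norm_le zero_le_one hLn, fun h =>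
    ⟨α h • p, v h, hv h, ?_⟩⟩
  exact (hGL h).coeFn_toLp

end DensityData

/-! ### Constancy of the deficiency indices in the half-planes -/

namespace DensityData

variable {b : EReal} {D : DensityData b} {l μ : ℂ} {f u v : ℝ → Fin 2 → ℂ} {y : Fin 2 → ℂ}
  {U Y V Z : ℝ → Matrix (Fin 2) (Fin 2) ℂ} {h g : ℝ → EuclideanSpace ℂ (Fin 2)}

/-- A solution at `μ` solves the equation at `l` with the forcing `(μ - l) w u`. -/
theorem isBVSolution_shift (l μ : ℂ) (u : ℝ → Fin 2 → ℂ) :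
    D.IsBVSolution μ 0 u ↔ D.IsBVSolution l ((μ - l) • D.forcing (D.weighted u)) u := by
  have h : D.rhs μ 0 u = D.rhs l ((μ - l) • D.forcing (D.weighted u)) u := by
    funext t
    simp only [rhs, A, Pi.zero_apply, sub_zero, Pi.smul_apply, forcing_weighted]
    rw [← Matrix.smul_mulVec, ← Matrix.sub_mulVec]
    congr 2
    rw [sub_smul]
    abel
  constructor
  · rintro ⟨h1, h2, h3, h4⟩
    exact ⟨h1, h2, h3, by rwa [← h]⟩
  · rintro ⟨h1, h2, h3, h4⟩
    exact ⟨h1, h2, h3, by rwa [h]⟩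

theorem integrableOn_smul_forcing (c : ℂ) (hh : MemLp h 2 D.ν) :
    ∀ d ∈ interval b, IntegrableOn (c • D.forcing h) (Ioc 0 d) D.ν := fun d hd =>
  (integrableOn_forcing hh d hd).smul c

theorem isBVSolution_iff_exists_isInitSolution (hb : 0 < b) (hreg : D.IsRegular l)
    (hu : MemLp (D.weighted u) 2 D.ν) : D.IsBVSolution μ 0 u ↔
      ∃ y, D.IsInitSolution l ((μ - l) • D.forcing (D.weighted u)) y u := by
  rw [isBVSolution_shift l]
  exact ⟨fun h => h.exists_isInitSolution hb hreg (integrableOn_smul_forcing _ hu),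
    fun ⟨_, h⟩ => h.isBVSolution⟩

theorem weighted_add' (u v : ℝ → Fin 2 → ℂ) :
    D.weighted (u + v) = D.weighted u + D.weighted v := funext (weighted_add u v)

theorem weighted_smul' (c : ℂ) (u : ℝ → Fin 2 → ℂ) :
    D.weighted (c • u) = c • D.weighted u := funext (weighted_smul c u)

theorem forcing_add' (h g : ℝ → EuclideanSpace ℂ (Fin 2)) :
    D.forcing (h + g) = D.forcing h + D.forcing g := funext (forcing_add h g)

theorem forcing_smul' (c : ℂ) (h : ℝ → EuclideanSpace ℂ (Fin 2)) :
    D.forcing (c • h) = c • D.forcing h := funext (forcing_smul c h)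

theorem isInitSolution_zero : D.IsInitSolution l 0 0 0 := by
  have h : D.rhs l 0 0 = 0 := by
    funext t
    simp [rhs]
  refine ⟨fun _ _ => rfl, fun d _ => ?_, fun x _ => ?_⟩
  · rw [h]; exact integrable_zero _ _ _
  · simp [h]

/-- The space of solutions at `μ` of finite norm. A regular `l` is needed for the closure under
addition: one-sided limits of solutions are known to exist as values of initial value problems at
`l`, whereas `μ` itself need not be regular. -/
def solutionSpace (hb : 0 < b) (hreg : D.IsRegular l) (μ : ℂ) :
    Submodule ℂ (ℝ → Fin 2 → ℂ) where
  carrier := {u | D.IsBVSolution μ 0 u ∧ MemLp (D.weighted u) 2 D.ν}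
  zero_mem' := by
    have h0 : D.weighted 0 = 0 := by funext t; simp [weighted]
    exact ⟨isInitSolution_zero.isBVSolution, by rw [h0]; exact MemLp.zero⟩
  add_mem' := by
    rintro u v ⟨hu1, hu2⟩ ⟨hv1, hv2⟩
    have hw : MemLp (D.weighted (u + v)) 2 D.ν := by rw [weighted_add']; exact hu2.add hv2
    obtain ⟨y, hy⟩ := (isBVSolution_iff_exists_isInitSolution hb hreg hu2).1 hu1
    obtain ⟨z, hz⟩ := (isBVSolution_iff_exists_isInitSolution hb hreg hv2).1 hv1
    refine ⟨(isBVSolution_iff_exists_isInitSolution hb hreg hw).2 ⟨y + z, ?_⟩, hw⟩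
    rw [weighted_add', forcing_add', smul_add]
    exact hy.add hz
  smul_mem' := by
    rintro c u ⟨hu1, hu2⟩
    have hw : MemLp (D.weighted (c • u)) 2 D.ν := by rw [weighted_smul']; exact hu2.const_smul c
    obtain ⟨y, hy⟩ := (isBVSolution_iff_exists_isInitSolution hb hreg hu2).1 hu1
    refine ⟨(isBVSolution_iff_exists_isInitSolution hb hreg hw).2 ⟨c • y, ?_⟩, hw⟩
    rw [weighted_smul', forcing_smul', smul_comm]
    exact hy.smul c

/-- The map `u ↦ S u` from solutions of finite norm to `L²(ν)`. -/
noncomputable def toVecL2 (hb : 0 < b) (hreg : D.IsRegular l) (μ : ℂ) :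
    solutionSpace hb hreg μ →ₗ[ℂ] VecL2 D.ν where
  toFun u := u.2.2.toLp
  map_add' u v := by
    refine Lp.ext ?_
    filter_upwards [(u + v).2.2.coeFn_toLp, u.2.2.coeFn_toLp, v.2.2.coeFn_toLp,
      Lp.coeFn_add u.2.2.toLp v.2.2.toLp] with t h1 h2 h3 h4
    rw [h1, h4, Pi.add_apply, h2, h3]
    exact weighted_add _ _ t
  map_smul' c u := by
    refine Lp.ext ?_
    filter_upwards [(c • u).2.2.coeFn_toLp, u.2.2.coeFn_toLp,
      Lp.coeFn_smul c u.2.2.toLp] with t h1 h2 h4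
    rw [h1, RingHom.id_apply, h4, Pi.smul_apply, h2]
    exact weighted_smul _ _ t

theorem mem_range_toVecL2 {hb : 0 < b} {hreg : D.IsRegular l} {φ : VecL2 D.ν} :
    φ ∈ LinearMap.range (toVecL2 hb hreg μ) ↔
      ∃ u, D.IsBVSolution μ 0 u ∧ φ =ᵐ[D.ν] D.weighted u := by
  constructor
  · rintro ⟨u, rfl⟩
    exact ⟨u, u.2.1, u.2.2.coeFn_toLp⟩
  · rintro ⟨u, hu, hφ⟩
    have hm : MemLp (D.weighted u) 2 D.ν := (Lp.memLp φ).ae_eq hφ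
    exact ⟨⟨u, hu, hm⟩, Lp.ext (hm.coeFn_toLp.trans hφ.symm)⟩

theorem mem_ker_toVecL2 {hb : 0 < b} {hreg : D.IsRegular l} {u : solutionSpace hb hreg μ} :
    u ∈ LinearMap.ker (toVecL2 hb hreg μ) ↔ D.weighted u =ᵐ[D.ν] 0 := by
  rw [LinearMap.mem_ker]
  constructor
  · intro h
    have h1 : u.2.2.toLp = 0 := h
    have := u.2.2.coeFn_toLp
    rw [h1] at this
    exact this.symm.trans (Lp.coeFn_zero _ _ _)
  · intro h
    exact Lp.ext (u.2.2.coeFn_toLp.trans (h.trans (Lp.coeFn_zero _ _ _).symm))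

/-- Solutions of norm zero solve the equation for every spectral parameter. -/
theorem IsBVSolution.of_weighted_eq_zero (hu : D.IsBVSolution μ 0 u) (h : D.weighted u =ᵐ[D.ν] 0)
    (μ' : ℂ) : D.IsBVSolution μ' 0 u := by
  refine ⟨hu.eq_zero, hu.locallyBV, hu.balanced, fun c d hc hcd hd => ?_⟩
  rw [hu.equation c d hc hcd hd]
  refine integral_congr_ae (ae_restrict_of_ae ?_)
  filter_upwards [h] with t ht
  have hW : (D.W t).mulVec (u t) = 0 := by
    rw [← forcing_weighted, forcing, ht]
    simp
  simp only [rhs, A, Matrix.sub_mulVec, Matrix.smul_mulVec, hW, smul_zero]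

theorem sqNorm_eq_zero_iff (hu : AEMeasurable u D.ν) : D.sqNorm u = 0 ↔ D.weighted u =ᵐ[D.ν] 0 := by
  rw [sqNorm, lintegral_eq_zero_iff' ((D.aemeasurable_weighted hu).enorm.pow_const 2)]
  refine ⟨fun h => h.mono fun t ht => ?_, fun h => h.mono fun t ht => ?_⟩
  · simpa using ht
  · simp [ht]

/-- The deficiency index is the dimension of the space of solutions of finite norm, as a
subspace of `L²`. -/
theorem _root_.Coefficients.HasDensity.deficiencyIndex_eq {S : Coefficients b}
    (hSD : S.HasDensity D) (hb : 0 < b) (hreg : D.IsRegular l) (μ : ℂ) :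
    S.deficiencyIndex μ = Module.rank ℂ (LinearMap.range (toVecL2 hb hreg μ)) := by
  have hn : ∀ {u : ℝ → Fin 2 → ℂ} {μ : ℂ}, D.IsBVSolution μ 0 u → S.normSq u = D.sqNorm u :=
    fun hu => hSD.normSq_eq hb hu.locallyBV
  have hm : ∀ {u : ℝ → Fin 2 → ℂ} {μ : ℂ}, D.IsBVSolution μ 0 u → AEMeasurable u D.ν :=
    fun hu => D.aemeasurable_of_locallyBV hb hu.locallyBV
  set N : Submodule ℂ (ℝ → Fin 2 → ℂ) :=
    (LinearMap.ker (toVecL2 hb hreg 0)).map (solutionSpace hb hreg 0).subtype with hN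
  have hNmem : ∀ u, u ∈ N ↔ D.IsBVSolution 0 0 u ∧ D.weighted u =ᵐ[D.ν] 0 := by
    intro u
    rw [hN, Submodule.mem_map]
    constructor
    · rintro ⟨w, hw, rfl⟩
      exact ⟨w.2.1, mem_ker_toVecL2.1 hw⟩
    · rintro ⟨h1, h2⟩
      have hL : MemLp (D.weighted u) 2 D.ν := MemLp.zero.ae_eq h2.symm
      exact ⟨⟨u, h1, hL⟩, mem_ker_toVecL2.2 h2, rfl⟩
  have e1 : S.finiteNormSolutions μ = solutionSpace hb hreg μ := by
    ext u
    change (S.IsSolution μ u ∧ _) ↔ (D.IsBVSolution μ 0 u ∧ _)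
    rw [hSD.isSolution_iff]
    exact and_congr_right fun hu => by rw [hn hu, memLp_weighted_iff (hm hu)]
  have e2 : S.nullSolutions = N := by
    ext u
    change (S.IsSolution 0 u ∧ _) ↔ u ∈ N
    rw [hSD.isSolution_iff, hNmem]
    exact and_congr_right fun hu => by rw [hn hu, sqNorm_eq_zero_iff (hm hu)]
  rw [Coefficients.deficiencyIndex, e1, e2, Submodule.span_eq, Submodule.span_eq]
  set M := N.mkQ ∘ₗ (solutionSpace hb hreg μ).subtype with hM
  have hr : (solutionSpace hb hreg μ).map N.mkQ = LinearMap.range M := by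
    rw [hM, LinearMap.range_comp, Submodule.range_subtype]
  have hk : LinearMap.ker M = LinearMap.ker (toVecL2 hb hreg μ) := by
    ext u
    rw [mem_ker_toVecL2, hM, LinearMap.mem_ker, LinearMap.comp_apply, Submodule.mkQ_apply,
      Submodule.Quotient.mk_eq_zero, Submodule.subtype_apply, hNmem]
    exact ⟨fun h => h.2, fun h => ⟨u.2.1.of_weighted_eq_zero h 0, h⟩⟩
  rw [hr]
  exact (M.quotKerEquivRange.symm.trans ((Submodule.quotEquivOfEq _ _ hk).trans
    (toVecL2 hb hreg μ).quotKerEquivRange)).rank_eq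

/-- The Cayley transform maps the half-plane containing `l` to the unit disc. -/
theorem norm_div_lt_one (hμ : 0 < μ.im * l.im) : ‖(μ - l) / (μ - star l)‖ < 1 := by
  have h : Complex.normSq (μ - l) < Complex.normSq (μ - star l) := by
    rw [Complex.normSq_apply, Complex.normSq_apply]
    simp
    nlinarith
  have hpos : 0 < Complex.normSq (μ - star l) := (Complex.normSq_nonneg _).trans_lt h
  have hne : 0 < ‖μ - star l‖ := norm_pos_iff.2 fun h0 => by rw [h0] at hpos; simp at hpos
  rw [norm_div, div_lt_one hne]
  rw [Complex.normSq_eq_norm_sq, Complex.normSq_eq_norm_sq] at h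
  exact lt_of_pow_lt_pow_left₀ 2 hne.le h

/-- The deficiency index is constant in each half-plane: the contraction associated with `l`
provides an invertible map which takes the solutions at `μ` onto the solutions at `l`. -/
theorem rank_range_toVecL2_eq (hb : 0 < b) (hreg : D.IsRegular l) (hμ : 0 < μ.im * l.im) :
    Module.rank ℂ (LinearMap.range (toVecL2 hb hreg μ))
      = Module.rank ℂ (LinearMap.range (toVecL2 hb hreg l)) := by
  have hl : l.im ≠ 0 := by
    intro h0; rw [h0, mul_zero] at hμ; exact lt_irrefl _ hμ
  obtain ⟨C, hC1, hC⟩ := hreg.exists_contraction hb hl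
  have hκ : l - star l ≠ 0 := by
    rw [← starRingEnd_apply, Complex.sub_conj]
    simpa using hl
  have hκ' : μ - star l ≠ 0 := by
    intro h0
    have := congrArg Complex.im h0
    simp at this
    have : μ.im = -l.im := by linarith
    rw [this] at hμ
    nlinarith [sq_nonneg l.im]
  set w := (μ - l) / (μ - star l) with hw
  set T : VecL2 D.ν →L[ℂ] VecL2 D.ν := 1 - w • C with hT
  have hTunit : IsUnit T := by
    refine isUnit_one_sub_of_norm_lt_one ?_
    rw [norm_smul]
    calc ‖w‖ * ‖C‖ ≤ ‖w‖ * 1 := mul_le_mul_of_nonneg_left hC1 (norm_nonneg _)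
      _ < 1 := by rw [mul_one]; exact norm_div_lt_one hμ
  obtain ⟨R, hR1, hR2⟩ := isUnit_iff_exists.1 hTunit
  have hTR : ∀ φ, T (R φ) = φ := fun φ => by
    have := congrArg (fun A : VecL2 D.ν →L[ℂ] VecL2 D.ν => A φ) hR1
    exact this
  have hRT : ∀ φ, R (T φ) = φ := fun φ => by
    have := congrArg (fun A : VecL2 D.ν →L[ℂ] VecL2 D.ν => A φ) hR2
    exact this
  have hinj : Function.Injective T := Function.LeftInverse.injective hRT
  -- `T h` is, up to the factor `(l - star l) / (μ - star l)`, equal to `h - (μ - l) S v`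
  have hTh : ∀ h : VecL2 D.ν, ∃ y v, D.IsInitSolution l (D.forcing h) y v ∧
      T h =ᵐ[D.ν] fun t => ((l - star l) / (μ - star l)) • (h t - (μ - l) • D.weighted v t) := by
    intro h
    obtain ⟨y, v, hv, hCh⟩ := hC h
    refine ⟨y, v, hv, ?_⟩
    have e : T h = h - w • C h := rfl
    rw [e]
    filter_upwards [hCh, Lp.coeFn_sub h (w • C h), Lp.coeFn_smul w (C h)] with t h1 h2 h3
    rw [h2, Pi.sub_apply, h3, Pi.smul_apply, h1, smul_add, smul_sub, smul_smul, smul_smul,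
      ← sub_sub]
    congr 1
    · rw [← one_smul ℂ ((h : ℝ → EuclideanSpace ℂ (Fin 2)) t), smul_smul, ← sub_smul, mul_one,
        smul_smul, mul_one]
      congr 1
      rw [hw]
      field_simp
      ring
    · congr 1
      rw [hw]
      ring
  set r := (l - star l) / (μ - star l) with hr
  have hr0 : r ≠ 0 := div_ne_zero hκ hκ'
  have hmap : (LinearMap.range (toVecL2 hb hreg μ)).map T.toLinearMap
      = LinearMap.range (toVecL2 hb hreg l) := by
    ext φ
    rw [Submodule.mem_map]
    constructor
    · rintro ⟨h, hh, rfl⟩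
      obtain ⟨u, hu, hhu⟩ := mem_range_toVecL2.1 hh
      have hm : MemLp (D.weighted u) 2 D.ν := (Lp.memLp h).ae_eq hhu
      obtain ⟨y, hy⟩ := (isBVSolution_iff_exists_isInitSolution hb hreg hm).1 hu
      obtain ⟨z, v, hv, hTv⟩ := hTh h
      refine mem_range_toVecL2.2 ⟨r • (u + -(μ - l) • v), ?_, ?_⟩
      · have := (hy.add (hv.smul (-(μ - l)))).smul r
        refine (this.congr_ae (g := 0) ?_).isBVSolution
        filter_upwards [hhu] with t ht
        simp only [Pi.smul_apply, Pi.add_apply, forcing, ht, Pi.zero_apply, ← add_smul]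
        simp
      · filter_upwards [hTv, hhu] with t h1 h2
        rw [weighted_smul, weighted_add, weighted_smul]
        refine h1.trans ?_
        rw [h2, neg_smul, sub_eq_add_neg]
    · intro hφ
      obtain ⟨w', hw', hφw⟩ := mem_range_toVecL2.1 hφ
      obtain ⟨y, hy⟩ := hw'.exists_isInitSolution hb hreg integrableOn_zero
      obtain ⟨z, v, hv, hTv⟩ := hTh (R φ)
      rw [hTR] at hTv
      refine ⟨R φ, ?_, hTR φ⟩
      set u := r⁻¹ • w' + (μ - l) • v with hu
      have hRu : R φ =ᵐ[D.ν] D.weighted u := by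
        filter_upwards [hTv, hφw] with t h1 h2
        rw [hu, weighted_add, weighted_smul, weighted_smul, ← h2, h1, smul_smul,
          inv_mul_cancel₀ hr0, one_smul, sub_add_cancel]
      have hm : MemLp (D.weighted u) 2 D.ν := (Lp.memLp (R φ)).ae_eq hRu
      refine mem_range_toVecL2.2 ⟨u, ?_, hRu⟩
      refine (isBVSolution_iff_exists_isInitSolution hb hreg hm).2
        ⟨r⁻¹ • y + (μ - l) • z, ?_⟩
      refine ((hy.smul r⁻¹).add (hv.smul (μ - l))).congr_ae ?_
      filter_upwards [hRu] with t ht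
      simp only [Pi.smul_apply, Pi.add_apply, forcing, ht, Pi.zero_apply, smul_zero, zero_add]
  rw [← hmap]
  exact (Submodule.equivMapOfInjective T.toLinearMap hinj _).rank_eq

end DensityData

/-! ### Counting solutions through initial values -/

namespace DensityData

variable {b : EReal} {D : DensityData b} {l μ : ℂ}
  {U Y V Z : ℝ → Matrix (Fin 2) (Fin 2) ℂ}

/-- The linear map which takes an initial value to the corresponding solution, for a fundamental
matrix `U`. -/
def initToSolution (U : ℝ → Matrix (Fin 2) (Fin 2) ℂ) : (Fin 2 → ℂ) →ₗ[ℂ] (ℝ → Fin 2 → ℂ) where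
  toFun k t := (U t).mulVec k
  map_add' _ _ := funext fun _ => Matrix.mulVec_add _ _ _
  map_smul' _ _ := funext fun _ => Matrix.mulVec_smul _ _ _

/-- The initial values of the solutions of finite norm. -/
def finiteNormInit (hb : 0 < b) (hreg : D.IsRegular l) (U : ℝ → Matrix (Fin 2) (Fin 2) ℂ) :
    Submodule ℂ (Fin 2 → ℂ) :=
  (solutionSpace hb hreg l).comap (initToSolution U)

theorem IsFundamental.mem_finiteNormInit {hb : 0 < b} {hreg : D.IsRegular l}
    (hU : D.IsFundamental l U Y) {k : Fin 2 → ℂ} :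
    k ∈ finiteNormInit hb hreg U ↔ D.sqNorm (fun t => (U t).mulVec k) < ⊤ := by
  rw [← memLp_weighted_iff ((hU.isInitSolution k).aemeasurable hb)]
  exact and_iff_right (hU.isInitSolution k).isBVSolution

/-- The initial values of the solutions of norm zero. -/
def nullInit (D : DensityData b) (U : ℝ → Matrix (Fin 2) (Fin 2) ℂ) :
    Set (Fin 2 → ℂ) := {k | D.weighted (initToSolution U k) =ᵐ[D.ν] 0}

/-- The solutions of norm zero, hence their initial values, do not depend on the spectral
parameter. -/
theorem IsFundamental.nullInit_subset (hb : 0 < b) (hreg : D.IsRegular μ)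
    (hU : D.IsFundamental l U Y) (hV : D.IsFundamental μ V Z) : D.nullInit U ⊆ D.nullInit V := by
  intro k hk
  have h1 := hU.isInitSolution k
  have hr : D.rhs l 0 (initToSolution U k) =ᵐ[D.ν] D.rhs μ 0 (initToSolution U k) := by
    filter_upwards [hk] with t ht
    have hW : (D.W t).mulVec (initToSolution U k t) = 0 := by
      rw [← forcing_weighted, forcing, ht]
      simp
    simp only [rhs, A, Matrix.sub_mulVec, Matrix.smul_mulVec, hW, smul_zero]
  have h2 : D.IsInitSolution μ 0 k (initToSolution U k) := by
    refine ⟨h1.eq_zero, fun d hd => (h1.integrable d hd).congr (ae_restrict_of_ae hr),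
      fun x hx => ?_⟩
    rw [← integral_congr_ae (ae_restrict_of_ae hr)]
    refine (h1.eq_integral x hx).trans ?_
    congr 1
    by_cases h0 : D.ν.real {x} = 0
    · simp [h0]
    · have h3 := ae_singleton hr h0
      rw [← h3]
      rfl
  have h3 : initToSolution U k = initToSolution V k :=
    h2.unique hb hreg (hV.isInitSolution k) integrableOn_zero
  change D.weighted (initToSolution V k) =ᵐ[D.ν] 0
  rw [← h3]
  exact hk

/-- The number of solutions of finite norm, counted modulo those of norm zero, in terms of initial
values. -/
theorem IsFundamental.exists_rank_eq (hb : 0 < b) (hreg : D.IsRegular l)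
    (hU : D.IsFundamental l U Y) : ∃ n : ℕ,
      Module.rank ℂ (LinearMap.range (toVecL2 hb hreg l)) = n ∧
      n + Module.finrank ℂ (Submodule.span ℂ (D.nullInit U))
        = Module.finrank ℂ (finiteNormInit hb hreg U) := by
  set F := finiteNormInit hb hreg U with hF
  set G : F →ₗ[ℂ] VecL2 D.ν := toVecL2 hb hreg l ∘ₗ
    ((initToSolution U).restrict (p := F) (q := solutionSpace hb hreg l) fun _ hk => hk) with hG
  have hrange : LinearMap.range G = LinearMap.range (toVecL2 hb hreg l) := by
    ext φ
    constructor
    · rintro ⟨k, rfl⟩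
      exact ⟨_, rfl⟩
    · rintro ⟨u, rfl⟩
      obtain ⟨k, hk⟩ := u.2.1.exists_isInitSolution hb hreg integrableOn_zero
      have hu : u.1 = initToSolution U k :=
        hk.unique hb hreg (hU.isInitSolution k) integrableOn_zero
      have hkF : k ∈ F := by
        change initToSolution U k ∈ solutionSpace hb hreg l
        rw [← hu]
        exact u.2
      exact ⟨⟨k, hkF⟩, congrArg (toVecL2 hb hreg l) (Subtype.ext hu.symm)⟩
  have hker : ∀ k : F, k ∈ LinearMap.ker G ↔ (k : Fin 2 → ℂ) ∈ D.nullInit U := by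
    intro k
    have : k ∈ LinearMap.ker G ↔
      (initToSolution U).restrict (p := F) (q := solutionSpace hb hreg l) (fun _ hk => hk) k
        ∈ LinearMap.ker (toVecL2 hb hreg l) := Iff.rfl
    rw [this, mem_ker_toVecL2]
    rfl
  have hspan : (LinearMap.ker G).map F.subtype = Submodule.span ℂ (D.nullInit U) := by
    have : ((LinearMap.ker G).map F.subtype : Set (Fin 2 → ℂ)) = D.nullInit U := by
      ext k
      constructor
      · rintro ⟨w, hw, rfl⟩
        exact (hker w).1 hw
      · intro hk
        have hk' : D.weighted (initToSolution U k) =ᵐ[D.ν] 0 := hk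
        have hL : MemLp (D.weighted (initToSolution U k)) 2 D.ν := MemLp.zero.ae_eq hk'.symm
        have hkF : k ∈ F := ⟨(hU.isInitSolution k).isBVSolution, hL⟩
        exact ⟨⟨k, hkF⟩, (hker ⟨k, hkF⟩).2 hk, rfl⟩
    rw [← this, Submodule.span_eq]
  have hfd : FiniteDimensional ℂ (LinearMap.range (toVecL2 hb hreg l)) := by
    rw [← hrange]; infer_instance
  refine ⟨Module.finrank ℂ (LinearMap.range (toVecL2 hb hreg l)),
    (Module.finrank_eq_rank _ _).symm, ?_⟩
  rw [← hspan, ← hrange, Submodule.finrank_map_subtype_eq]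
  exact G.finrank_range_add_finrank_ker

theorem IsFundamental.finrank_finiteNormInit {hb : 0 < b} {hreg : D.IsRegular l}
    {ψ : Fin 2 → ℂ} (hψ : ψ ≠ 0) (hψF : ψ ∈ finiteNormInit hb hreg U)
    (hne : finiteNormInit hb hreg U ≠ ⊤) : Module.finrank ℂ (finiteNormInit hb hreg U) = 1 := by
  have h1 : 0 < Module.finrank ℂ (finiteNormInit hb hreg U) :=
    Module.finrank_pos_iff_exists_ne_zero.2 ⟨⟨ψ, hψF⟩, fun h => hψ (congrArg Subtype.val h)⟩
  have h2 := Submodule.finrank_lt hne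
  rw [Module.finrank_fin_fun] at h2
  omega

/-- If the numbers of solutions of finite norm at `l` and `star l` differ, then exactly one of the
two equations has only solutions of finite norm, and there the determinant tends to zero. -/
theorem tendsto_det_of_rank_ne (hb : 0 < b) (hl : l.im ≠ 0) (hreg : D.IsRegular l)
    (hU : D.IsFundamental l U Y) (hV : D.IsFundamental (star l) V Z)
    (hne : Module.rank ℂ (LinearMap.range (toVecL2 hb hreg l))
      ≠ Module.rank ℂ (LinearMap.range (toVecL2 hb hreg.conj (star l)))) :
    (Tendsto (fun c => ‖(Y c).det‖) (toEnd b) (𝓝 0) ∧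
      Tendsto (fun c => ‖(Z c).det‖) (toEnd b) atTop) ∨
    (Tendsto (fun c => ‖(Y c).det‖) (toEnd b) atTop ∧
      Tendsto (fun c => ‖(Z c).det‖) (toEnd b) (𝓝 0)) := by
  have hl' : (star l).im ≠ 0 := by rw [Complex.star_def, Complex.conj_im]; exact neg_ne_zero.2 hl
  have hU' : D.IsFundamental (star (star l)) U Y := by rwa [star_star]
  obtain ⟨ψ, hψ0, hψ⟩ := hU.exists_hermForm_nonpos hb hV
  have hψF : ψ ∈ finiteNormInit hb hreg U :=
    hU.mem_finiteNormInit.2 (hU.sqNorm_lt_top_of_hermForm_nonpos hb hl hψ)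
  have hχF : star ψ ∈ finiteNormInit hb hreg.conj V :=
    hV.mem_finiteNormInit.2 (hV.sqNorm_lt_top_of_hermForm_nonpos hb hl'
      (hU.hermForm_conj_nonpos hV hψ))
  obtain ⟨n, hn, hnF⟩ := hU.exists_rank_eq hb hreg
  obtain ⟨m, hm, hmF⟩ := hV.exists_rank_eq hb hreg.conj
  have hK : D.nullInit U = D.nullInit V :=
    (hU.nullInit_subset hb hreg.conj hV).antisymm (hV.nullInit_subset hb hreg hU)
  rw [hn, hm, Ne, Nat.cast_inj] at hne
  rw [hK] at hnF
  have hdim : Module.finrank ℂ (finiteNormInit hb hreg U)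
      ≠ Module.finrank ℂ (finiteNormInit hb hreg.conj V) := by omega
  have key1 : finiteNormInit hb hreg U = ⊤ → finiteNormInit hb hreg.conj V ≠ ⊤ := by
    intro h1 h2
    rw [h1, h2] at hdim
    exact hdim rfl
  by_cases h1 : finiteNormInit hb hreg U = ⊤
  · left
    have h2 := key1 h1
    have h3 : Tendsto (fun c => ‖(Y c).det‖) (toEnd b) (𝓝 0) := by
      by_contra hlim
      refine h2 (eq_top_iff.2 fun k _ => hV.mem_finiteNormInit.2
        (hU.sqNorm_lt_top_of_not_tendsto hb hl hV (fun k => ?_) hlim k))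
      exact hU.mem_finiteNormInit.1 (h1 ▸ Submodule.mem_top : k ∈ finiteNormInit hb hreg U)
    exact ⟨h3, hU.tendsto_det hb hV h3⟩
  · right
    have h2 : finiteNormInit hb hreg.conj V = ⊤ := by
      by_contra h2
      exact hdim ((IsFundamental.finrank_finiteNormInit hψ0 hψF h1).trans
        (IsFundamental.finrank_finiteNormInit (star_ne_zero.2 hψ0) hχF h2).symm)
    have h3 : Tendsto (fun c => ‖(Z c).det‖) (toEnd b) (𝓝 0) := by
      by_contra hlim
      refine h1 (eq_top_iff.2 fun k _ => hU.mem_finiteNormInit.2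
        (hV.sqNorm_lt_top_of_not_tendsto hb hl' hU' (fun k => ?_) hlim k))
      exact hV.mem_finiteNormInit.1 (h2 ▸ Submodule.mem_top : k ∈ finiteNormInit hb hreg.conj V)
    exact ⟨hV.tendsto_det hb hU' h3, h3⟩

end DensityData

theorem tendsto_enorm_zero_of_norm {α : Type*} {F : Filter α} {f : α → ℂ}
    (h : Tendsto (fun c => ‖f c‖) F (𝓝 0)) : Tendsto (fun c => ‖f c‖ₑ) F (𝓝 0) := by
  have := ENNReal.tendsto_ofReal h
  simpa using this

theorem tendsto_enorm_top_of_norm {α : Type*} {F : Filter α} {f : α → ℂ}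
    (h : Tendsto (fun c => ‖f c‖) F atTop) : Tendsto (fun c => ‖f c‖ₑ) F (𝓝 ⊤) := by
  have := ENNReal.tendsto_ofReal_atTop.comp h
  simpa [Function.comp_def] using this

/-- `μp` and `μm` are arbitrary points of the upper and the lower half-plane, at which
the deficiency indices `n₊` and `n₋` are evaluated; they need not be related to `l`. -/
theorem corollary3p5 (b : EReal) (hb : 0 < b) (S : Coefficients b)
    (l : ℂ) (hl : l.im ≠ 0) (hbad : l ∉ S.badSet)
    (μp μm : ℂ) (hp : 0 < μp.im) (hm : μm.im < 0) :
    (S.deficiencyIndex μp ≠ S.deficiencyIndex μm →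
      (Tendsto (fun c => ‖S.tau c l‖) (toEnd b) (𝓝 0) ∧
        Tendsto (fun c => ‖S.tau c (star l)‖) (toEnd b) atTop) ∨
      (Tendsto (fun c => ‖S.tau c l‖) (toEnd b) atTop ∧
        Tendsto (fun c => ‖S.tau c (star l)‖) (toEnd b) (𝓝 0))) ∧
    ((¬ ∃ t : ENNReal, Tendsto (fun c => ‖S.tau c l‖ₑ) (toEnd b) (𝓝 t)) →
      S.deficiencyIndex μp = S.deficiencyIndex μm) := by
  have main : S.deficiencyIndex μp ≠ S.deficiencyIndex μm →
      (Tendsto (fun c => ‖S.tau c l‖) (toEnd b) (𝓝 0) ∧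
        Tendsto (fun c => ‖S.tau c (star l)‖) (toEnd b) atTop) ∨
      (Tendsto (fun c => ‖S.tau c l‖) (toEnd b) atTop ∧
        Tendsto (fun c => ‖S.tau c (star l)‖) (toEnd b) (𝓝 0)) := by
    intro hne
    obtain ⟨D, hSD⟩ := S.exists_hasDensity hb
    have hreg : D.IsRegular l := hSD.isRegular hbad
    obtain ⟨U, Y, hU⟩ := hreg.exists_isFundamental hb
    obtain ⟨V, Z, hV⟩ := hreg.conj.exists_isFundamental hb
    obtain ⟨β, -, hβI, -⟩ := exists_strictMono_cutoffs hb
    have e1 : (fun c => ‖(Y c).det‖) =ᶠ[toEnd b] fun c => ‖S.tau c l‖ := by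
      filter_upwards [eventually_toEnd (hβI 0)] with c hc
      rw [hSD.tau_eq_det hreg hU hc.2]
    have e2 : (fun c => ‖(Z c).det‖) =ᶠ[toEnd b] fun c => ‖S.tau c (star l)‖ := by
      filter_upwards [eventually_toEnd (hβI 0)] with c hc
      rw [hSD.tau_eq_det hreg.conj hV hc.2]
    rw [← tendsto_congr' e1, ← tendsto_congr' e1, ← tendsto_congr' e2, ← tendsto_congr' e2]
    refine DensityData.tendsto_det_of_rank_ne hb hl hreg hU hV fun h => hne ?_
    have key : ∀ μ : ℂ, μ.im ≠ 0 → S.deficiencyIndex μ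
        = Module.rank ℂ (LinearMap.range (DensityData.toVecL2 hb hreg l)) := by
      intro μ hμ
      rcases lt_or_gt_of_ne (mul_ne_zero hμ hl) with hlt | hgt
      · rw [h, hSD.deficiencyIndex_eq hb hreg.conj μ]
        refine DensityData.rank_range_toVecL2_eq hb hreg.conj ?_
        rw [Complex.star_def, Complex.conj_im]
        linarith
      · rw [hSD.deficiencyIndex_eq hb hreg μ]
        exact DensityData.rank_range_toVecL2_eq hb hreg hgt
    rw [key μp hp.ne', key μm hm.ne]
  refine ⟨main, fun hlim => ?_⟩
  by_contra hne
  rcases main hne with ⟨h, -⟩ | ⟨h, -⟩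
  · exact hlim ⟨0, tendsto_enorm_zero_of_norm h⟩
  · exact hlim ⟨⊤, tendsto_enorm_top_of_norm h⟩
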